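/- **Notation.** All functions live on $\mathbb R$, $\hat f(\xi)=\frac1{\sqrt{2\pi}}\int e^{-i\xi x}f(x)\,dx$, $\mathsf H$ is the Hilbert transform $\widehat{\mathsf Hf}(\xi)=-i\,\mathrm{sgn}(\xi)\hat f(\xi)$, $C_+$ is the Cauchy–Szegő projection $\widehat{C_+f}=1_{[0,\infty)}\hat f$, $\|f\|_{H^\sigma}^2=\int(|\xi|+1)^{2\sigma}|\hat f(\xi)|^2d\xi$, and $H^\sigma_+$ is the space of $f\in H^\sigma(\mathbb R)$ with $\hat f$ supported in $[0,\infty)$. For $A>0$ let $B_A=\{q\in H^s(\mathbb R)\text{ real-valued}:\|q\|_{H^s}\le A\}$. Products of an element of $H^s$ with a constant plus an element of $H^{s+1}$ are taken in $H^s$, and equations hold in the sense of distributions; elements of $H^{s+1}$ are identified with their continuous representatives. **Theorem 4.10.** Fix $s\in(-\frac12,0)$ and put $\varepsilon=\frac12(\frac12-|s|)$. There is a constant $C_s\ge1$, depending only on $s$, such that for every $A>0$, every $q\in B_A$ and every $\kappa\ge\kappa_0(A):=C_s(1+A)^{1/(2\varepsilon)}$ the following hold. 1. There is a unique $m=m(\cdot\,;\kappa,q)\in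 H^{s+1}_+$ with $$m'=-i\kappa m+iC_+[q(m+1)].$$ 2. The functional $\beta(\kappa;q)=\int q\,m(x;\kappa,q)\,dx$ is Fréchet differentiable at $q$ with respect to real-valued variations in $H^s$, and its functional derivative (with respect to the pairing $\int fg\,dx$) is $\frac{\delta\beta}{\delta q}=|m|^2+m+\bar m$. 3. The function $$w=\kappa\tfrac{\delta\beta}{\delta q}=\kappa\bigl(|m|^2+m+\bar m\bigr)$$ is real-valued, belongs to $H^{s+1}(\mathbb R)$, satisfies $\inf_x(\kappa+w(x))>0$ and solves the Bock–Kruskal equation $$2q=\tfrac1{w+\kappa}\mathsf H(w')+\mathsf H\Bigl(\tfrac{w'}{w+\kappa}\Bigr)+\tfrac{2\kappa w}{w+\kappa},$$ and it is the only real-valued $w\in H^{s+1}(\mathbb R)$ with these two properties. -/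

import Mathlib

open MeasureTheory
open scoped SchwartzMap FourierTransform

namespace BockKruskal

noncomputable section

/-! Tempered distributions on the line are Mathlib's `𝓢'(ℝ, ℂ)`, and `T ∈ H^σ(ℝ)` is Mathlib's
`TemperedDistribution.MemSobolev σ 2 T`.  Mathlib's Fourier transform is
`𝓕 f(ξ) = ∫ e^{-2πixξ} f(x) dx`, so that `2πξ` is the angular frequency. -/

/-- The Fourier transform of the tempered distribution `T` is the (locally integrable)
function `F`. -/
def IsFourierDensity (T : 𝓢'(ℝ, ℂ)) (F : ℝ → ℂ) : Prop :=
  AEStronglyMeasurable F volume ∧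
    ∀ φ : 𝓢(ℝ, ℂ), Integrable (fun ξ => F ξ * φ ξ) volume ∧ 𝓕 T φ = ∫ ξ, F ξ * φ ξ

open Classical in
/-- The Fourier transform of `T` as a function.  It exists and is unique almost everywhere
whenever `T` belongs to some `H^σ(ℝ)`; the value is `0` if there is no such function. -/
def fhat (T : 𝓢'(ℝ, ℂ)) : ℝ → ℂ :=
  if h : ∃ F, IsFourierDensity T F then h.choose else 0

/-- The norm `‖T‖_{H^σ}`, whose square is `∫ (|ω| + 1)^{2σ} |T^(ω)|² dω` for the unitary Fourier
transform `T^` in the angular frequency `ω = 2πξ`. It is meaningful for `T ∈ H^σ(ℝ)`. -/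
def sobolevNorm (σ : ℝ) (T : 𝓢'(ℝ, ℂ)) : ℝ :=
  Real.sqrt (∫ ξ, (2 * Real.pi * |ξ| + 1) ^ (2 * σ) * ‖fhat T ξ‖ ^ 2)

/-- A distribution is real-valued if it takes real values on real test functions. -/
def IsRealValued (T : 𝓢'(ℝ, ℂ)) : Prop :=
  ∀ φ : 𝓢(ℝ, ℂ), (∀ x, (φ x).im = 0) → (T φ).im = 0

/-- The ball `B_A` of real-valued `q ∈ H^s(ℝ)` with `‖q‖_{H^s} ≤ A`. -/
def sobolevBall (s A : ℝ) : Set 𝓢'(ℝ, ℂ) :=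
  {q | TemperedDistribution.MemSobolev s 2 q ∧ IsRealValued q ∧ sobolevNorm s q ≤ A}

open Classical in
/-- The Fourier multiplier with symbol `a`: the distribution whose Fourier transform is the
function `a · fhat T`. -/
def multiplier (a : ℝ → ℂ) (T : 𝓢'(ℝ, ℂ)) : 𝓢'(ℝ, ℂ) :=
  if h : ∃ S : 𝓢'(ℝ, ℂ), IsFourierDensity S (fun ξ => a ξ * fhat T ξ) then h.choose else 0

/-- The Hilbert transform, with symbol `-i sgn ξ`. -/
def hilbert : 𝓢'(ℝ, ℂ) → 𝓢'(ℝ, ℂ) :=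
  multiplier (fun ξ => -Complex.I * (SignType.sign ξ : ℝ))

/-- The Cauchy–Szegő projection `C₊`, with symbol the indicator function of `[0, ∞)`. -/
def szegoPlus : 𝓢'(ℝ, ℂ) → 𝓢'(ℝ, ℂ) :=
  multiplier ((Set.Ici (0 : ℝ)).indicator 1)

open Classical in
/-- A square-integrable function, regarded as a tempered distribution. -/
def toDist (u : ℝ → ℂ) : 𝓢'(ℝ, ℂ) :=
  if h : MemLp u 2 volume then ((h.toLp u : Lp ℂ 2 (volume : Measure ℝ)) : 𝓢'(ℝ, ℂ)) else 0

/-- The function `u` belongs to `H^σ(ℝ)`, where `σ ≥ 0`. -/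
def MemSob (σ : ℝ) (u : ℝ → ℂ) : Prop :=
  MemLp u 2 volume ∧ TemperedDistribution.MemSobolev σ 2 (toDist u)

/-- The function `u` belongs to the Hardy–Sobolev space `H^σ_+(ℝ)`: its Fourier transform
vanishes at negative frequencies. -/
def MemHardySob (σ : ℝ) (u : ℝ → ℂ) : Prop :=
  MemSob σ u ∧ ∀ᵐ ξ : ℝ, ξ < 0 → fhat (toDist u) ξ = 0

/-- The bilinear duality pairing `∫ S T dx` of `S ∈ H^σ(ℝ)` and `T ∈ H^{-σ}(ℝ)`, written in
Fourier variables. -/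
def pairing (S T : 𝓢'(ℝ, ℂ)) : ℂ :=
  ∫ ξ, fhat S ξ * fhat T (-ξ)

/-- `P` is the product of the distribution `T` and the function `g`:
`∫ P φ dx = ∫ T (g φ) dx` for every test function `φ`. -/
def IsProduct (g : ℝ → ℂ) (T P : 𝓢'(ℝ, ℂ)) : Prop :=
  ∀ φ : 𝓢(ℝ, ℂ),
    Integrable (fun ξ => fhat T ξ * fhat (toDist (fun x => g x * φ x)) (-ξ)) volume ∧
      P φ = pairing T (toDist (fun x => g x * φ x))

open Classical in
/-- The product `g T`.  For `-1/2 < s < 0` it exists, and lies in `H^s(ℝ)`, whenever `T ∈ H^s(ℝ)`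
and `g` is the sum of a constant and a (continuous) function in `H^{s+1}(ℝ)`. -/
def mulDist (g : ℝ → ℂ) (T : 𝓢'(ℝ, ℂ)) : 𝓢'(ℝ, ℂ) :=
  if h : ∃ P : 𝓢'(ℝ, ℂ), IsProduct g T P then h.choose else 0

/-- `m ∈ H^{s+1}_+(ℝ)`, taken to be its continuous representative, solves
`m' = -iκ m + i C₊[q (m + 1)]` in the sense of distributions. -/
def IsGauge (s κ : ℝ) (q : 𝓢'(ℝ, ℂ)) (m : ℝ → ℂ) : Prop :=
  Continuous m ∧ MemHardySob (s + 1) m ∧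
    TemperedDistribution.derivCLM ℂ (toDist m) =
      (-(Complex.I * κ)) • toDist m + Complex.I • szegoPlus (mulDist (fun x => m x + 1) q)

open Classical in
/-- The gauge `m(x; κ, q)`: the solution of `IsGauge`. -/
def gauge (s κ : ℝ) (q : 𝓢'(ℝ, ℂ)) : ℝ → ℂ :=
  if h : ∃ m, IsGauge s κ q m then h.choose else 0

/-- `β(κ; q) = ∫ q(x) m(x; κ, q) dx`. -/
def beta (s κ : ℝ) (q : 𝓢'(ℝ, ℂ)) : ℂ :=
  pairing q (toDist (gauge s κ q))

/-- `g = δF/δq` at `q`, for a functional `F` of real-valued `q ∈ H^s(ℝ)`: the Fréchet derivative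
of `F` at `q` is `f ↦ ∫ f g dx`, with `g` in the dual space `H^{-s}(ℝ)`. -/
def HasFunctionalDeriv (s : ℝ) (F : 𝓢'(ℝ, ℂ) → ℂ) (q : 𝓢'(ℝ, ℂ)) (g : ℝ → ℂ) : Prop :=
  MemSob (-s) g ∧
    ∀ ε > 0, ∃ δ > 0, ∀ f : 𝓢'(ℝ, ℂ), TemperedDistribution.MemSobolev s 2 f → IsRealValued f →
      sobolevNorm s f ≤ δ →
        ‖F (q + f) - F q - pairing f (toDist g)‖ ≤ ε * sobolevNorm s f

/-- The real-valued `w ∈ H^{s+1}(ℝ)`, taken to be its continuous representative, satisfies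
`inf (κ + w) > 0` and solves the Bock–Kruskal equation
`2q = (w + κ)⁻¹ H(w') + H[w' / (w + κ)] + 2κw / (w + κ)` in the sense of distributions. -/
def IsBKSolution (s κ : ℝ) (q : 𝓢'(ℝ, ℂ)) (w : ℝ → ℝ) : Prop :=
  Continuous w ∧ MemSob (s + 1) (fun x => (w x : ℂ)) ∧
    (∃ δ > 0, ∀ x, δ ≤ κ + w x) ∧
    (2 : ℂ) • q =
      mulDist (fun x => ((1 / (w x + κ) : ℝ) : ℂ))
          (hilbert (TemperedDistribution.derivCLM ℂ (toDist (fun x => (w x : ℂ)))))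
        + hilbert (mulDist (fun x => ((1 / (w x + κ) : ℝ) : ℂ))
            (TemperedDistribution.derivCLM ℂ (toDist (fun x => (w x : ℂ)))))
        + toDist (fun x => ((2 * κ * w x / (w x + κ) : ℝ) : ℂ))

end

end BockKruskal

open MeasureTheory
open scoped SchwartzMap FourierTransform ContDiff ComplexConjugate ENNReal

namespace BockKruskal

/-! Everything is done on the Fourier side, where H^σ is L² with the weight (2π|ξ|+κ)^σ. The
parameter κ is built into the norm, and all κ ≥ 1 give the same space.

The analytic core is one product estimate (`nrm_conv_le`): multiplication by g in H^σ, with 1/2 < σ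
≤ 1, acts on H^τ for 0 ≤ τ ≤ σ with norm at most `prodConst κ σ` times the norm of g. By scaling,
this constant is κ^(1/2-σ) times its value at κ = 1. With σ = s+1 and τ = -s, duality gives products
H^{s+1} · H^s → H^s with a factor κ^{-(1/2-|s|)}. This factor is small exactly above the threshold
for κ.

On nonnegative frequencies d/dx + iκ has symbol i(2πξ+κ), so the gauge equation is a fixed-point
problem that is contractive for such κ. This gives existence, uniqueness, Lipschitz dependence on q
and |m| ≤ 1/2.

For the derivative of β, the equations for q and q+f are tested against each other. The derivative
part is symmetric and drops out, leaving the exact remainder ∫ f (1+m̄)(n-m)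
(`IsGauge.pairing_sub`), which is quadratic in f.

For the Bock–Kruskal equation, write w+κ = κ|1+m|² with 1+m invertible in the Hardy algebra. Then
w'/(w+κ) = m'/(1+m) + its conjugate, and H acts as -i and +i on the two parts. Tested against
(w+κ)ψ̄ with ψ of positive frequency, the equation becomes 2κ times the gauge equation tested with
(1+m)ψ. As 1+m is invertible, the two equations are equivalent (`Factorization.bk_iff_isGauge`).

Uniqueness of w follows because every admissible w has such a factorization: split log(1+w/κ) into a
Hardy function and a conjugate one, and exponentiate. The logarithm, exponential and inverse stay in
H^{s+1} by the Gagliardo seminorm (`MemSob.of_lipschitz`), and in the Hardy class by power series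
(`posFreq_of_hasSum`). The factor m then solves the gauge equation, which has only one solution. -/

/-! ### Weighted L² spaces of Fourier densities and their match with H^σ. -/

/-- The frequency weight `2π|ξ| + κ`. -/
noncomputable def wt (κ ξ : ℝ) : ℝ := 2 * Real.pi * |ξ| + κ

/-- The Fourier densities of the elements of `H^σ(ℝ)`. -/
def MemW (σ : ℝ) (F : ℝ → ℂ) : Prop :=
  ∀ κ : ℝ, 1 ≤ κ → MemLp (fun ξ => ((wt κ ξ ^ σ : ℝ) : ℂ) * F ξ) 2 volume

/-- The weighted norm of a Fourier density. -/
noncomputable def nrm (κ σ : ℝ) (F : ℝ → ℂ) : ℝ :=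
  (eLpNorm (fun ξ => ((wt κ ξ ^ σ : ℝ) : ℂ) * F ξ) 2 volume).toReal

theorem wt_pos {κ : ℝ} (hκ : 1 ≤ κ) (ξ : ℝ) : 0 < wt κ ξ := by
  unfold wt; positivity

theorem one_le_wt {κ : ℝ} (hκ : 1 ≤ κ) (ξ : ℝ) : 1 ≤ wt κ ξ := by
  unfold wt; nlinarith [abs_nonneg ξ, Real.pi_pos, mul_nonneg Real.pi_pos.le (abs_nonneg ξ)]

@[simp] theorem wt_neg (κ ξ : ℝ) : wt κ (-ξ) = wt κ ξ := by simp [wt]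

theorem continuous_wt (κ : ℝ) : Continuous (wt κ) := by unfold wt; fun_prop

theorem continuous_wt_rpow {κ : ℝ} (hκ : 1 ≤ κ) (σ : ℝ) : Continuous (fun ξ => wt κ ξ ^ σ) :=
  (continuous_wt κ).rpow_const fun ξ => Or.inl (wt_pos hκ ξ).ne'

theorem continuous_wt_rpow_ofReal {κ : ℝ} (hκ : 1 ≤ κ) (σ : ℝ) :
    Continuous (fun ξ => ((wt κ ξ ^ σ : ℝ) : ℂ)) :=
  Complex.continuous_ofReal.comp (continuous_wt_rpow hκ σ)

/-- Comparability in both directions is needed because the sign of σ is free: one bound serves σ ≥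
0, the other σ ≤ 0. -/
theorem rpow_le_of_comparable {a b C : ℝ} (ha : 0 < a) (hb : 0 < b) (hC : 1 ≤ C)
    (h1 : a ≤ C * b) (h2 : b ≤ C * a) (σ : ℝ) : a ^ σ ≤ C ^ |σ| * b ^ σ := by
  have hC0 : 0 < C := by linarith
  rcases le_total 0 σ with h | h
  · rw [abs_of_nonneg h, ← Real.mul_rpow hC0.le hb.le]
    exact Real.rpow_le_rpow ha.le h1 h
  · rw [abs_of_nonpos h, Real.rpow_neg hC0.le, ← Real.inv_rpow hC0.le,
      ← Real.mul_rpow (by positivity) hb.le]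
    apply Real.rpow_le_rpow_of_nonpos (by positivity) _ h
    rw [inv_mul_le_iff₀ hC0]; exact h2

theorem memLp_weight_of_comparable {v w : ℝ → ℝ} (hv : Continuous v) (hw : Continuous w)
    (hv0 : ∀ ξ, 0 < v ξ) (hw0 : ∀ ξ, 0 < w ξ) {C : ℝ} (hC : 1 ≤ C)
    (h1 : ∀ ξ, v ξ ≤ C * w ξ) (h2 : ∀ ξ, w ξ ≤ C * v ξ) {σ : ℝ} {F : ℝ → ℂ}
    (h : MemLp (fun ξ => ((w ξ ^ σ : ℝ) : ℂ) * F ξ) 2 volume) :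
    MemLp (fun ξ => ((v ξ ^ σ : ℝ) : ℂ) * F ξ) 2 volume := by
  have hvc : Continuous fun ξ => ((v ξ ^ σ : ℝ) : ℂ) :=
    Complex.continuous_ofReal.comp (hv.rpow_const fun ξ => Or.inl (hv0 ξ).ne')
  have hwc : Continuous fun ξ => ((w ξ ^ (-σ) : ℝ) : ℂ) :=
    Complex.continuous_ofReal.comp (hw.rpow_const fun ξ => Or.inl (hw0 ξ).ne')
  refine MemLp.of_le_mul (c := C ^ |σ|) h ?_ ?_
  · have : (fun ξ => ((v ξ ^ σ : ℝ) : ℂ) * F ξ) =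
        fun ξ => ((v ξ ^ σ : ℝ) : ℂ) * (((w ξ ^ (-σ) : ℝ) : ℂ) * (((w ξ ^ σ : ℝ) : ℂ) * F ξ)) := by
      ext ξ
      rw [← mul_assoc ((w ξ ^ (-σ) : ℝ) : ℂ), ← Complex.ofReal_mul, ← Real.rpow_add (hw0 ξ)]
      simp
    rw [this]
    exact hvc.aestronglyMeasurable.mul (hwc.aestronglyMeasurable.mul h.1)
  · refine Filter.Eventually.of_forall fun ξ => ?_
    rw [norm_mul, norm_mul, ← mul_assoc, Complex.norm_real, Complex.norm_real,
      Real.norm_of_nonneg (Real.rpow_nonneg (hv0 ξ).le _),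
      Real.norm_of_nonneg (Real.rpow_nonneg (hw0 ξ).le _)]
    gcongr
    exact rpow_le_of_comparable (hv0 ξ) (hw0 ξ) hC (h1 ξ) (h2 ξ) σ

/-- The weights for κ and κ' are comparable with constant κκ', so a single κ decides membership in
`MemW`. -/
theorem memW_of_memLp {κ σ : ℝ} (hκ : 1 ≤ κ) {F : ℝ → ℂ}
    (h : MemLp (fun ξ => ((wt κ ξ ^ σ : ℝ) : ℂ) * F ξ) 2 volume) : MemW σ F := by
  intro κ' hκ'
  refine memLp_weight_of_comparable (continuous_wt κ') (continuous_wt κ) (wt_pos hκ') (wt_pos hκ)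
    (C := κ * κ') (by nlinarith) ?_ ?_ h
  · intro ξ; unfold wt
    have := mul_nonneg Real.pi_pos.le (abs_nonneg ξ)
    nlinarith [mul_nonneg this (show 0 ≤ κ * κ' - 1 by nlinarith), mul_le_mul hκ hκ (by norm_num) (by linarith)]
  · intro ξ; unfold wt
    have := mul_nonneg Real.pi_pos.le (abs_nonneg ξ)
    nlinarith [mul_nonneg this (show 0 ≤ κ * κ' - 1 by nlinarith), mul_le_mul hκ' hκ' (by norm_num) (by linarith)]

/-- The Bessel weight. -/
noncomputable def bes (ξ : ℝ) : ℝ := (1 + ‖ξ‖ ^ 2) ^ (1 / 2 : ℝ)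

theorem bes_pos (ξ : ℝ) : 0 < bes ξ := by unfold bes; positivity

theorem continuous_bes : Continuous bes :=
  Continuous.rpow_const (by fun_prop) fun ξ => Or.inl (by positivity)

theorem bes_rpow (σ ξ : ℝ) : bes ξ ^ σ = (1 + ‖ξ‖ ^ 2) ^ (σ / 2) := by
  unfold bes; rw [← Real.rpow_mul (by positivity)]; congr 1; ring

theorem bes_le_wt (ξ : ℝ) : bes ξ ≤ wt 1 ξ := by
  unfold bes wt
  rw [← Real.sqrt_eq_rpow, Real.sqrt_le_left (by positivity), Real.norm_eq_abs]
  have h := Real.pi_gt_three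
  have h2 := abs_nonneg ξ
  have : |ξ| ≤ 2 * Real.pi * |ξ| := by nlinarith
  nlinarith

theorem wt_le_bes (ξ : ℝ) : wt 1 ξ ≤ (2 * Real.pi + 1) * bes ξ := by
  have h1 : |ξ| ≤ bes ξ := by
    unfold bes; rw [← Real.sqrt_eq_rpow]; apply Real.le_sqrt_of_sq_le; rw [Real.norm_eq_abs]; linarith
  have h2 : 1 ≤ bes ξ := by
    unfold bes; rw [← Real.sqrt_eq_rpow]; apply Real.le_sqrt_of_sq_le; nlinarith [sq_nonneg ‖ξ‖]
  unfold wt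
  nlinarith [Real.pi_pos]

/-- Bridge to the Bessel weight (1+ξ²)^(1/2), in which `MemSobolev` is expressed. -/
theorem memW_iff_bes {σ : ℝ} {F : ℝ → ℂ} :
    MemW σ F ↔ MemLp (fun ξ => ((bes ξ ^ σ : ℝ) : ℂ) * F ξ) 2 volume := by
  have hC : 1 ≤ 2 * Real.pi + 1 := by linarith [Real.pi_pos]
  have h1 : ∀ ξ, bes ξ ≤ (2 * Real.pi + 1) * wt 1 ξ := fun ξ =>
    (bes_le_wt ξ).trans (le_mul_of_one_le_left (wt_pos le_rfl ξ).le hC)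
  constructor
  · intro h
    exact memLp_weight_of_comparable continuous_bes (continuous_wt 1) bes_pos (wt_pos le_rfl) hC
      h1 wt_le_bes (h 1 le_rfl)
  · intro h
    exact memW_of_memLp le_rfl (memLp_weight_of_comparable (continuous_wt 1) continuous_bes
      (wt_pos le_rfl) bes_pos hC wt_le_bes h1 h)

theorem MemW.aestronglyMeasurable {σ : ℝ} {F : ℝ → ℂ} (h : MemW σ F) :
    AEStronglyMeasurable F volume := by
  have : F = fun ξ => ((wt 1 ξ ^ (-σ) : ℝ) : ℂ) * (((wt 1 ξ ^ σ : ℝ) : ℂ) * F ξ) := by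
    ext ξ
    rw [← mul_assoc, ← Complex.ofReal_mul, ← Real.rpow_add (wt_pos le_rfl ξ)]
    simp
  rw [this]
  exact (continuous_wt_rpow_ofReal le_rfl _).aestronglyMeasurable.mul (h 1 le_rfl).1

theorem hasTemperateGrowth_bes (σ : ℝ) :
    (fun ξ : ℝ => (((1 + ‖ξ‖ ^ 2) ^ (σ / 2) : ℝ) : ℂ)).HasTemperateGrowth := by
  have := Function.hasTemperateGrowth_one_add_norm_sq_rpow ℝ (σ / 2)
  fun_prop

/-- The weight is moved onto the test function: both factors are then square-integrable. -/
theorem integrable_mul_schwartz_of_memW {σ : ℝ} {F : ℝ → ℂ} (h : MemW σ F) (φ : 𝓢(ℝ, ℂ)) :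
    Integrable (fun ξ => F ξ * φ ξ) volume := by
  have h1 := memW_iff_bes.1 h
  have h2 := (SchwartzMap.smulLeftCLM ℂ (fun ξ : ℝ => (((1 + ‖ξ‖ ^ 2) ^ (-σ / 2) : ℝ) : ℂ)) φ).memLp
    2 volume
  convert MemLp.integrable_mul (p := 2) (q := 2) h1 h2 using 1
  ext ξ
  simp only [Pi.mul_apply]
  rw [SchwartzMap.smulLeftCLM_apply_apply (by exact hasTemperateGrowth_bes (-σ)), ← bes_rpow, smul_eq_mul]
  have : ((bes ξ ^ σ : ℝ) : ℂ) * ((bes ξ ^ (-σ) : ℝ) : ℂ) = 1 := by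
    rw [← Complex.ofReal_mul, ← Real.rpow_add (bes_pos ξ)]; simp
  linear_combination (- F ξ * φ ξ) * this

theorem exists_isFourierDensity {σ : ℝ} {F : ℝ → ℂ} (h : MemW σ F) :
    ∃ T : 𝓢'(ℝ, ℂ), IsFourierDensity T F := by
  have h1 := memW_iff_bes.1 h
  refine ⟨𝓕⁻ (TemperedDistribution.smulLeftCLM ℂ
    (fun ξ : ℝ => (((1 + ‖ξ‖ ^ 2) ^ (-σ / 2) : ℝ) : ℂ)) (h1.toLp _ : 𝓢'(ℝ, ℂ))),
    h.aestronglyMeasurable, fun φ => ⟨integrable_mul_schwartz_of_memW h φ, ?_⟩⟩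
  rw [FourierTransform.fourier_fourierInv_eq, TemperedDistribution.smulLeftCLM_apply_apply,
    Lp.toTemperedDistribution_apply]
  apply integral_congr_ae
  filter_upwards [h1.coeFn_toLp] with ξ hξ
  rw [hξ, SchwartzMap.smulLeftCLM_apply_apply (by exact hasTemperateGrowth_bes (-σ)), ← bes_rpow, smul_eq_mul,
    smul_eq_mul]
  have : ((bes ξ ^ σ : ℝ) : ℂ) * ((bes ξ ^ (-σ) : ℝ) : ℂ) = 1 := by
    rw [← Complex.ofReal_mul, ← Real.rpow_add (bes_pos ξ)]; simp
  linear_combination (F ξ * φ ξ) * this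

theorem MemW.memSobolev {σ : ℝ} {F : ℝ → ℂ} (h : MemW σ F) {T : 𝓢'(ℝ, ℂ)}
    (hT : IsFourierDensity T F) : TemperedDistribution.MemSobolev σ 2 T := by
  rw [TemperedDistribution.memSobolev_iff_exists_smulLeftCLM_fourier]
  have h1 := memW_iff_bes.1 h
  refine ⟨h1.toLp _, ?_⟩
  ext φ
  rw [TemperedDistribution.smulLeftCLM_apply_apply, Lp.toTemperedDistribution_apply, (hT.2 _).2]
  apply integral_congr_ae
  filter_upwards [h1.coeFn_toLp] with ξ hξ
  rw [hξ, SchwartzMap.smulLeftCLM_apply_apply (by exact hasTemperateGrowth_bes σ), ← bes_rpow, smul_eq_mul, smul_eq_mul]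
  ring

theorem exists_density_of_memSobolev {σ : ℝ} {T : 𝓢'(ℝ, ℂ)}
    (hT : TemperedDistribution.MemSobolev σ 2 T) : ∃ F, IsFourierDensity T F ∧ MemW σ F := by
  obtain ⟨f, hf⟩ := TemperedDistribution.memSobolev_iff_exists_smulLeftCLM_fourier.1 hT
  have hmul : ∀ ξ, ((bes ξ ^ σ : ℝ) : ℂ) * ((bes ξ ^ (-σ) : ℝ) : ℂ) = 1 := fun ξ => by
    rw [← Complex.ofReal_mul, ← Real.rpow_add (bes_pos ξ)]; simp
  have hW : MemW σ (fun ξ => ((bes ξ ^ (-σ) : ℝ) : ℂ) * f ξ) := by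
    rw [memW_iff_bes]
    refine (Lp.memLp f).ae_eq (Filter.Eventually.of_forall fun ξ => ?_)
    simp only
    rw [← mul_assoc, hmul, one_mul]
  refine ⟨_, ⟨hW.aestronglyMeasurable, fun φ => ⟨integrable_mul_schwartz_of_memW hW φ, ?_⟩⟩, hW⟩
  have hφ : φ = SchwartzMap.smulLeftCLM ℂ (fun ξ : ℝ => (((1 + ‖ξ‖ ^ 2) ^ (σ / 2) : ℝ) : ℂ))
      (SchwartzMap.smulLeftCLM ℂ (fun ξ : ℝ => (((1 + ‖ξ‖ ^ 2) ^ (-σ / 2) : ℝ) : ℂ)) φ) := by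
    ext ξ
    rw [SchwartzMap.smulLeftCLM_apply_apply (by exact hasTemperateGrowth_bes σ),
      SchwartzMap.smulLeftCLM_apply_apply (by exact hasTemperateGrowth_bes (-σ)), ← bes_rpow, ← bes_rpow, smul_eq_mul,
      smul_eq_mul, ← mul_assoc, hmul, one_mul]
  conv_lhs => rw [hφ]
  rw [← TemperedDistribution.smulLeftCLM_apply_apply, hf, Lp.toTemperedDistribution_apply]
  congr 1
  ext ξ
  rw [SchwartzMap.smulLeftCLM_apply_apply (by exact hasTemperateGrowth_bes (-σ)), ← bes_rpow, smul_eq_mul, smul_eq_mul]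
  ring

/-! ### Uniqueness and linearity of Fourier densities; monotonicity of the norms. -/

/-- Test with a smooth bump that equals 1 near the point. -/
theorem IsFourierDensity.locallyIntegrable {T : 𝓢'(ℝ, ℂ)} {F : ℝ → ℂ} (h : IsFourierDensity T F) :
    LocallyIntegrable F volume := by
  intro x
  let b : ContDiffBump x := ⟨1, 2, one_pos, one_lt_two⟩
  have hc : HasCompactSupport (Complex.ofRealCLM ∘ b) := b.hasCompactSupport.comp_left rfl
  have hd : ContDiff ℝ ∞ (Complex.ofRealCLM ∘ b) := Complex.ofRealCLM.contDiff.comp b.contDiff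
  refine ⟨Metric.closedBall x 1, Metric.closedBall_mem_nhds x one_pos, ?_⟩
  refine ((h.2 (hc.toSchwartzMap hd)).1.integrableOn (s := Metric.closedBall x 1)).congr_fun
    (fun y hy => ?_) Metric.isClosed_closedBall.measurableSet
  simp [b.one_of_mem_closedBall hy]

theorem ae_eq_of_integral_schwartz {F G : ℝ → ℂ} (hF : LocallyIntegrable F volume)
    (hG : LocallyIntegrable G volume)
    (h : ∀ φ : 𝓢(ℝ, ℂ), ∫ ξ, F ξ * φ ξ = ∫ ξ, G ξ * φ ξ) : F =ᵐ[volume] G := by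
  refine ae_eq_of_integral_contDiff_smul_eq hF hG fun g hg hgc => ?_
  have hc : HasCompactSupport (Complex.ofRealCLM ∘ g) := hgc.comp_left rfl
  have hd : ContDiff ℝ ∞ (Complex.ofRealCLM ∘ g) := Complex.ofRealCLM.contDiff.comp hg
  simpa [mul_comm] using h (hc.toSchwartzMap hd)

theorem IsFourierDensity.ae_eq {T : 𝓢'(ℝ, ℂ)} {F G : ℝ → ℂ} (hF : IsFourierDensity T F)
    (hG : IsFourierDensity T G) : F =ᵐ[volume] G :=
  ae_eq_of_integral_schwartz hF.locallyIntegrable hG.locallyIntegrable fun φ => by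
    rw [← (hF.2 φ).2, ← (hG.2 φ).2]

theorem IsFourierDensity.isFourierDensity_fhat {T : 𝓢'(ℝ, ℂ)} {F : ℝ → ℂ}
    (hF : IsFourierDensity T F) : IsFourierDensity T (fhat T) := by
  have h : ∃ F, IsFourierDensity T F := ⟨F, hF⟩
  rw [fhat, dif_pos h]; exact h.choose_spec

theorem IsFourierDensity.fhat_ae_eq {T : 𝓢'(ℝ, ℂ)} {F : ℝ → ℂ} (hF : IsFourierDensity T F) :
    fhat T =ᵐ[volume] F :=
  hF.isFourierDensity_fhat.ae_eq hF

theorem IsFourierDensity.congr {T : 𝓢'(ℝ, ℂ)} {F G : ℝ → ℂ} (hF : IsFourierDensity T F)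
    (h : F =ᵐ[volume] G) : IsFourierDensity T G := by
  refine ⟨hF.1.congr h, fun φ => ?_⟩
  have h2 : (fun ξ => F ξ * φ ξ) =ᵐ[volume] fun ξ => G ξ * φ ξ := by
    filter_upwards [h] with ξ hξ; rw [hξ]
  exact ⟨(hF.2 φ).1.congr h2, (hF.2 φ).2.trans (integral_congr_ae h2)⟩

theorem IsFourierDensity.ext {T S : 𝓢'(ℝ, ℂ)} {F G : ℝ → ℂ} (hF : IsFourierDensity T F)
    (hG : IsFourierDensity S G) (h : F =ᵐ[volume] G) : T = S := by
  have : 𝓕 T = 𝓕 S := by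
    ext φ
    rw [((hF.congr h).2 φ).2, (hG.2 φ).2]
  have h2 := congrArg (fun U : 𝓢'(ℝ, ℂ) => (𝓕⁻ U : 𝓢'(ℝ, ℂ))) this
  simpa using h2

theorem IsFourierDensity.add {T S : 𝓢'(ℝ, ℂ)} {F G : ℝ → ℂ} (hF : IsFourierDensity T F)
    (hG : IsFourierDensity S G) : IsFourierDensity (T + S) (fun ξ => F ξ + G ξ) := by
  refine ⟨hF.1.add hG.1, fun φ => ?_⟩
  simp only [add_mul]
  refine ⟨(hF.2 φ).1.add (hG.2 φ).1, ?_⟩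
  rw [integral_add (hF.2 φ).1 (hG.2 φ).1, ← (hF.2 φ).2, ← (hG.2 φ).2, FourierTransform.fourier_add]
  rfl

theorem IsFourierDensity.smul {T : 𝓢'(ℝ, ℂ)} {F : ℝ → ℂ} (hF : IsFourierDensity T F) (c : ℂ) :
    IsFourierDensity (c • T) (fun ξ => c * F ξ) := by
  refine ⟨hF.1.const_mul c, fun φ => ?_⟩
  simp only [mul_assoc]
  refine ⟨(hF.2 φ).1.const_mul c, ?_⟩
  rw [integral_const_mul, ← (hF.2 φ).2, FourierTransform.fourier_smul]
  rfl

theorem MemW.congr {σ : ℝ} {F G : ℝ → ℂ} (hF : MemW σ F) (h : F =ᵐ[volume] G) : MemW σ G :=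
  fun κ hκ => (hF κ hκ).ae_eq (by filter_upwards [h] with ξ hξ; rw [hξ])

theorem nrm_congr {F G : ℝ → ℂ} (h : F =ᵐ[volume] G) (κ σ : ℝ) : nrm κ σ F = nrm κ σ G := by
  unfold nrm
  rw [eLpNorm_congr_ae]
  filter_upwards [h] with ξ hξ; rw [hξ]

theorem MemW.add {σ : ℝ} {F G : ℝ → ℂ} (hF : MemW σ F) (hG : MemW σ G) :
    MemW σ (fun ξ => F ξ + G ξ) := by
  intro κ hκ
  simp only [mul_add]
  exact (hF κ hκ).add (hG κ hκ)

theorem MemW.const_mul {σ : ℝ} {F : ℝ → ℂ} (hF : MemW σ F) (c : ℂ) : MemW σ (fun ξ => c * F ξ) := by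
  intro κ hκ
  simp only [mul_left_comm _ c]
  exact (hF κ hκ).const_mul c

theorem nrm_add_le {κ σ : ℝ} (hκ : 1 ≤ κ) {F G : ℝ → ℂ} (hF : MemW σ F) (hG : MemW σ G) :
    nrm κ σ (fun ξ => F ξ + G ξ) ≤ nrm κ σ F + nrm κ σ G := by
  unfold nrm
  rw [← ENNReal.toReal_add (hF κ hκ).2.ne (hG κ hκ).2.ne]
  refine ENNReal.toReal_mono (ENNReal.add_ne_top.2 ⟨(hF κ hκ).2.ne, (hG κ hκ).2.ne⟩) ?_
  simp only [mul_add]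
  exact eLpNorm_add_le (hF κ hκ).1 (hG κ hκ).1 one_le_two

theorem nrm_const_mul (κ σ : ℝ) (F : ℝ → ℂ) (c : ℂ) :
    nrm κ σ (fun ξ => c * F ξ) = ‖c‖ * nrm κ σ F := by
  unfold nrm
  simp only [mul_left_comm _ c]
  have : (fun ξ => c * (((wt κ ξ ^ σ : ℝ) : ℂ) * F ξ)) = c • fun ξ => ((wt κ ξ ^ σ : ℝ) : ℂ) * F ξ := rfl
  rw [this, eLpNorm_const_smul, ENNReal.toReal_mul]
  simp

theorem nrm_nonneg (κ σ : ℝ) (F : ℝ → ℂ) : 0 ≤ nrm κ σ F := ENNReal.toReal_nonneg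

theorem isFourierDensity_fhat {σ : ℝ} {T : 𝓢'(ℝ, ℂ)}
    (hT : TemperedDistribution.MemSobolev σ 2 T) : IsFourierDensity T (fhat T) := by
  obtain ⟨F, hF, -⟩ := exists_density_of_memSobolev hT
  exact hF.isFourierDensity_fhat

theorem memW_fhat {σ : ℝ} {T : 𝓢'(ℝ, ℂ)}
    (hT : TemperedDistribution.MemSobolev σ 2 T) : MemW σ (fhat T) := by
  obtain ⟨F, hF, hW⟩ := exists_density_of_memSobolev hT
  exact hW.congr hF.fhat_ae_eq.symm

theorem ext_of_fhat {σ σ' : ℝ} {T S : 𝓢'(ℝ, ℂ)} (hT : TemperedDistribution.MemSobolev σ 2 T)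
    (hS : TemperedDistribution.MemSobolev σ' 2 S) (h : fhat T =ᵐ[volume] fhat S) : T = S :=
  (isFourierDensity_fhat hT).ext (isFourierDensity_fhat hS) h

theorem fhat_add {σ : ℝ} {T S : 𝓢'(ℝ, ℂ)} (hT : TemperedDistribution.MemSobolev σ 2 T)
    (hS : TemperedDistribution.MemSobolev σ 2 S) :
    fhat (T + S) =ᵐ[volume] fun ξ => fhat T ξ + fhat S ξ :=
  ((isFourierDensity_fhat hT).add (isFourierDensity_fhat hS)).fhat_ae_eq

theorem fhat_smul {σ : ℝ} {T : 𝓢'(ℝ, ℂ)} (hT : TemperedDistribution.MemSobolev σ 2 T) (c : ℂ) :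
    fhat (c • T) =ᵐ[volume] fun ξ => c * fhat T ξ :=
  ((isFourierDensity_fhat hT).smul c).fhat_ae_eq

theorem exists_fhat_eq {σ : ℝ} {F : ℝ → ℂ} (h : MemW σ F) :
    ∃ T : 𝓢'(ℝ, ℂ), TemperedDistribution.MemSobolev σ 2 T ∧ fhat T =ᵐ[volume] F := by
  obtain ⟨T, hT⟩ := exists_isFourierDensity h
  exact ⟨T, h.memSobolev hT, hT.fhat_ae_eq⟩

/-- `MemW` is monotone, and the weighted norm as well. -/
theorem weight_rpow_mono {κ σ τ : ℝ} (hκ : 1 ≤ κ) (h : τ ≤ σ) (ξ : ℝ) :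
    wt κ ξ ^ τ ≤ wt κ ξ ^ σ :=
  Real.rpow_le_rpow_of_exponent_le (one_le_wt hκ ξ) h

theorem eLpNorm_weight_mono {v w : ℝ → ℝ} (hv : ∀ ξ, 0 ≤ v ξ) (h : ∀ ξ, v ξ ≤ w ξ) (F : ℝ → ℂ) :
    eLpNorm (fun ξ => ((v ξ : ℝ) : ℂ) * F ξ) 2 volume ≤
      eLpNorm (fun ξ => ((w ξ : ℝ) : ℂ) * F ξ) 2 volume := by
  refine eLpNorm_mono fun ξ => ?_
  rw [norm_mul, norm_mul, Complex.norm_real, Complex.norm_real, Real.norm_of_nonneg (hv ξ),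
    Real.norm_of_nonneg ((hv ξ).trans (h ξ))]
  exact mul_le_mul_of_nonneg_right (h ξ) (norm_nonneg _)

theorem MemW.mono {σ τ : ℝ} (h : τ ≤ σ) {F : ℝ → ℂ} (hF : MemW σ F) : MemW τ F := by
  intro κ hκ
  refine ⟨(continuous_wt_rpow_ofReal hκ τ).aestronglyMeasurable.mul hF.aestronglyMeasurable, ?_⟩
  exact (eLpNorm_weight_mono (fun ξ => (Real.rpow_nonneg (wt_pos hκ ξ).le _))
    (weight_rpow_mono hκ h) F).trans_lt (hF κ hκ).2

theorem nrm_mono {κ σ τ : ℝ} (hκ : 1 ≤ κ) (h : τ ≤ σ) {F : ℝ → ℂ} (hF : MemW σ F) :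
    nrm κ τ F ≤ nrm κ σ F :=
  ENNReal.toReal_mono (hF κ hκ).2.ne (eLpNorm_weight_mono
    (fun ξ => (Real.rpow_nonneg (wt_pos hκ ξ).le _)) (weight_rpow_mono hκ h) F)

/-- For σ ≤ 0 a larger κ only shrinks the weight. This is how the radius A, measured at κ = 1,
controls q in the norm of every κ. -/
theorem nrm_le_nrm_one {κ σ : ℝ} (hκ : 1 ≤ κ) (hσ : σ ≤ 0) {F : ℝ → ℂ} (hF : MemW σ F) :
    nrm κ σ F ≤ nrm 1 σ F := by
  refine ENNReal.toReal_mono (hF 1 le_rfl).2.ne (eLpNorm_weight_mono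
    (fun ξ => (Real.rpow_nonneg (wt_pos hκ ξ).le _)) (fun ξ => ?_) F)
  exact Real.rpow_le_rpow_of_nonpos (wt_pos le_rfl ξ) (by unfold wt; linarith) hσ

theorem sobolevNorm_eq_nrm {σ : ℝ} {T : 𝓢'(ℝ, ℂ)} (hT : TemperedDistribution.MemSobolev σ 2 T) :
    sobolevNorm σ T = nrm 1 σ (fhat T) := by
  have h := memW_fhat hT 1 le_rfl
  unfold sobolevNorm nrm
  rw [h.eLpNorm_eq_integral_rpow_norm (by norm_num) (by norm_num), ENNReal.toReal_ofReal (by positivity),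
    Real.sqrt_eq_rpow]
  simp only [ENNReal.toReal_ofNat]
  congr 1
  · congr 1
    ext ξ
    rw [norm_mul, Complex.norm_real, Real.norm_of_nonneg (Real.rpow_nonneg (wt_pos le_rfl ξ).le _)]
    rw [Real.mul_rpow (Real.rpow_nonneg (wt_pos le_rfl ξ).le _) (norm_nonneg _),
      ← Real.rpow_mul (wt_pos le_rfl ξ).le, Real.rpow_two, mul_comm σ 2]
    rfl
  · norm_num

/-! ### Derivatives -/

theorem IsFourierDensity.derivCLM {σ : ℝ} {T : 𝓢'(ℝ, ℂ)} {F : ℝ → ℂ} (hF : IsFourierDensity T F)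
    (hW : MemW σ F) :
    IsFourierDensity (TemperedDistribution.derivCLM ℂ T) (fun ξ => 2 * Real.pi * Complex.I * ξ * F ξ) ∧
      MemW (σ - 1) (fun ξ => 2 * Real.pi * Complex.I * ξ * F ξ) := by
  have hm : AEStronglyMeasurable (fun ξ : ℝ => 2 * Real.pi * Complex.I * ξ * F ξ) volume :=
    (Continuous.aestronglyMeasurable (by fun_prop)).mul hF.1
  have hW' : MemW (σ - 1) (fun ξ : ℝ => 2 * Real.pi * Complex.I * ξ * F ξ) := by
    intro κ hκ
    refine (hW κ hκ).of_le ((continuous_wt_rpow_ofReal hκ _).aestronglyMeasurable.mul hm)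
      (Filter.Eventually.of_forall fun ξ => ?_)
    have h1 : ‖(2 * Real.pi * Complex.I * ξ : ℂ)‖ ≤ wt κ ξ := by
      simp only [norm_mul, Complex.norm_I, Complex.norm_real, Complex.norm_ofNat, mul_one,
        Real.norm_eq_abs, abs_of_pos Real.pi_pos, wt]
      linarith
    rw [norm_mul, norm_mul _ (F ξ), norm_mul _ (F ξ), Complex.norm_real, Complex.norm_real,
      Real.norm_of_nonneg (Real.rpow_nonneg (wt_pos hκ ξ).le _),
      Real.norm_of_nonneg (Real.rpow_nonneg (wt_pos hκ ξ).le _), ← mul_assoc]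
    gcongr
    calc wt κ ξ ^ (σ - 1) * ‖(2 * Real.pi * Complex.I * ξ : ℂ)‖ ≤ wt κ ξ ^ (σ - 1) * wt κ ξ :=
          mul_le_mul_of_nonneg_left h1 (Real.rpow_nonneg (wt_pos hκ ξ).le _)
      _ = wt κ ξ ^ σ := by
          rw [← Real.rpow_add_one (wt_pos hκ ξ).ne']; congr 1; ring
  refine ⟨⟨hm, fun φ => ⟨integrable_mul_schwartz_of_memW hW' φ, ?_⟩⟩, hW'⟩
  have h2 : (id : ℝ → ℝ).HasTemperateGrowth := by fun_prop
  -- The transpose of the claim on test functions: differentiating a Fourier transform multiplies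
  -- the function by -2πiξ.
  have key : -SchwartzMap.derivCLM ℂ ℂ (𝓕 φ) =
      𝓕 (((2 * Real.pi * Complex.I : ℂ)) • SchwartzMap.smulLeftCLM ℂ (fun ξ : ℝ => (ξ : ℂ)) φ) := by
    ext x
    have hd : HasDerivAt (𝓕 (φ : ℝ → ℂ)) (𝓕 (fun x : ℝ => (-2 * Real.pi * Complex.I * x) • φ x) x) x := by
      refine Real.hasDerivAt_fourier φ.integrable ?_ x
      have := (SchwartzMap.smulLeftCLM ℂ (fun ξ : ℝ => ξ) φ).integrable (μ := volume)
      refine this.congr (Filter.Eventually.of_forall fun ξ => ?_)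
      simp only
      rw [SchwartzMap.smulLeftCLM_apply_apply (by fun_prop)]
    simp only [neg_apply, SchwartzMap.derivCLM_apply]
    rw [SchwartzMap.fourier_coe, hd.deriv, SchwartzMap.fourier_coe]
    simp only [Real.fourier_eq', smul_apply, ← integral_neg]
    congr 1
    ext v
    rw [SchwartzMap.smulLeftCLM_apply_apply (by fun_prop)]
    simp only [smul_eq_mul]
    ring
  rw [TemperedDistribution.fourier_apply, TemperedDistribution.derivCLM_apply_apply, key,
    ← TemperedDistribution.fourier_apply, (hF.2 _).2]
  congr 1
  ext ξ
  rw [smul_apply, SchwartzMap.smulLeftCLM_apply_apply (by fun_prop)]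
  simp only [smul_eq_mul]
  ring

theorem memSobolev_derivCLM {σ : ℝ} {T : 𝓢'(ℝ, ℂ)} (hT : TemperedDistribution.MemSobolev (σ + 1) 2 T) :
    TemperedDistribution.MemSobolev σ 2 (TemperedDistribution.derivCLM ℂ T) := by
  have h := (isFourierDensity_fhat hT).derivCLM (memW_fhat hT)
  rw [add_sub_cancel_right] at h
  exact h.2.memSobolev h.1

theorem fhat_derivCLM {σ : ℝ} {T : 𝓢'(ℝ, ℂ)} (hT : TemperedDistribution.MemSobolev σ 2 T) :
    fhat (TemperedDistribution.derivCLM ℂ T) =ᵐ[volume]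
      fun ξ => 2 * Real.pi * Complex.I * ξ * fhat T ξ :=
  ((isFourierDensity_fhat hT).derivCLM (memW_fhat hT)).1.fhat_ae_eq

/-! ### Fourier densities of square-integrable functions. -/

/-- The Fourier density of a square-integrable function. -/
noncomputable def hat (u : ℝ → ℂ) : ℝ → ℂ := fhat (toDist u)

theorem toDist_of_memLp {u : ℝ → ℂ} (hu : MemLp u 2 volume) :
    toDist u = ((hu.toLp u : Lp ℂ 2 (volume : Measure ℝ)) : 𝓢'(ℝ, ℂ)) := by
  rw [toDist, dif_pos hu]

theorem toDist_apply {u : ℝ → ℂ} (hu : MemLp u 2 volume) (φ : 𝓢(ℝ, ℂ)) :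
    toDist u φ = ∫ x, u x * φ x := by
  rw [toDist_of_memLp hu, Lp.toTemperedDistribution_apply]
  apply integral_congr_ae
  filter_upwards [hu.coeFn_toLp] with x hx
  rw [hx, smul_eq_mul, mul_comm]

theorem memW_zero_iff {F : ℝ → ℂ} : MemW 0 F ↔ MemLp F 2 volume := by
  constructor
  · intro h; simpa using h 1 le_rfl
  · intro h κ _; simpa using h

theorem isFourierDensity_toDist {u : ℝ → ℂ} (hu : MemLp u 2 volume) :
    IsFourierDensity (toDist u) (𝓕 (hu.toLp u) : Lp ℂ 2 (volume : Measure ℝ)) := by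
  refine ⟨Lp.aestronglyMeasurable _, fun φ =>
    ⟨integrable_mul_schwartz_of_memW (memW_zero_iff.2 (Lp.memLp _)) φ, ?_⟩⟩
  rw [toDist_of_memLp hu, Lp.fourier_toTemperedDistribution_eq, Lp.toTemperedDistribution_apply]
  simp only [smul_eq_mul, mul_comm]

theorem hat_ae_eq {u : ℝ → ℂ} (hu : MemLp u 2 volume) :
    hat u =ᵐ[volume] (𝓕 (hu.toLp u) : Lp ℂ 2 (volume : Measure ℝ)) :=
  (isFourierDensity_toDist hu).fhat_ae_eq

theorem memLp_hat {u : ℝ → ℂ} (hu : MemLp u 2 volume) : MemLp (hat u) 2 volume :=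
  (Lp.memLp _).ae_eq (hat_ae_eq hu).symm

theorem isFourierDensity_hat {u : ℝ → ℂ} (hu : MemLp u 2 volume) :
    IsFourierDensity (toDist u) (hat u) :=
  (isFourierDensity_toDist hu).isFourierDensity_fhat

theorem memSobolev_zero_toDist {u : ℝ → ℂ} (hu : MemLp u 2 volume) :
    TemperedDistribution.MemSobolev 0 2 (toDist u) :=
  (memW_zero_iff.2 (memLp_hat hu)).memSobolev (isFourierDensity_hat hu)

theorem eLpNorm_hat {u : ℝ → ℂ} (hu : MemLp u 2 volume) :
    eLpNorm (hat u) 2 volume = eLpNorm u 2 volume := by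
  rw [eLpNorm_congr_ae (hat_ae_eq hu)]
  have h := Lp.norm_fourier_eq (hu.toLp u)
  rw [Lp.norm_def, Lp.norm_toLp, ENNReal.toReal_eq_toReal_iff' (Lp.memLp _).2.ne hu.2.ne] at h
  exact h

theorem memSob_iff {σ : ℝ} {u : ℝ → ℂ} : MemSob σ u ↔ MemLp u 2 volume ∧ MemW σ (hat u) :=
  ⟨fun h => ⟨h.1, memW_fhat h.2⟩, fun h => ⟨h.1, h.2.memSobolev (isFourierDensity_hat h.1)⟩⟩

theorem MemSob.memW {σ : ℝ} {u : ℝ → ℂ} (h : MemSob σ u) : MemW σ (hat u) := (memSob_iff.1 h).2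

theorem exists_hat_eq {F : ℝ → ℂ} (hF : MemLp F 2 volume) :
    ∃ u, MemLp u 2 volume ∧ hat u =ᵐ[volume] F := by
  let f : Lp ℂ 2 (volume : Measure ℝ) := 𝓕⁻ (hF.toLp F)
  refine ⟨f, Lp.memLp f, (hat_ae_eq (Lp.memLp f)).trans ?_⟩
  rw [Lp.toLp_coeFn]
  simp only [f, FourierTransform.fourier_fourierInv_eq]
  exact hF.coeFn_toLp

theorem exists_memSob_hat_eq {σ : ℝ} (hσ : 0 ≤ σ) {F : ℝ → ℂ} (hF : MemW σ F) :
    ∃ u, MemSob σ u ∧ hat u =ᵐ[volume] F := by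
  obtain ⟨u, hu, huF⟩ := exists_hat_eq (memW_zero_iff.1 (hF.mono hσ))
  exact ⟨u, memSob_iff.2 ⟨hu, hF.congr huF.symm⟩, huF⟩

theorem toDist_congr {u v : ℝ → ℂ} (h : u =ᵐ[volume] v) : toDist u = toDist v := by
  by_cases hu : MemLp u 2 volume
  · rw [toDist_of_memLp hu, toDist_of_memLp (hu.ae_eq h), MemLp.toLp_congr hu (hu.ae_eq h) h]
  · have hv : ¬ MemLp v 2 volume := fun hv => hu (hv.ae_eq h.symm)
    rw [toDist, toDist, dif_neg hu, dif_neg hv]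

theorem ae_eq_of_hat {u v : ℝ → ℂ} (hu : MemLp u 2 volume) (hv : MemLp v 2 volume)
    (h : hat u =ᵐ[volume] hat v) : u =ᵐ[volume] v := by
  have h1 := ((hat_ae_eq hu).symm.trans h).trans (hat_ae_eq hv)
  have h2 := (Lp.fourierTransformₗᵢ ℝ ℂ).injective (Lp.ext h1)
  exact (MemLp.toLp_eq_toLp_iff hu hv).1 h2

theorem toDist_add {u v : ℝ → ℂ} (hu : MemLp u 2 volume) (hv : MemLp v 2 volume) :
    toDist (fun x => u x + v x) = toDist u + toDist v := by
  ext φ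
  have h1 : ∀ {u : ℝ → ℂ}, MemLp u 2 volume → Integrable (fun x => u x * φ x) volume := fun h =>
    MemLp.integrable_mul (p := 2) (q := 2) h (φ.memLp 2 volume)
  rw [toDist_apply (u := fun x => u x + v x) (hu.add hv)]
  change _ = toDist u φ + toDist v φ
  rw [toDist_apply hu, toDist_apply hv, ← integral_add (h1 hu) (h1 hv)]
  simp only [add_mul]

theorem toDist_const_mul {u : ℝ → ℂ} (hu : MemLp u 2 volume) (c : ℂ) :
    toDist (fun x => c * u x) = c • toDist u := by
  ext φ
  rw [toDist_apply (hu.const_mul c)]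
  change _ = c • toDist u φ
  rw [toDist_apply hu, smul_eq_mul, ← integral_const_mul]
  simp only [mul_assoc]

theorem hat_add {u v : ℝ → ℂ} (hu : MemLp u 2 volume) (hv : MemLp v 2 volume) :
    hat (fun x => u x + v x) =ᵐ[volume] fun ξ => hat u ξ + hat v ξ := by
  unfold hat
  rw [toDist_add hu hv]
  exact fhat_add (memSobolev_zero_toDist hu) (memSobolev_zero_toDist hv)

theorem hat_const_mul {u : ℝ → ℂ} (hu : MemLp u 2 volume) (c : ℂ) :
    hat (fun x => c * u x) =ᵐ[volume] fun ξ => c * hat u ξ := by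
  unfold hat
  rw [toDist_const_mul hu]
  exact fhat_smul (memSobolev_zero_toDist hu) c

theorem MemSob.add {σ : ℝ} {u v : ℝ → ℂ} (hu : MemSob σ u) (hv : MemSob σ v) :
    MemSob σ (fun x => u x + v x) :=
  memSob_iff.2 ⟨hu.1.add hv.1, (hu.memW.add hv.memW).congr (hat_add hu.1 hv.1).symm⟩

theorem MemSob.const_mul {σ : ℝ} {u : ℝ → ℂ} (hu : MemSob σ u) (c : ℂ) :
    MemSob σ (fun x => c * u x) :=
  memSob_iff.2 ⟨hu.1.const_mul c, (hu.memW.const_mul c).congr (hat_const_mul hu.1 c).symm⟩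

theorem MemSob.neg {σ : ℝ} {u : ℝ → ℂ} (hu : MemSob σ u) : MemSob σ (fun x => - u x) := by
  simpa using hu.const_mul (-1)

theorem MemSob.sub {σ : ℝ} {u v : ℝ → ℂ} (hu : MemSob σ u) (hv : MemSob σ v) :
    MemSob σ (fun x => u x - v x) := by
  simpa [sub_eq_add_neg] using hu.add hv.neg

theorem MemSob.congr {σ : ℝ} {u v : ℝ → ℂ} (hu : MemSob σ u) (h : u =ᵐ[volume] v) : MemSob σ v :=
  ⟨hu.1.ae_eq h, toDist_congr h ▸ hu.2⟩

theorem MemSob.mono {σ τ : ℝ} (h : τ ≤ σ) {u : ℝ → ℂ} (hu : MemSob σ u) : MemSob τ u :=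
  ⟨hu.1, hu.2.mono h⟩

/-! ### Conjugation -/

/-- The complex conjugate of a Schwartz function. -/
noncomputable def conjS (φ : 𝓢(ℝ, ℂ)) : 𝓢(ℝ, ℂ) :=
  SchwartzMap.postcompCLM (𝕜 := ℝ) (Complex.conjCLE : ℂ →L[ℝ] ℂ) φ

@[simp] theorem conjS_apply (φ : 𝓢(ℝ, ℂ)) (x : ℝ) : conjS φ x = conj (φ x) := rfl

/-- The reflection of a Schwartz function. -/
noncomputable def reflS (φ : 𝓢(ℝ, ℂ)) : 𝓢(ℝ, ℂ) :=
  SchwartzMap.compCLMOfContinuousLinearEquiv ℝ (ContinuousLinearEquiv.neg ℝ) φ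

@[simp] theorem reflS_apply (φ : 𝓢(ℝ, ℂ)) (x : ℝ) : reflS φ x = φ (-x) := rfl

theorem conjS_fourier (φ : 𝓢(ℝ, ℂ)) : conjS (𝓕 φ) = 𝓕 (conjS (reflS φ)) := by
  ext x
  rw [conjS_apply, SchwartzMap.fourier_coe, SchwartzMap.fourier_coe, Real.fourier_eq',
    Real.fourier_eq', ← integral_conj, ← integral_neg_eq_self]
  congr 1
  ext v
  simp only [smul_eq_mul, map_mul, conjS_apply, reflS_apply, ← Complex.exp_conj]
  congr 2
  simp [Complex.conj_ofNat]

/-- Stated for a pair T, S so that it covers both the conjugate of a function and, with S = T, a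
real-valued distribution. -/
theorem conj_apply_of_forall_conj {T S : 𝓢'(ℝ, ℂ)} {F : ℝ → ℂ} (hF : IsFourierDensity T F)
    (h : ∀ φ, S φ = conj (T (conjS φ))) : IsFourierDensity S (fun ξ => conj (F (-ξ))) := by
  refine ⟨Complex.continuous_conj.comp_aestronglyMeasurable
    (hF.1.comp_measurePreserving (Measure.measurePreserving_neg volume)), fun φ => ⟨?_, ?_⟩⟩
  · have h1 := ((hF.2 (conjS (reflS φ))).1.comp_neg)
    refine ((Complex.conjLIE : ℂ ≃ₗᵢ[ℝ] ℂ).integrable_comp_iff.2 h1).congr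
      (Filter.Eventually.of_forall fun ξ => ?_)
    simp
  · rw [TemperedDistribution.fourier_apply, h, conjS_fourier, ← TemperedDistribution.fourier_apply,
      (hF.2 _).2, ← integral_conj, ← integral_neg_eq_self]
    simp

theorem hat_conj {u : ℝ → ℂ} (hu : MemLp u 2 volume) :
    hat (fun x => conj (u x)) =ᵐ[volume] fun ξ => conj (hat u (-ξ)) := by
  have hu' : MemLp (fun x => conj (u x)) 2 volume := hu.star
  refine (conj_apply_of_forall_conj (isFourierDensity_hat hu) (S := toDist fun x => conj (u x))
    fun φ => ?_).fhat_ae_eq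
  rw [toDist_apply hu', toDist_apply hu, ← integral_conj]
  simp

/-- Reality on φ + φ̄ relates the imaginary parts, and reality on i(φ - φ̄) the real parts. -/
theorem IsRealValued.apply_conjS {T : 𝓢'(ℝ, ℂ)} (h : IsRealValued T) (φ : 𝓢(ℝ, ℂ)) :
    T φ = conj (T (conjS φ)) := by
  have h1 := h (φ + conjS φ) (fun x => by simp)
  have h2 := h (Complex.I • (φ - conjS φ)) (fun x => by simp)
  rw [map_add] at h1
  rw [map_smul, map_sub] at h2
  apply Complex.ext
  · simp at h2 ⊢; linarith
  · simp at h1 ⊢; linarith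

theorem IsRealValued.fhat_neg {σ : ℝ} {T : 𝓢'(ℝ, ℂ)} (h : IsRealValued T)
    (hT : TemperedDistribution.MemSobolev σ 2 T) :
    fhat T =ᵐ[volume] fun ξ => conj (fhat T (-ξ)) :=
  (conj_apply_of_forall_conj (isFourierDensity_fhat hT) h.apply_conjS).fhat_ae_eq

theorem ae_neg {P : ℝ → Prop} (h : ∀ᵐ ξ : ℝ, P ξ) : ∀ᵐ ξ : ℝ, P (-ξ) :=
  (Measure.measurePreserving_neg (volume : Measure ℝ)).quasiMeasurePreserving.ae h

theorem MemW.conj_neg {σ : ℝ} {F : ℝ → ℂ} (hF : MemW σ F) : MemW σ (fun ξ => conj (F (-ξ))) := by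
  intro κ hκ
  have h := ((hF κ hκ).comp_measurePreserving (Measure.measurePreserving_neg volume)).star
  refine h.ae_eq (Filter.Eventually.of_forall fun ξ => ?_)
  simp

theorem nrm_conj_neg {κ σ : ℝ} (hκ : 1 ≤ κ) {F : ℝ → ℂ} (hF : MemW σ F) :
    nrm κ σ (fun ξ => conj (F (-ξ))) = nrm κ σ F := by
  unfold nrm
  rw [← eLpNorm_comp_measurePreserving (hF κ hκ).1 (Measure.measurePreserving_neg volume)]
  congr 1
  refine eLpNorm_congr_norm_ae (Filter.Eventually.of_forall fun ξ => ?_)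
  simp

theorem MemSob.conj {σ : ℝ} {u : ℝ → ℂ} (hu : MemSob σ u) : MemSob σ (fun x => conj (u x)) :=
  memSob_iff.2 ⟨hu.1.star, hu.memW.conj_neg.congr (hat_conj hu.1).symm⟩

/-! ### The pairing -/

/-- Plancherel for the inner product of ū and v; the conjugate turns the sesquilinear product into
the bilinear pairing. -/
theorem pairing_toDist {u v : ℝ → ℂ} (hu : MemLp u 2 volume) (hv : MemLp v 2 volume) :
    pairing (toDist u) (toDist v) = ∫ x, u x * v x := by
  have hu' : MemLp (fun x => conj (u x)) 2 volume := hu.star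
  have h := Lp.inner_fourier_eq (hu'.toLp _) (hv.toLp v)
  rw [L2.inner_def, L2.inner_def] at h
  have h1 : pairing (toDist u) (toDist v) = ∫ ξ, hat u (-ξ) * hat v ξ := by
    rw [pairing, ← integral_neg_eq_self]; simp [hat]
  rw [h1]
  have hc := (hat_conj hu').symm.trans (hat_ae_eq hu'.star)
  have e1 : ∫ ξ, hat u (-ξ) * hat v ξ = ∫ ξ, inner ℂ ((𝓕 (hu'.toLp _) : Lp ℂ 2 (volume : Measure ℝ)) ξ)
      ((𝓕 (hv.toLp v) : Lp ℂ 2 (volume : Measure ℝ)) ξ) := by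
    apply integral_congr_ae
    filter_upwards [hat_conj hu, hat_ae_eq hu', hat_ae_eq hv] with ξ h1 h2 h3
    rw [← h2, ← h3, RCLike.inner_apply, h1]
    simp [mul_comm]
  rw [e1, h]
  apply integral_congr_ae
  filter_upwards [hu'.coeFn_toLp, hv.coeFn_toLp] with x h1 h2
  rw [h1, h2, RCLike.inner_apply]
  simp [mul_comm]

theorem hat_schwartz (φ : 𝓢(ℝ, ℂ)) : hat φ =ᵐ[volume] (𝓕 φ : 𝓢(ℝ, ℂ)) := by
  have h : MemLp φ 2 volume := φ.memLp 2 volume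
  refine (hat_ae_eq h).trans ?_
  have : h.toLp φ = φ.toLp 2 := rfl
  rw [this, SchwartzMap.toLp_fourier_eq]
  exact (𝓕 φ).coeFn_toLp 2 volume

theorem memSob_schwartz (σ : ℝ) (φ : 𝓢(ℝ, ℂ)) : MemSob σ φ := by
  refine ⟨φ.memLp 2 volume, ?_⟩
  have h : toDist φ = (φ : 𝓢'(ℝ, ℂ)) := by
    ext ψ
    rw [toDist_apply (φ.memLp 2 volume), SchwartzMap.coe_apply]
    simp [mul_comm]
  rw [h]
  exact φ.memSobolev

theorem norm_integral_mul_le_L2 {f g : ℝ → ℂ} (hf : MemLp f 2 volume) (hg : MemLp g 2 volume) :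
    ‖∫ x, (f * g) x‖ ≤ (eLpNorm f 2 volume).toReal * (eLpNorm g 2 volume).toReal := by
  rw [← ENNReal.toReal_mul, ← toReal_enorm]
  refine ENNReal.toReal_mono (ENNReal.mul_ne_top hf.2.ne hg.2.ne)
    (le_trans ?_ (eLpNorm_smul_le_mul_eLpNorm (p := 2) (q := 2) (r := 1) hg.1 hf.1))
  rw [eLpNorm_one_eq_lintegral_enorm]
  exact enorm_integral_le_lintegral_enorm _

theorem pairing_eq (T : 𝓢'(ℝ, ℂ)) (φ : ℝ → ℂ) :
    pairing T (toDist φ) = ∫ ξ, fhat T ξ * hat φ (-ξ) := rfl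

theorem MemW.integrable_mul_neg {σ : ℝ} {F G : ℝ → ℂ} (hF : MemW σ F) (hG : MemW (-σ) G) :
    Integrable (fun ξ => F ξ * G (-ξ)) volume := by
  have h2 := (hG 1 le_rfl).comp_measurePreserving (Measure.measurePreserving_neg volume)
  convert MemLp.integrable_mul (p := 2) (q := 2) (hF 1 le_rfl) h2 using 1
  ext ξ
  simp only [Pi.mul_apply, Function.comp_apply, wt_neg]
  have : ((wt 1 ξ ^ σ : ℝ) : ℂ) * ((wt 1 ξ ^ (-σ) : ℝ) : ℂ) = 1 := by
    rw [← Complex.ofReal_mul, ← Real.rpow_add (wt_pos le_rfl ξ)]; simp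
  linear_combination (-F ξ * G (-ξ)) * this

/-- The even weights with exponents σ and -σ cancel, so the duality has constant 1 for every κ and
no power of κ is lost. -/
theorem norm_integral_mul_neg_le {κ σ : ℝ} (hκ : 1 ≤ κ) {F G : ℝ → ℂ} (hF : MemW σ F)
    (hG : MemW (-σ) G) : ‖∫ ξ, F ξ * G (-ξ)‖ ≤ nrm κ σ F * nrm κ (-σ) G := by
  have h1 := hF κ hκ
  have h2 := (hG κ hκ).comp_measurePreserving (Measure.measurePreserving_neg volume)
  have e : (fun ξ => F ξ * G (-ξ)) = (fun ξ => ((wt κ ξ ^ σ : ℝ) : ℂ) * F ξ) *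
      ((fun ξ => ((wt κ ξ ^ (-σ) : ℝ) : ℂ) * G ξ) ∘ fun ξ => -ξ) := by
    ext ξ
    simp only [Pi.mul_apply, Function.comp_apply, wt_neg]
    have : ((wt κ ξ ^ σ : ℝ) : ℂ) * ((wt κ ξ ^ (-σ) : ℝ) : ℂ) = 1 := by
      rw [← Complex.ofReal_mul, ← Real.rpow_add (wt_pos hκ ξ)]; simp
    linear_combination (-F ξ * G (-ξ)) * this
  unfold nrm
  rw [← eLpNorm_comp_measurePreserving (hG κ hκ).1 (Measure.measurePreserving_neg volume), e]
  exact norm_integral_mul_le_L2 h1 h2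

theorem integrable_pairing {s : ℝ} {T : 𝓢'(ℝ, ℂ)} (hT : TemperedDistribution.MemSobolev s 2 T)
    {φ : ℝ → ℂ} (hφ : MemSob (-s) φ) : Integrable (fun ξ => fhat T ξ * hat φ (-ξ)) volume :=
  (memW_fhat hT).integrable_mul_neg hφ.memW

theorem norm_pairing_le {s κ : ℝ} (hκ : 1 ≤ κ) {T : 𝓢'(ℝ, ℂ)}
    (hT : TemperedDistribution.MemSobolev s 2 T) {φ : ℝ → ℂ} (hφ : MemSob (-s) φ) :
    ‖pairing T (toDist φ)‖ ≤ nrm κ s (fhat T) * nrm κ (-s) (hat φ) :=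
  norm_integral_mul_neg_le hκ (memW_fhat hT) hφ.memW

theorem pairing_schwartz {s : ℝ} {T : 𝓢'(ℝ, ℂ)} (hT : TemperedDistribution.MemSobolev s 2 T)
    (φ : 𝓢(ℝ, ℂ)) : pairing T (toDist φ) = T φ := by
  have h := ((isFourierDensity_fhat hT).2 (𝓕⁻ φ)).2
  rw [TemperedDistribution.fourier_apply, FourierTransform.fourier_fourierInv_eq] at h
  rw [h, pairing]
  apply integral_congr_ae
  filter_upwards [ae_neg (hat_schwartz φ)] with ξ hξ
  change fhat T ξ * hat φ (-ξ) = _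
  rw [hξ, SchwartzMap.fourierInv_coe, Real.fourierInv_eq_fourier_neg, SchwartzMap.fourier_coe]

theorem ext_of_pairing {s s' : ℝ} {T S : 𝓢'(ℝ, ℂ)} (hT : TemperedDistribution.MemSobolev s 2 T)
    (hS : TemperedDistribution.MemSobolev s' 2 S)
    (h : ∀ φ : 𝓢(ℝ, ℂ), pairing T (toDist φ) = pairing S (toDist φ)) : T = S := by
  ext φ
  rw [← pairing_schwartz hT, ← pairing_schwartz hS, h]

theorem pairing_add_left {s : ℝ} {T S : 𝓢'(ℝ, ℂ)} (hT : TemperedDistribution.MemSobolev s 2 T)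
    (hS : TemperedDistribution.MemSobolev s 2 S) {φ : ℝ → ℂ} (hφ : MemSob (-s) φ) :
    pairing (T + S) (toDist φ) = pairing T (toDist φ) + pairing S (toDist φ) := by
  simp only [pairing_eq]
  rw [← integral_add (integrable_pairing hT hφ) (integrable_pairing hS hφ)]
  apply integral_congr_ae
  filter_upwards [fhat_add hT hS] with ξ h
  rw [h, add_mul]

theorem pairing_smul_left {s : ℝ} {T : 𝓢'(ℝ, ℂ)} (hT : TemperedDistribution.MemSobolev s 2 T)
    (c : ℂ) (φ : ℝ → ℂ) : pairing (c • T) (toDist φ) = c * pairing T (toDist φ) := by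
  simp only [pairing_eq]
  rw [← integral_const_mul]
  apply integral_congr_ae
  filter_upwards [fhat_smul hT c] with ξ h
  rw [h, mul_assoc]

theorem pairing_add_right {s : ℝ} {T : 𝓢'(ℝ, ℂ)} (hT : TemperedDistribution.MemSobolev s 2 T)
    {φ ψ : ℝ → ℂ} (hφ : MemSob (-s) φ) (hψ : MemSob (-s) ψ) :
    pairing T (toDist fun x => φ x + ψ x) = pairing T (toDist φ) + pairing T (toDist ψ) := by
  simp only [pairing_eq]
  rw [← integral_add (integrable_pairing hT hφ) (integrable_pairing hT hψ)]
  apply integral_congr_ae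
  filter_upwards [ae_neg (hat_add hφ.1 hψ.1)] with ξ h
  rw [h, mul_add]

theorem pairing_const_mul_right (T : 𝓢'(ℝ, ℂ)) {φ : ℝ → ℂ} (hφ : MemLp φ 2 volume) (c : ℂ) :
    pairing T (toDist fun x => c * φ x) = c * pairing T (toDist φ) := by
  simp only [pairing_eq]
  rw [← integral_const_mul]
  apply integral_congr_ae
  filter_upwards [ae_neg (hat_const_mul hφ c)] with ξ h
  rw [h]; ring

theorem conj_pairing {T S : 𝓢'(ℝ, ℂ)} (hTS : fhat S =ᵐ[volume] fun ξ => conj (fhat T (-ξ)))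
    {φ : ℝ → ℂ} (hφ : MemLp φ 2 volume) :
    conj (pairing T (toDist φ)) = pairing S (toDist fun x => conj (φ x)) := by
  simp only [pairing_eq]
  rw [← integral_conj, ← integral_neg_eq_self]
  apply integral_congr_ae
  filter_upwards [hTS, ae_neg (hat_conj hφ)] with ξ h1 h2
  rw [h1, h2, map_mul]

/-! ### Convolution of densities and the product estimate. -/

theorem lintegral_mul_sq_le {α : Type*} [MeasurableSpace α] (μ : Measure α) {f g : α → ℝ≥0∞}
    (hf : AEMeasurable f μ) (hg : AEMeasurable g μ) :
    (∫⁻ a, f a * g a ∂μ) ^ 2 ≤ (∫⁻ a, f a ^ 2 ∂μ) * ∫⁻ a, g a ^ 2 ∂μ := by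
  have h := ENNReal.lintegral_mul_le_Lp_mul_Lq μ Real.HolderConjugate.two_two hf hg
  simp only [ENNReal.rpow_two, Pi.mul_apply] at h
  calc _ ≤ ((∫⁻ a, f a ^ 2 ∂μ) ^ (1 / 2 : ℝ) * (∫⁻ a, g a ^ 2 ∂μ) ^ (1 / 2 : ℝ)) ^ 2 := by gcongr
    _ = _ := by
      rw [mul_pow, ← ENNReal.rpow_two, ← ENNReal.rpow_two, ← ENNReal.rpow_mul, ← ENNReal.rpow_mul]
      norm_num

theorem eLpNorm_two_sq {α : Type*} [MeasurableSpace α] {μ : Measure α} (f : α → ℂ) :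
    eLpNorm f 2 μ ^ 2 = ∫⁻ x, ‖f x‖ₑ ^ 2 ∂μ := by
  have := eLpNorm_nnreal_pow_eq_lintegral (f := f) (μ := μ) (p := 2) (by norm_num)
  simpa using this

/-- Here c is the weight at the output frequency and c ≤ 2 max(a, b). If b dominates, b^{-τ} absorbs
c^τ. If a dominates, part of a^{-σ} absorbs it, and the leftover a^{-(σ-τ)} is at most b^{-(σ-τ)}.
What remains is integrable as soon as σ > 1/2. -/
theorem weight_triangle {a b c τ σ : ℝ} (ha : 0 < a) (hb : 0 < b) (hc : 0 < c) (h : c ≤ a + b)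
    (hτ : 0 ≤ τ) (hτσ : τ ≤ σ) (hσ : σ ≤ 1) :
    (c ^ τ * a ^ (-σ) * b ^ (-τ)) ^ 2 ≤ 4 * (a ^ (-(2 * σ)) + b ^ (-(2 * σ))) := by
  have e : ∀ {x : ℝ}, 0 < x → ∀ r : ℝ, (x ^ r) ^ 2 = x ^ (2 * r) := fun hx r => by
    rw [← Real.rpow_natCast, ← Real.rpow_mul hx.le]; congr 1; push_cast; ring
  rw [mul_pow, mul_pow, e hc, e ha, e hb]
  -- The factor 4 comes from c ≤ 2 max(a, b) and τ ≤ σ ≤ 1.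
  have h4 : (2 : ℝ) ^ (2 * τ) ≤ 4 := by
    calc (2 : ℝ) ^ (2 * τ) ≤ 2 ^ (2 : ℝ) := Real.rpow_le_rpow_of_exponent_le one_le_two (by linarith)
      _ = 4 := by norm_num
  have key : ∀ m : ℝ, 0 < m → c ≤ 2 * m → c ^ (2 * τ) ≤ 4 * m ^ (2 * τ) := fun m hm hcm => by
    calc c ^ (2 * τ) ≤ (2 * m) ^ (2 * τ) := Real.rpow_le_rpow hc.le hcm (by linarith)
      _ = 2 ^ (2 * τ) * m ^ (2 * τ) := Real.mul_rpow two_pos.le hm.le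
      _ ≤ _ := by gcongr
  have pa := Real.rpow_nonneg ha.le (-(2 * σ))
  have pb := Real.rpow_nonneg hb.le (-(2 * σ))
  rcases le_total a b with hab | hab
  · calc c ^ (2 * τ) * a ^ (2 * -σ) * b ^ (2 * -τ)
        ≤ 4 * b ^ (2 * τ) * a ^ (2 * -σ) * b ^ (2 * -τ) := by
          have h5 := key b hb (by linarith)
          gcongr
      _ = 4 * (b ^ (2 * τ) * b ^ (2 * -τ)) * a ^ (-(2 * σ)) := by
          rw [show 2 * -σ = -(2 * σ) by ring]; ring
      _ = 4 * a ^ (-(2 * σ)) := by rw [← Real.rpow_add hb]; simp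
      _ ≤ _ := by linarith
  · calc c ^ (2 * τ) * a ^ (2 * -σ) * b ^ (2 * -τ)
        ≤ 4 * a ^ (2 * τ) * a ^ (2 * -σ) * b ^ (2 * -τ) := by
          have h5 := key a ha (by linarith)
          gcongr
      _ = 4 * a ^ (-(2 * (σ - τ))) * b ^ (2 * -τ) := by
          rw [mul_assoc 4, ← Real.rpow_add ha]; congr 3; ring
      _ ≤ 4 * b ^ (-(2 * (σ - τ))) * b ^ (2 * -τ) := by
          have h5 : a ^ (-(2 * (σ - τ))) ≤ b ^ (-(2 * (σ - τ))) :=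
            Real.rpow_le_rpow_of_nonpos hb hab (by linarith)
          gcongr
      _ = 4 * b ^ (-(2 * σ)) := by rw [mul_assoc, ← Real.rpow_add hb]; congr 2; ring
      _ ≤ _ := by linarith

theorem wt_triangle {κ : ℝ} (hκ : 1 ≤ κ) (ξ η : ℝ) : wt κ ξ ≤ wt κ η + wt κ (ξ - η) := by
  unfold wt
  have h : |ξ| ≤ |η| + |ξ - η| := by
    calc |ξ| = |η + (ξ - η)| := by ring_nf
      _ ≤ _ := abs_add_le _ _
  nlinarith [Real.pi_pos]

/-- The integral of the weight `wt κ ^ (-2σ)`. -/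
noncomputable def wtInt (κ σ : ℝ) : ℝ≥0∞ := ∫⁻ ξ, ENNReal.ofReal (wt κ ξ ^ (-(2 * σ)))

theorem wtInt_one_lt_top {σ : ℝ} (hσ : 1 / 2 < σ) : wtInt 1 σ < ⊤ := by
  have h := (integrable_one_add_norm (E := ℝ) (μ := volume) (r := 2 * σ) (by simp; linarith))
  refine lt_of_le_of_lt (lintegral_mono fun ξ => ENNReal.ofReal_le_ofReal ?_) h.lintegral_lt_top
  refine Real.rpow_le_rpow_of_nonpos (by positivity) ?_ (by linarith)
  rw [Real.norm_eq_abs, wt]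
  nlinarith [Real.pi_gt_three, abs_nonneg ξ]

theorem lintegral_comp_mul_left {a : ℝ} (ha : a ≠ 0) (f : ℝ → ℝ≥0∞) :
    ∫⁻ x, f (a * x) = ENNReal.ofReal |a⁻¹| * ∫⁻ x, f x := by
  have h := (measurableEmbedding_mulLeft₀ ha).lintegral_map (μ := (volume : Measure ℝ)) f
  rw [← h, Real.map_volume_mul_left ha, lintegral_smul_measure, smul_eq_mul]

/-- The substitution ξ ↦ ξ/κ scales κ out of the weight. -/
theorem wtInt_eq {κ σ : ℝ} (hκ : 1 ≤ κ) :
    wtInt κ σ = ENNReal.ofReal (κ ^ (1 - 2 * σ)) * wtInt 1 σ := by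
  have hκ0 : 0 < κ := by linarith
  have h1 := lintegral_comp_mul_left (inv_ne_zero hκ0.ne')
    (fun ξ => ENNReal.ofReal (wt 1 ξ ^ (-(2 * σ))))
  have h2 : ∀ ξ, wt κ ξ ^ (-(2 * σ)) = κ ^ (-(2 * σ)) * wt 1 (κ⁻¹ * ξ) ^ (-(2 * σ)) := fun ξ => by
    rw [← Real.mul_rpow hκ0.le (wt_pos le_rfl _).le]
    congr 1
    unfold wt
    rw [abs_mul, abs_of_pos (inv_pos.2 hκ0)]
    field_simp
  unfold wtInt
  simp only [h2]
  simp only [ENNReal.ofReal_mul (Real.rpow_nonneg hκ0.le _)]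
  rw [lintegral_const_mul' _ _ ENNReal.ofReal_ne_top, h1, inv_inv, abs_of_pos hκ0, ← mul_assoc,
    ← ENNReal.ofReal_mul (Real.rpow_nonneg hκ0.le _), ← Real.rpow_add_one hκ0.ne']
  congr 3; ring

theorem wtInt_lt_top {κ σ : ℝ} (hκ : 1 ≤ κ) (hσ : 1 / 2 < σ) : wtInt κ σ < ⊤ := by
  rw [wtInt_eq hκ]
  exact ENNReal.mul_lt_top ENNReal.ofReal_lt_top (wtInt_one_lt_top hσ)

/-- The constant of the product estimate. -/
noncomputable def prodConst (κ σ : ℝ) : ℝ := Real.sqrt (8 * (wtInt κ σ).toReal)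

theorem prodConst_nonneg (κ σ : ℝ) : 0 ≤ prodConst κ σ := Real.sqrt_nonneg _

/-- For σ > 1/2 this negative power of κ is the only source of smallness. At σ = s+1 the exponent is
-(1/2-|s|), which dictates the threshold. -/
theorem prodConst_eq {κ σ : ℝ} (hκ : 1 ≤ κ) :
    prodConst κ σ = κ ^ (1 / 2 - σ) * prodConst 1 σ := by
  have hκ0 : 0 < κ := by linarith
  unfold prodConst
  rw [wtInt_eq hκ, ENNReal.toReal_mul, ENNReal.toReal_ofReal (Real.rpow_nonneg hκ0.le _),
    mul_left_comm, Real.sqrt_mul (Real.rpow_nonneg hκ0.le _), Real.sqrt_eq_rpow,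
    ← Real.rpow_mul hκ0.le]
  congr 2; ring

theorem lintegral_weight_triangle_le {κ σ τ : ℝ} (hκ : 1 ≤ κ) (hτ : 0 ≤ τ) (hτσ : τ ≤ σ)
    (hσ : σ ≤ 1) (ξ : ℝ) :
    ∫⁻ η, (ENNReal.ofReal (wt κ ξ ^ τ * wt κ η ^ (-σ) * wt κ (ξ - η) ^ (-τ))) ^ 2 ≤
      8 * wtInt κ σ := by
  have hm : ∀ r : ℝ, Measurable fun η => ENNReal.ofReal (wt κ η ^ r) := fun r =>
    ((continuous_wt_rpow hκ r).measurable).ennreal_ofReal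
  calc _ ≤ ∫⁻ η, 4 * (ENNReal.ofReal (wt κ η ^ (-(2 * σ))) +
        ENNReal.ofReal (wt κ (ξ - η) ^ (-(2 * σ)))) := by
        refine lintegral_mono fun η => ?_
        rw [← ENNReal.ofReal_pow, ← ENNReal.ofReal_add, ← ENNReal.ofReal_ofNat 4, ← ENNReal.ofReal_mul]
        · exact ENNReal.ofReal_le_ofReal (weight_triangle (wt_pos hκ η) (wt_pos hκ _) (wt_pos hκ ξ)
            (wt_triangle hκ ξ η) hτ hτσ hσ)
        · norm_num
        · exact Real.rpow_nonneg (wt_pos hκ _).le _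
        · exact Real.rpow_nonneg (wt_pos hκ _).le _
        · have := Real.rpow_nonneg (wt_pos hκ η).le (-σ)
          have := Real.rpow_nonneg (wt_pos hκ ξ).le τ
          have := Real.rpow_nonneg (wt_pos hκ (ξ - η)).le (-τ)
          positivity
    _ = 8 * wtInt κ σ := by
        rw [lintegral_const_mul' _ _ (by norm_num), lintegral_add_left (hm _),
          lintegral_sub_left_eq_self (fun η => ENNReal.ofReal (wt κ η ^ (-(2 * σ)))) ξ]
        unfold wtInt
        rw [← two_mul, ← mul_assoc]; norm_num

/-- The convolution of absolute values. -/
noncomputable def absConv (G Φ : ℝ → ℂ) (ξ : ℝ) : ℝ≥0∞ := ∫⁻ η, ‖G η‖ₑ * ‖Φ (ξ - η)‖ₑ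

theorem aestronglyMeasurable_sub_swap {Φ : ℝ → ℂ} (hΦ : AEStronglyMeasurable Φ volume) :
    AEStronglyMeasurable (fun p : ℝ × ℝ => Φ (p.1 - p.2)) (volume.prod volume) :=
  hΦ.comp_quasiMeasurePreserving (quasiMeasurePreserving_sub volume volume)

theorem aestronglyMeasurable_const_sub {Φ : ℝ → ℂ} (hΦ : AEStronglyMeasurable Φ volume) (ξ : ℝ) :
    AEStronglyMeasurable (fun η : ℝ => Φ (ξ - η)) volume :=
  hΦ.comp_measurePreserving (Measure.measurePreserving_sub_left volume ξ)

/-- Cauchy–Schwarz in η with the weights separated off, the weight integral being bounded uniformly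
in ξ. The remaining double integral factors by Tonelli and translation invariance. -/
theorem lintegral_absConv_sq_le {κ σ τ : ℝ} (hκ : 1 ≤ κ) (hτ : 0 ≤ τ) (hτσ : τ ≤ σ)
    (hσ : σ ≤ 1) {G Φ : ℝ → ℂ} (hG : AEStronglyMeasurable G volume)
    (hΦ : AEStronglyMeasurable Φ volume) :
    ∫⁻ ξ, (ENNReal.ofReal (wt κ ξ ^ τ) * absConv G Φ ξ) ^ 2 ≤
      8 * wtInt κ σ * (eLpNorm (fun ξ => ((wt κ ξ ^ σ : ℝ) : ℂ) * G ξ) 2 volume ^ 2 *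
        eLpNorm (fun ξ => ((wt κ ξ ^ τ : ℝ) : ℂ) * Φ ξ) 2 volume ^ 2) := by
  set g : ℝ → ℂ := fun ξ => ((wt κ ξ ^ σ : ℝ) : ℂ) * G ξ with hg
  set f : ℝ → ℂ := fun ξ => ((wt κ ξ ^ τ : ℝ) : ℂ) * Φ ξ with hf
  have hgm : AEStronglyMeasurable g volume := (continuous_wt_rpow_ofReal hκ σ).aestronglyMeasurable.mul hG
  have hfm : AEStronglyMeasurable f volume := (continuous_wt_rpow_ofReal hκ τ).aestronglyMeasurable.mul hΦ
  have hpt : ∀ ξ, (ENNReal.ofReal (wt κ ξ ^ τ) * absConv G Φ ξ) ^ 2 ≤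
      8 * wtInt κ σ * ∫⁻ η, (‖g η‖ₑ * ‖f (ξ - η)‖ₑ) ^ 2 := by
    intro ξ
    have e1 : ENNReal.ofReal (wt κ ξ ^ τ) * absConv G Φ ξ = ∫⁻ η,
        ENNReal.ofReal (wt κ ξ ^ τ * wt κ η ^ (-σ) * wt κ (ξ - η) ^ (-τ)) *
          (‖g η‖ₑ * ‖f (ξ - η)‖ₑ) := by
      rw [absConv, ← lintegral_const_mul' _ _ ENNReal.ofReal_ne_top]
      refine lintegral_congr fun η => ?_
      have p1 := Real.rpow_nonneg (wt_pos hκ η).le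
      have p2 := Real.rpow_nonneg (wt_pos hκ ξ).le
      have p3 := Real.rpow_nonneg (wt_pos hκ (ξ - η)).le
      simp only [hg, hf, enorm_mul]
      rw [← ofReal_norm (((wt κ η ^ σ : ℝ) : ℂ)), ← ofReal_norm (((wt κ (ξ - η) ^ τ : ℝ) : ℂ)),
        Complex.norm_real, Complex.norm_real, Real.norm_of_nonneg (p1 σ), Real.norm_of_nonneg (p3 τ),
        show ∀ a b c d e : ℝ≥0∞, a * (b * c * (d * e)) = a * b * d * (c * e) by intros; ring,
        ← ENNReal.ofReal_mul (mul_nonneg (mul_nonneg (p2 τ) (p1 (-σ))) (p3 (-τ))),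
        ← ENNReal.ofReal_mul (mul_nonneg (mul_nonneg (mul_nonneg (p2 τ) (p1 (-σ))) (p3 (-τ))) (p1 σ))]
      congr 2
      have q1 : wt κ η ^ (-σ) * wt κ η ^ σ = 1 := by rw [← Real.rpow_add (wt_pos hκ η)]; simp
      have q2 : wt κ (ξ - η) ^ (-τ) * wt κ (ξ - η) ^ τ = 1 := by
        rw [← Real.rpow_add (wt_pos hκ _)]; simp
      linear_combination (-wt κ ξ ^ τ) * q1 - wt κ ξ ^ τ * (wt κ η ^ (-σ) * wt κ η ^ σ) * q2
    rw [e1]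
    refine (lintegral_mul_sq_le volume ?_ ?_).trans ?_
    · exact (Continuous.measurable (((continuous_const.mul (continuous_wt_rpow hκ _)).mul
        ((continuous_wt_rpow hκ _).comp (by fun_prop))))).ennreal_ofReal.aemeasurable
    · exact hgm.enorm.mul (aestronglyMeasurable_const_sub hfm ξ).enorm
    · gcongr
      exact lintegral_weight_triangle_le hκ hτ hτσ hσ ξ
  calc _ ≤ ∫⁻ ξ, 8 * wtInt κ σ * ∫⁻ η, (‖g η‖ₑ * ‖f (ξ - η)‖ₑ) ^ 2 := lintegral_mono hpt
    _ = 8 * wtInt κ σ * ∫⁻ ξ, ∫⁻ η, (‖g η‖ₑ * ‖f (ξ - η)‖ₑ) ^ 2 := by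
        rw [lintegral_const_mul'']
        exact (((hgm.comp_snd.enorm.mul (aestronglyMeasurable_sub_swap hfm).enorm).pow_const
          2).lintegral_prod_right')
    _ = _ := by
        congr 1
        rw [lintegral_lintegral_swap ((hgm.comp_snd.enorm.mul
          (aestronglyMeasurable_sub_swap hfm).enorm).pow_const 2), eLpNorm_two_sq, eLpNorm_two_sq]
        simp only [mul_pow]
        have : ∀ η, ∫⁻ ξ, ‖g η‖ₑ ^ 2 * ‖f (ξ - η)‖ₑ ^ 2 = ‖g η‖ₑ ^ 2 * ∫⁻ ξ, ‖f ξ‖ₑ ^ 2 := fun η => by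
          rw [lintegral_const_mul' _ _ (by simp),
            lintegral_sub_right_eq_self (fun ξ => ‖f ξ‖ₑ ^ 2) η]
        simp only [this]
        rw [lintegral_mul_const'' _ (hgm.enorm.pow_const 2)]

/-- The convolution of Fourier densities. -/
noncomputable def conv (G Φ : ℝ → ℂ) (ξ : ℝ) : ℂ := ∫ η, G η * Φ (ξ - η)

theorem enorm_conv_le (G Φ : ℝ → ℂ) (ξ : ℝ) : ‖conv G Φ ξ‖ₑ ≤ absConv G Φ ξ := by
  refine (enorm_integral_le_lintegral_enorm _).trans (le_of_eq ?_)
  simp only [enorm_mul]; rfl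

theorem aestronglyMeasurable_conv {G Φ : ℝ → ℂ} (hG : AEStronglyMeasurable G volume)
    (hΦ : AEStronglyMeasurable Φ volume) : AEStronglyMeasurable (conv G Φ) volume :=
  (hG.comp_snd.mul (aestronglyMeasurable_sub_swap hΦ)).integral_prod_right'

theorem eLpNorm_conv_sq_le {κ σ τ : ℝ} (hκ : 1 ≤ κ) (hτ : 0 ≤ τ) (hτσ : τ ≤ σ)
    (hσ : σ ≤ 1) {G Φ : ℝ → ℂ} (hG : AEStronglyMeasurable G volume)
    (hΦ : AEStronglyMeasurable Φ volume) :
    eLpNorm (fun ξ => ((wt κ ξ ^ τ : ℝ) : ℂ) * conv G Φ ξ) 2 volume ^ 2 ≤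
      8 * wtInt κ σ * (eLpNorm (fun ξ => ((wt κ ξ ^ σ : ℝ) : ℂ) * G ξ) 2 volume ^ 2 *
        eLpNorm (fun ξ => ((wt κ ξ ^ τ : ℝ) : ℂ) * Φ ξ) 2 volume ^ 2) := by
  rw [eLpNorm_two_sq]
  refine (lintegral_mono fun ξ => ?_).trans (lintegral_absConv_sq_le hκ hτ hτσ hσ hG hΦ)
  rw [enorm_mul, ← ofReal_norm (((wt κ ξ ^ τ : ℝ) : ℂ)), Complex.norm_real,
    Real.norm_of_nonneg (Real.rpow_nonneg (wt_pos hκ ξ).le _)]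
  gcongr
  exact enorm_conv_le G Φ ξ

theorem MemW.conv {σ τ : ℝ} (hσ2 : 1 / 2 < σ) (hτ : 0 ≤ τ) (hτσ : τ ≤ σ)
    (hσ : σ ≤ 1) {G Φ : ℝ → ℂ} (hG : MemW σ G) (hΦ : MemW τ Φ) : MemW τ (conv G Φ) := by
  intro κ hκ
  refine ⟨(continuous_wt_rpow_ofReal hκ τ).aestronglyMeasurable.mul
    (aestronglyMeasurable_conv hG.aestronglyMeasurable hΦ.aestronglyMeasurable), ?_⟩
  have h := eLpNorm_conv_sq_le hκ hτ hτσ hσ hG.aestronglyMeasurable hΦ.aestronglyMeasurable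
  have h2 := h.trans_lt (ENNReal.mul_lt_top (ENNReal.mul_lt_top (by norm_num) (wtInt_lt_top hκ hσ2))
    (ENNReal.mul_lt_top (ENNReal.pow_lt_top (hG κ hκ).2) (ENNReal.pow_lt_top (hΦ κ hκ).2)))
  by_contra hcon
  rw [not_lt_top_iff.1 hcon] at h2
  simp at h2

theorem nrm_conv_le {κ σ τ : ℝ} (hκ : 1 ≤ κ) (hσ2 : 1 / 2 < σ) (hτ : 0 ≤ τ) (hτσ : τ ≤ σ)
    (hσ : σ ≤ 1) {G Φ : ℝ → ℂ} (hG : MemW σ G) (hΦ : MemW τ Φ) :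
    nrm κ τ (BockKruskal.conv G Φ) ≤ prodConst κ σ * (nrm κ σ G * nrm κ τ Φ) := by
  have h := eLpNorm_conv_sq_le hκ hτ hτσ hσ hG.aestronglyMeasurable hΦ.aestronglyMeasurable
  have h2 := ENNReal.toReal_mono (ENNReal.mul_lt_top (ENNReal.mul_lt_top (by norm_num) (wtInt_lt_top hκ hσ2))
    (ENNReal.mul_lt_top (ENNReal.pow_lt_top (hG κ hκ).2) (ENNReal.pow_lt_top (hΦ κ hκ).2))).ne h
  rw [ENNReal.toReal_pow, ENNReal.toReal_mul, ENNReal.toReal_mul, ENNReal.toReal_mul,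
    ENNReal.toReal_pow, ENNReal.toReal_pow] at h2
  refine le_of_sq_le_sq ?_ (mul_nonneg (prodConst_nonneg _ _)
    (mul_nonneg (nrm_nonneg _ _ _) (nrm_nonneg _ _ _)))
  refine h2.trans (le_of_eq ?_)
  rw [mul_pow, mul_pow, prodConst, Real.sq_sqrt (by positivity)]
  simp [nrm]

theorem enorm_weight_mul {κ : ℝ} (hκ : 1 ≤ κ) (σ : ℝ) (F : ℝ → ℂ) (ξ : ℝ) :
    ‖((wt κ ξ ^ σ : ℝ) : ℂ) * F ξ‖ₑ = ENNReal.ofReal (wt κ ξ ^ σ) * ‖F ξ‖ₑ := by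
  rw [enorm_mul, ← ofReal_norm (((wt κ ξ ^ σ : ℝ) : ℂ)), Complex.norm_real,
    Real.norm_of_nonneg (Real.rpow_nonneg (wt_pos hκ ξ).le _)]

theorem lintegral_absConv_mul_lt_top {σ τ : ℝ} (hσ2 : 1 / 2 < σ) (hτ : 0 ≤ τ) (hτσ : τ ≤ σ)
    (hσ : σ ≤ 1) {G Φ Q : ℝ → ℂ} (hG : MemW σ G) (hΦ : MemW τ Φ) (hQ : MemW (-τ) Q) :
    ∫⁻ ξ, absConv G Φ ξ * ‖Q ξ‖ₑ < ⊤ := by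
  have hc := le_refl (1 : ℝ)
  have h1 := lintegral_absConv_sq_le hc hτ hτσ hσ hG.aestronglyMeasurable hΦ.aestronglyMeasurable
  have h2 := h1.trans_lt (ENNReal.mul_lt_top (ENNReal.mul_lt_top (by norm_num) (wtInt_lt_top hc hσ2))
    (ENNReal.mul_lt_top (ENNReal.pow_lt_top (hG 1 hc).2) (ENNReal.pow_lt_top (hΦ 1 hc).2)))
  have e : ∀ ξ, absConv G Φ ξ * ‖Q ξ‖ₑ = (ENNReal.ofReal (wt 1 ξ ^ τ) * absConv G Φ ξ) *
      ‖((wt 1 ξ ^ (-τ) : ℝ) : ℂ) * Q ξ‖ₑ := fun ξ => by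
    rw [enorm_weight_mul hc, show ∀ a b c d : ℝ≥0∞, a * b * (c * d) = a * c * (b * d) by intros; ring,
      ← ENNReal.ofReal_mul (Real.rpow_nonneg (wt_pos hc ξ).le _), ← Real.rpow_add (wt_pos hc ξ)]
    simp
  have hm : AEMeasurable (absConv G Φ) volume :=
    (hG.aestronglyMeasurable.comp_snd.enorm.mul
      (aestronglyMeasurable_sub_swap hΦ.aestronglyMeasurable).enorm).lintegral_prod_right'
  have h3 := lintegral_mul_sq_le volume
    (((continuous_wt_rpow hc τ).measurable.ennreal_ofReal.aemeasurable).mul hm) (hQ 1 hc).1.enorm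
  rw [← eLpNorm_two_sq] at h3
  simp only [e]
  have h4 := h3.trans_lt (ENNReal.mul_lt_top h2 (ENNReal.pow_lt_top (hQ 1 hc).2))
  by_contra hcon
  simp only [Pi.mul_apply] at h4
  rw [not_lt_top_iff.1 hcon] at h4
  simp at h4

/-- Licenses the interchanges of integrals in the convolution theorem and in the Leibniz rule. -/
theorem integrable_trilinear {σ τ : ℝ} (hσ2 : 1 / 2 < σ) (hτ : 0 ≤ τ) (hτσ : τ ≤ σ)
    (hσ : σ ≤ 1) {G Φ Q : ℝ → ℂ} (hG : MemW σ G) (hΦ : MemW τ Φ) (hQ : MemW (-τ) Q) :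
    Integrable (fun p : ℝ × ℝ => G p.2 * Φ (p.1 - p.2) * Q p.1) (volume.prod volume) := by
  have hm : AEStronglyMeasurable (fun p : ℝ × ℝ => G p.2 * Φ (p.1 - p.2) * Q p.1)
      (volume.prod volume) :=
    (hG.aestronglyMeasurable.comp_snd.mul (aestronglyMeasurable_sub_swap hΦ.aestronglyMeasurable)).mul
      hQ.aestronglyMeasurable.comp_fst
  refine ⟨hm, ?_⟩
  rw [hasFiniteIntegral_iff_enorm, lintegral_prod _ hm.enorm]
  refine lt_of_eq_of_lt (lintegral_congr fun ξ => ?_)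
    (lintegral_absConv_mul_lt_top hσ2 hτ hτσ hσ hG hΦ hQ)
  simp only [enorm_mul]
  rw [lintegral_mul_const' _ _ enorm_ne_top]
  rfl

/-! ### Fourier inversion and the embedding of H^σ, σ > 1/2, in bounded continuous functions. -/

theorem integral_fourierInv_mul_eq {F g : ℝ → ℂ} (hF : Integrable F volume)
    (hg : Integrable g volume) : ∫ x, 𝓕⁻ F x * g x = ∫ ξ, F ξ * 𝓕⁻ g ξ := by
  have h := VectorFourier.integral_fourierIntegral_smul_eq_flip (L := innerₗ ℝ)
    Real.continuous_fourierChar continuous_inner hF.comp_neg hg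
  rw [← integral_neg_eq_self] at h
  rw [Real.fourierInv_eq_fourier_comp_neg]
  have h2 : ∫ ξ, F ξ * 𝓕⁻ g ξ = ∫ ξ, F (-ξ) * 𝓕 g ξ := by
    rw [← integral_neg_eq_self]
    simp [Real.fourierInv_eq_fourier_neg]
  rw [h2, ← integral_neg_eq_self]
  simpa using! h

theorem locallyIntegrable_of_memLp {u : ℝ → ℂ} (hu : MemLp u 2 volume) :
    LocallyIntegrable u volume := hu.locallyIntegrable one_le_two

theorem continuous_fourierInv {F : ℝ → ℂ} (hF : Integrable F volume) :
    Continuous (𝓕⁻ F) := by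
  rw [Real.fourierInv_eq_fourier_comp_neg]
  exact VectorFourier.fourierIntegral_continuous Real.continuous_fourierChar
    (by exact continuous_inner) hF.comp_neg

theorem norm_fourierInv_le (F : ℝ → ℂ) (x : ℝ) : ‖𝓕⁻ F x‖ ≤ ∫ ξ, ‖F ξ‖ := by
  rw [Real.fourierInv_eq]
  refine (norm_integral_le_integral_norm _).trans (le_of_eq ?_)
  simp

theorem ae_eq_fourierInv_hat {u : ℝ → ℂ} (hu : MemLp u 2 volume)
    (h : Integrable (hat u) volume) : u =ᵐ[volume] 𝓕⁻ (hat u) := by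
  refine ae_eq_of_integral_schwartz (locallyIntegrable_of_memLp hu)
    (continuous_fourierInv h).locallyIntegrable fun φ => ?_
  rw [integral_fourierInv_mul_eq h φ.integrable, ← toDist_apply hu]
  have h2 := ((isFourierDensity_hat hu).2 (𝓕⁻ φ)).2
  rw [TemperedDistribution.fourier_apply, FourierTransform.fourier_fourierInv_eq] at h2
  rw [h2, SchwartzMap.fourierInv_coe]

/-- Cauchy–Schwarz against the weight. It yields the square root of `wtInt κ σ`; the larger
`prodConst` is used so that one constant governs both products and sup norms. -/
theorem MemW.integrable_and_integral_norm_le {κ σ : ℝ} (hκ : 1 ≤ κ) (hσ2 : 1 / 2 < σ)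
    {F : ℝ → ℂ} (hF : MemW σ F) :
    Integrable F volume ∧ ∫ ξ, ‖F ξ‖ ≤ prodConst κ σ * nrm κ σ F := by
  have e : ∀ ξ, ‖F ξ‖ₑ = ENNReal.ofReal (wt κ ξ ^ (-σ)) * ‖((wt κ ξ ^ σ : ℝ) : ℂ) * F ξ‖ₑ := fun ξ => by
    rw [enorm_weight_mul hκ, ← mul_assoc,
      ← ENNReal.ofReal_mul (Real.rpow_nonneg (wt_pos hκ ξ).le _), ← Real.rpow_add (wt_pos hκ ξ)]
    simp
  have h1 := lintegral_mul_sq_le volume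
    ((continuous_wt_rpow hκ (-σ)).measurable.ennreal_ofReal.aemeasurable) (hF κ hκ).1.enorm
  simp only [← e] at h1
  rw [← eLpNorm_two_sq] at h1
  have e2 : ∫⁻ ξ, ENNReal.ofReal (wt κ ξ ^ (-σ)) ^ 2 = wtInt κ σ := by
    refine lintegral_congr fun ξ => ?_
    rw [← ENNReal.ofReal_pow (Real.rpow_nonneg (wt_pos hκ ξ).le _), ← Real.rpow_natCast,
      ← Real.rpow_mul (wt_pos hκ ξ).le]
    congr 2; push_cast; ring
  rw [e2] at h1
  have hfin := ENNReal.mul_lt_top (wtInt_lt_top hκ hσ2) (ENNReal.pow_lt_top (n := 2) (hF κ hκ).2)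
  have hint : Integrable F volume := by
    refine ⟨hF.aestronglyMeasurable, ?_⟩
    rw [hasFiniteIntegral_iff_enorm]
    have h2 := h1.trans_lt hfin
    by_contra hcon
    rw [not_lt_top_iff.1 hcon] at h2
    simp at h2
  refine ⟨hint, ?_⟩
  refine le_of_sq_le_sq ?_ (mul_nonneg (prodConst_nonneg _ _) (nrm_nonneg _ _ _))
  have h3 := ENNReal.toReal_mono hfin.ne h1
  rw [ENNReal.toReal_pow, ENNReal.toReal_mul, ENNReal.toReal_pow] at h3
  rw [integral_norm_eq_lintegral_enorm hint.1]
  refine h3.trans ?_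
  rw [mul_pow, prodConst, Real.sq_sqrt (by positivity)]
  change _ * nrm κ σ F ^ 2 ≤ _
  have := ENNReal.toReal_nonneg (a := wtInt κ σ)
  gcongr
  linarith

theorem MemSob.integrable_hat {σ : ℝ} (hσ2 : 1 / 2 < σ) {u : ℝ → ℂ} (hu : MemSob σ u) :
    Integrable (hat u) volume := (hu.memW.integrable_and_integral_norm_le le_rfl hσ2).1

theorem MemSob.eq_fourierInv {σ : ℝ} (hσ2 : 1 / 2 < σ) {u : ℝ → ℂ} (hu : MemSob σ u)
    (hc : Continuous u) : u = 𝓕⁻ (hat u) :=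
  (Continuous.ae_eq_iff_eq volume hc (continuous_fourierInv (hu.integrable_hat hσ2))).1
    (ae_eq_fourierInv_hat hu.1 (hu.integrable_hat hσ2))

theorem MemSob.norm_le {κ σ : ℝ} (hκ : 1 ≤ κ) (hσ2 : 1 / 2 < σ) {u : ℝ → ℂ} (hu : MemSob σ u)
    (hc : Continuous u) (x : ℝ) : ‖u x‖ ≤ prodConst κ σ * nrm κ σ (hat u) := by
  conv_lhs => rw [hu.eq_fourierInv hσ2 hc]
  exact (norm_fourierInv_le _ _).trans (hu.memW.integrable_and_integral_norm_le hκ hσ2).2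

theorem MemSob.exists_continuous {σ : ℝ} (hσ2 : 1 / 2 < σ) {u : ℝ → ℂ} (hu : MemSob σ u) :
    ∃ v, Continuous v ∧ MemSob σ v ∧ v =ᵐ[volume] u := by
  have h := ae_eq_fourierInv_hat hu.1 (hu.integrable_hat hσ2)
  exact ⟨_, continuous_fourierInv (hu.integrable_hat hσ2), hu.congr h, h.symm⟩

/-! ### Products of functions -/

theorem MemSob.memLp_mul {σ : ℝ} (hσ2 : 1 / 2 < σ) {h φ : ℝ → ℂ} (hh : MemSob σ h)
    (hφ : MemLp φ 2 volume) : MemLp (fun x => h x * φ x) 2 volume := by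
  refine hφ.of_le_mul (c := ∫ ξ, ‖hat h ξ‖) (hh.1.1.mul hφ.1) ?_
  filter_upwards [ae_eq_fourierInv_hat hh.1 (hh.integrable_hat hσ2)] with x hx
  rw [norm_mul]
  gcongr
  rw [hx]
  exact norm_fourierInv_le _ _

/-- Modulation on one side is translation on the other: this is the defining identity of `hat φ`,
tested on a translate of ψ. -/
theorem integral_mul_exp_mul_fourier {φ : ℝ → ℂ} (hφ : MemLp φ 2 volume) (ψ : 𝓢(ℝ, ℂ)) (η : ℝ) :
    𝓕⁻ (fun x => φ x * 𝓕 (ψ : ℝ → ℂ) x) η = ∫ z, hat φ (z - η) * ψ z := by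
  have h := ((isFourierDensity_hat hφ).2 (SchwartzMap.compSubConstCLM ℂ (-η) ψ)).2
  rw [TemperedDistribution.fourier_apply, toDist_apply hφ] at h
  rw [← integral_add_right_eq_self _ η]
  simp only [add_sub_cancel_right]
  simp only [SchwartzMap.compSubConstCLM_apply, sub_neg_eq_add] at h
  rw [← h, Real.fourierInv_eq]
  congr 1
  ext x
  rw [SchwartzMap.fourier_coe, Real.fourier_eq, Real.fourier_eq]
  simp only [SchwartzMap.compSubConstCLM_apply, sub_neg_eq_add]
  rw [← integral_add_right_eq_self (fun y => Real.fourierChar (-inner ℝ y x) • ψ (y + η)) (-η)]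
  simp only [Circle.smul_def, smul_eq_mul, neg_add_cancel_right]
  rw [← integral_const_mul, ← integral_const_mul, ← integral_const_mul]
  congr 1
  ext y
  have : ((Real.fourierChar (-inner ℝ (y + -η) x) : Circle) : ℂ) =
      (Real.fourierChar (inner ℝ x η) : Circle) * (Real.fourierChar (-inner ℝ y x) : Circle) := by
    rw [← Circle.coe_mul, ← AddChar.map_add_eq_mul]
    congr 2
    simp; ring
  rw [this]; ring

/-- Write h by Fourier inversion, move the inverse transform onto φ · 𝓕ψ, and exchange the
integrals. -/
theorem isFourierDensity_mul {σ : ℝ} (hσ2 : 1 / 2 < σ) (hσ : σ ≤ 1) {h φ : ℝ → ℂ}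
    (hh : MemSob σ h) (hφ : MemLp φ 2 volume) :
    IsFourierDensity (toDist fun x => h x * φ x) (conv (hat h) (hat φ)) := by
  have hφW : MemW 0 (hat φ) := memW_zero_iff.2 (memLp_hat hφ)
  have hW := MemW.conv hσ2 le_rfl (by linarith) hσ hh.memW hφW
  refine ⟨hW.aestronglyMeasurable, fun ψ => ⟨integrable_mul_schwartz_of_memW hW ψ, ?_⟩⟩
  rw [TemperedDistribution.fourier_apply, toDist_apply (hh.memLp_mul hσ2 hφ)]
  have hψ2 : MemLp (𝓕 (ψ : ℝ → ℂ)) 2 volume := by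
    rw [← SchwartzMap.fourier_coe]; exact (𝓕 ψ).memLp 2 volume
  have hg : Integrable (fun x => φ x * 𝓕 (ψ : ℝ → ℂ) x) volume :=
    MemLp.integrable_mul (p := 2) (q := 2) hφ hψ2
  have hψW : MemW (-0) ψ := by rw [neg_zero]; exact memW_zero_iff.2 (ψ.memLp 2 volume)
  have htri := integrable_trilinear hσ2 le_rfl (by linarith) hσ hh.memW hφW hψW
  calc ∫ x, h x * φ x * (𝓕 ψ) x = ∫ x, 𝓕⁻ (hat h) x * (φ x * 𝓕 (ψ : ℝ → ℂ) x) := by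
        apply integral_congr_ae
        filter_upwards [ae_eq_fourierInv_hat hh.1 (hh.integrable_hat hσ2)] with x hx
        rw [← hx, SchwartzMap.fourier_coe]; ring
    _ = ∫ η, hat h η * ∫ z, hat φ (z - η) * ψ z := by
        rw [integral_fourierInv_mul_eq (hh.integrable_hat hσ2) hg]
        simp only [integral_mul_exp_mul_fourier hφ ψ]
    _ = ∫ η, ∫ z, hat h η * hat φ (z - η) * ψ z := by
        simp only [← integral_const_mul, mul_assoc]
    _ = ∫ z, ∫ η, hat h η * hat φ (z - η) * ψ z := (integral_integral_swap htri).symm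
    _ = _ := by
        simp only [integral_mul_const]; rfl

theorem hat_mul {σ : ℝ} (hσ2 : 1 / 2 < σ) (hσ : σ ≤ 1) {h φ : ℝ → ℂ}
    (hh : MemSob σ h) (hφ : MemLp φ 2 volume) :
    hat (fun x => h x * φ x) =ᵐ[volume] conv (hat h) (hat φ) :=
  (isFourierDensity_mul hσ2 hσ hh hφ).fhat_ae_eq

theorem MemSob.mul {σ τ : ℝ} (hσ2 : 1 / 2 < σ) (hτ : 0 ≤ τ) (hτσ : τ ≤ σ) (hσ : σ ≤ 1)
    {h φ : ℝ → ℂ} (hh : MemSob σ h) (hφ : MemSob τ φ) : MemSob τ (fun x => h x * φ x) :=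
  memSob_iff.2 ⟨hh.memLp_mul hσ2 hφ.1,
    (MemW.conv hσ2 hτ hτσ hσ hh.memW hφ.memW).congr (hat_mul hσ2 hσ hh hφ.1).symm⟩

theorem nrm_hat_mul_le {κ σ τ : ℝ} (hκ : 1 ≤ κ) (hσ2 : 1 / 2 < σ) (hτ : 0 ≤ τ) (hτσ : τ ≤ σ)
    (hσ : σ ≤ 1) {h φ : ℝ → ℂ} (hh : MemSob σ h) (hφ : MemSob τ φ) :
    nrm κ τ (hat fun x => h x * φ x) ≤ prodConst κ σ * (nrm κ σ (hat h) * nrm κ τ (hat φ)) := by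
  rw [nrm_congr (hat_mul hσ2 hσ hh hφ.1)]
  exact nrm_conv_le hκ hσ2 hτ hτσ hσ hh.memW hφ.memW

/-! ### Duality -/

theorem MemW.weight_mul {κ σ τ : ℝ} (hκ : 1 ≤ κ) {F : ℝ → ℂ} (hF : MemW σ F) :
    MemW (σ - τ) (fun ξ => ((wt κ ξ ^ τ : ℝ) : ℂ) * F ξ) := by
  refine memW_of_memLp hκ ((hF κ hκ).ae_eq (Filter.Eventually.of_forall fun ξ => ?_))
  simp only
  rw [← mul_assoc, ← Complex.ofReal_mul, ← Real.rpow_add (wt_pos hκ ξ)]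
  congr 3; ring

/-- Riesz representation for the dual of H^{-s}, transported to L² by the weight. The functional is
given on plain functions, so additivity, homogeneity and invariance under almost everywhere equality
are separate hypotheses. -/
theorem exists_of_functional {s κ C : ℝ} (hs : s ≤ 0) (hκ : 1 ≤ κ) (hC : 0 ≤ C) (l : (ℝ → ℂ) → ℂ)
    (hadd : ∀ φ ψ, MemSob (-s) φ → MemSob (-s) ψ → l (fun x => φ x + ψ x) = l φ + l ψ)
    (hsmul : ∀ (c : ℂ) φ, MemSob (-s) φ → l (fun x => c * φ x) = c * l φ)
    (hcongr : ∀ φ ψ, φ =ᵐ[volume] ψ → l φ = l ψ)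
    (hbd : ∀ φ, MemSob (-s) φ → ‖l φ‖ ≤ C * nrm κ (-s) (hat φ)) :
    ∃ T : 𝓢'(ℝ, ℂ), TemperedDistribution.MemSobolev s 2 T ∧
      (∀ φ, MemSob (-s) φ → pairing T (toDist φ) = l φ) ∧ nrm κ s (fhat T) ≤ C := by
  have hs' : 0 ≤ -s := by linarith
  have hch : ∀ Φ : Lp ℂ 2 (volume : Measure ℝ), ∃ u, MemSob (-s) u ∧
      hat u =ᵐ[volume] fun ξ => ((wt κ ξ ^ s : ℝ) : ℂ) * Φ ξ := fun Φ => by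
    refine exists_memSob_hat_eq hs' ?_
    have := (memW_zero_iff.2 (Lp.memLp Φ)).weight_mul hκ (τ := s)
    rwa [zero_sub] at this
  choose u hu huhat using hch
  have hnrm : ∀ Φ, nrm κ (-s) (hat (u Φ)) = ‖Φ‖ := fun Φ => by
    rw [nrm_congr (huhat Φ), nrm, Lp.norm_def]
    congr 1
    refine eLpNorm_congr_ae (Filter.Eventually.of_forall fun ξ => ?_)
    simp only
    rw [← mul_assoc, ← Complex.ofReal_mul, ← Real.rpow_add (wt_pos hκ ξ)]
    simp
  let L : Lp ℂ 2 (volume : Measure ℝ) →ₗ[ℂ] ℂ :=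
    { toFun := fun Φ => l (u Φ)
      map_add' := fun Φ Ψ => by
        rw [← hadd _ _ (hu Φ) (hu Ψ)]
        refine hcongr _ _ (ae_eq_of_hat (hu _).1 ((hu Φ).add (hu Ψ)).1 ?_)
        filter_upwards [huhat Φ, huhat Ψ, huhat (Φ + Ψ), hat_add (hu Φ).1 (hu Ψ).1,
          Lp.coeFn_add Φ Ψ] with ξ h1 h2 h3 h4 h5
        rw [h3, h4, h1, h2, h5]; simp [mul_add]
      map_smul' := fun c Φ => by
        rw [RingHom.id_apply, smul_eq_mul, ← hsmul _ _ (hu Φ)]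
        refine hcongr _ _ (ae_eq_of_hat (hu _).1 ((hu Φ).const_mul c).1 ?_)
        filter_upwards [huhat Φ, huhat (c • Φ), hat_const_mul (hu Φ).1 c,
          Lp.coeFn_smul c Φ] with ξ h1 h2 h3 h4
        rw [h2, h3, h1, h4]; simp [mul_left_comm] }
  let Lc := L.mkContinuous C fun Φ => by
    rw [← hnrm Φ]; exact hbd _ (hu Φ)
  let t := (InnerProductSpace.toDual ℂ (Lp ℂ 2 (volume : Measure ℝ))).symm Lc
  have ht : ‖t‖ ≤ C := by
    simp only [t, LinearIsometryEquiv.norm_map]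
    exact L.mkContinuous_norm_le hC _
  have htW : MemW (-s) (fun ξ => ((wt κ ξ ^ s : ℝ) : ℂ) * t ξ) := by
    have := (memW_zero_iff.2 (Lp.memLp t)).weight_mul hκ (τ := s)
    rwa [zero_sub] at this
  have htW' : MemW s (fun ξ => ((wt κ ξ ^ (-s) : ℝ) : ℂ) * t ξ) := by
    have := (memW_zero_iff.2 (Lp.memLp t)).weight_mul hκ (τ := -s)
    rwa [zero_sub, neg_neg] at this
  -- The inner product conjugates the Riesz vector and the pairing reflects frequencies; conjugation
  -- with reflection undoes both.
  obtain ⟨T, hT, hTF⟩ := exists_fhat_eq htW'.conj_neg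
  refine ⟨T, hT, fun φ hφ => ?_, ?_⟩
  · have hΦ := (hφ.memW κ hκ)
    have e1 : l φ = Lc (hΦ.toLp _) := by
      change l φ = l (u (hΦ.toLp _))
      refine hcongr _ _ (ae_eq_of_hat hφ.1 (hu _).1 ?_)
      filter_upwards [huhat (hΦ.toLp _), hΦ.coeFn_toLp] with ξ h1 h2
      rw [h1, h2, ← mul_assoc, ← Complex.ofReal_mul, ← Real.rpow_add (wt_pos hκ ξ)]
      simp
    rw [e1, ← InnerProductSpace.toDual_symm_apply, L2.inner_def, pairing_eq, ← integral_neg_eq_self]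
    apply integral_congr_ae
    filter_upwards [ae_neg hTF, hΦ.coeFn_toLp] with ξ h1 h2
    rw [h1, h2, neg_neg, RCLike.inner_apply]
    simp only [map_mul, Complex.conj_ofReal, t]
    ring
  · rw [nrm_congr hTF, nrm_conj_neg hκ htW']
    refine le_trans (le_of_eq ?_) ht
    rw [nrm, Lp.norm_def]
    congr 1
    refine eLpNorm_congr_ae (Filter.Eventually.of_forall fun ξ => ?_)
    simp only
    rw [← mul_assoc, ← Complex.ofReal_mul, ← Real.rpow_add (wt_pos hκ ξ)]
    simp

/-! ### Multipliers -/

/-- `g` is the sum of a constant and an element of `H^σ(ℝ)`. -/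
def IsMult (σ : ℝ) (g : ℝ → ℂ) : Prop := ∃ c : ℂ, MemSob σ (fun x => g x - c)

theorem MemSob.isMult {σ : ℝ} {g : ℝ → ℂ} (h : MemSob σ g) : IsMult σ g := ⟨0, by simpa using h⟩

theorem MemSob.isMult_add_one {σ : ℝ} {g : ℝ → ℂ} (h : MemSob σ g) : IsMult σ (fun x => g x + 1) :=
  ⟨1, by simpa using h⟩

theorem IsMult.mul_memSob {σ τ : ℝ} (hσ2 : 1 / 2 < σ) (hτ : 0 ≤ τ) (hτσ : τ ≤ σ) (hσ : σ ≤ 1)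
    {g φ : ℝ → ℂ} (hg : IsMult σ g) (hφ : MemSob τ φ) : MemSob τ (fun x => g x * φ x) := by
  obtain ⟨c, hc⟩ := hg
  convert (hc.mul hσ2 hτ hτσ hσ hφ).add (hφ.const_mul c) using 2
  ring

theorem IsMult.exists_nrm_le {κ σ τ : ℝ} (hκ : 1 ≤ κ) (hσ2 : 1 / 2 < σ) (hτ : 0 ≤ τ) (hτσ : τ ≤ σ)
    (hσ : σ ≤ 1) {g : ℝ → ℂ} (hg : IsMult σ g) :
    ∃ C, 0 ≤ C ∧ ∀ φ, MemSob τ φ → nrm κ τ (hat fun x => g x * φ x) ≤ C * nrm κ τ (hat φ) := by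
  obtain ⟨c, hc⟩ := hg
  refine ⟨prodConst κ σ * nrm κ σ (hat fun x => g x - c) + ‖c‖, ?_, fun φ hφ => ?_⟩
  · have := prodConst_nonneg κ σ
    have := nrm_nonneg κ σ (hat fun x => g x - c)
    positivity
  · have e : (fun x => g x * φ x) = fun x => (g x - c) * φ x + c * φ x := by ext x; ring
    have h1 := hc.mul hσ2 hτ hτσ hσ hφ
    have h2 := hφ.const_mul c
    rw [e, nrm_congr (hat_add h1.1 h2.1)]
    refine (nrm_add_le hκ h1.memW h2.memW).trans ?_
    rw [nrm_congr (hat_const_mul hφ.1 c), nrm_const_mul, add_mul, mul_assoc]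
    gcongr
    exact nrm_hat_mul_le hκ hσ2 hτ hτσ hσ hc hφ

/-- Multiplication on H^s is the transpose of multiplication on H^{-s} and inherits its bound. The
product estimate applies with τ = -s and σ = s+1 because s > -1/2. `C` is left free to serve
constants plus H^{s+1} as well as the sharp bound for g in H^{s+1}. -/
theorem exists_product {s κ C : ℝ} (hs : -(1 / 2) < s) (hs' : s < 0) (hκ : 1 ≤ κ) (hC : 0 ≤ C)
    {g : ℝ → ℂ} (hg : IsMult (s + 1) g)
    (hgC : ∀ φ, MemSob (-s) φ → nrm κ (-s) (hat fun x => g x * φ x) ≤ C * nrm κ (-s) (hat φ))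
    {T : 𝓢'(ℝ, ℂ)} (hT : TemperedDistribution.MemSobolev s 2 T) :
    ∃ P : 𝓢'(ℝ, ℂ), TemperedDistribution.MemSobolev s 2 P ∧
      (∀ φ, MemSob (-s) φ → pairing P (toDist φ) = pairing T (toDist fun x => g x * φ x)) ∧
      nrm κ s (fhat P) ≤ nrm κ s (fhat T) * C := by
  have hm : ∀ φ, MemSob (-s) φ → MemSob (-s) (fun x => g x * φ x) := fun φ hφ =>
    hg.mul_memSob (by linarith) (by linarith) (by linarith) (by linarith) hφ
  refine exists_of_functional hs'.le hκ (mul_nonneg (nrm_nonneg _ _ _) hC)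
    (fun φ => pairing T (toDist fun x => g x * φ x)) ?_ ?_ ?_ ?_
  · intro φ ψ hφ hψ
    rw [← pairing_add_right hT (hm φ hφ) (hm ψ hψ)]
    simp only [mul_add]
  · intro c φ hφ
    rw [← pairing_const_mul_right T (hm φ hφ).1]
    congr 2
    ext x
    ring
  · intro φ ψ h
    exact congrArg (pairing T) (toDist_congr (by filter_upwards [h] with x hx; rw [hx]))
  · intro φ hφ
    refine (norm_pairing_le hκ hT (hm φ hφ)).trans ?_
    rw [mul_assoc]
    exact mul_le_mul_of_nonneg_left (hgC φ hφ) (nrm_nonneg _ _ _)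

/-- The tests range over all of H^{-s}, the form needed when products are multiplied again by
Sobolev functions. -/
theorem mulDist_eq {s : ℝ} (hs : -(1 / 2) < s) (hs' : s < 0) {g : ℝ → ℂ} (hg : IsMult (s + 1) g)
    {T P : 𝓢'(ℝ, ℂ)} (hT : TemperedDistribution.MemSobolev s 2 T)
    (hP : TemperedDistribution.MemSobolev s 2 P)
    (h : ∀ φ, MemSob (-s) φ → pairing P (toDist φ) = pairing T (toDist fun x => g x * φ x)) :
    mulDist g T = P := by
  have hex : IsProduct g T P := fun φ =>
    ⟨integrable_pairing hT (hg.mul_memSob (by linarith) (by linarith) (by linarith) (by linarith)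
      (memSob_schwartz (-s) φ)), by
      rw [← h φ (memSob_schwartz (-s) φ), pairing_schwartz hP]⟩
  have h2 : ∃ P : 𝓢'(ℝ, ℂ), IsProduct g T P := ⟨P, hex⟩
  rw [mulDist, dif_pos h2]
  ext φ
  rw [(h2.choose_spec φ).2, (hex φ).2]

theorem mulDist_spec {s : ℝ} (hs : -(1 / 2) < s) (hs' : s < 0) {g : ℝ → ℂ} (hg : IsMult (s + 1) g)
    {T : 𝓢'(ℝ, ℂ)} (hT : TemperedDistribution.MemSobolev s 2 T) :
    TemperedDistribution.MemSobolev s 2 (mulDist g T) ∧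
      ∀ φ, MemSob (-s) φ →
        pairing (mulDist g T) (toDist φ) = pairing T (toDist fun x => g x * φ x) := by
  obtain ⟨C, hC, hgC⟩ := hg.exists_nrm_le (τ := -s) le_rfl (by linarith) (by linarith) (by linarith)
    (by linarith)
  obtain ⟨P, hP, h, -⟩ := exists_product hs hs' le_rfl hC hg hgC hT
  rw [mulDist_eq hs hs' hg hT hP h]
  exact ⟨hP, h⟩

theorem nrm_mulDist_le {s κ : ℝ} (hs : -(1 / 2) < s) (hs' : s < 0) (hκ : 1 ≤ κ) {g : ℝ → ℂ}
    (hg : MemSob (s + 1) g) {T : 𝓢'(ℝ, ℂ)} (hT : TemperedDistribution.MemSobolev s 2 T) :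
    nrm κ s (fhat (mulDist g T)) ≤
      nrm κ s (fhat T) * (prodConst κ (s + 1) * nrm κ (s + 1) (hat g)) := by
  obtain ⟨P, hP, h, hle⟩ := exists_product hs hs' hκ
    (mul_nonneg (prodConst_nonneg κ (s + 1)) (nrm_nonneg κ (s + 1) (hat g))) hg.isMult
    (fun φ hφ => by
      rw [mul_assoc]
      exact nrm_hat_mul_le hκ (by linarith) (by linarith) (by linarith) (by linarith) hg hφ) hT
  rwa [mulDist_eq hs hs' hg.isMult hT hP h]

/-! ### The Leibniz rule -/

/-- The distributional derivative of a function. -/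
noncomputable def dv (u : ℝ → ℂ) : 𝓢'(ℝ, ℂ) := TemperedDistribution.derivCLM ℂ (toDist u)

theorem MemSob.memSobolev_dv {s : ℝ} {u : ℝ → ℂ} (hu : MemSob (s + 1) u) :
    TemperedDistribution.MemSobolev s 2 (dv u) := memSobolev_derivCLM hu.2

theorem fhat_dv {σ : ℝ} {u : ℝ → ℂ} (hu : MemSob σ u) :
    fhat (dv u) =ᵐ[volume] fun ξ => 2 * Real.pi * Complex.I * ξ * hat u ξ := fhat_derivCLM hu.2

/-- On the Fourier side the Leibniz rule is ξ = η + (ξ-η) inside the convolution; the rest is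
Fubini. -/
theorem pairing_dv_mul {s : ℝ} (hs : -(1 / 2) < s) (hs' : s < 0) {u v φ : ℝ → ℂ}
    (hu : MemSob (s + 1) u) (hv : MemSob (s + 1) v) (hφ : MemSob (-s) φ) :
    pairing (dv fun x => u x * v x) (toDist φ) =
      pairing (dv u) (toDist fun x => v x * φ x) + pairing (dv v) (toDist fun x => u x * φ x) := by
  have h1 : 1 / 2 < s + 1 := by linarith
  have h2 : s + 1 ≤ 1 := by linarith
  have h3 : 0 ≤ -s := by linarith
  have h4 : -s ≤ s + 1 := by linarith
  have hD : ∀ {w : ℝ → ℂ}, MemSob (s + 1) w →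
      MemW (- -s) (fun x : ℝ => 2 * Real.pi * Complex.I * (-x : ℝ) * hat w (-x)) := fun {w} hw => by
    have := (memW_fhat hw.memSobolev_dv).congr (fhat_dv hw)
    have h5 := this.conj_neg.conj_neg
    have h6 : MemW s (fun x : ℝ => 2 * Real.pi * Complex.I * x * hat w x) := this
    rw [neg_neg]
    intro κ hκ
    have := (h6 κ hκ).comp_measurePreserving (Measure.measurePreserving_neg volume)
    refine this.ae_eq (Filter.Eventually.of_forall fun ξ => ?_)
    simp
  -- Measure-preserving linear changes of variables that carry `integrable_trilinear` to the two
  -- integrands below.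
  have mp2 : MeasurePreserving (fun p : ℝ × ℝ => (-p.1, p.2 - p.1)) (volume.prod volume)
      (volume.prod volume) :=
    ((Measure.measurePreserving_neg volume).prod (MeasurePreserving.id volume)).comp
      (measurePreserving_prod_sub volume volume)
  have mp1 : MeasurePreserving (fun p : ℝ × ℝ => (p.1 - p.2, p.1)) (volume.prod volume)
      (volume.prod volume) := by
    have := (((Measure.measurePreserving_neg volume).prod (MeasurePreserving.id volume)).comp
      (measurePreserving_sub_prod volume volume)).comp
      (Measure.measurePreserving_swap (μ := (volume : Measure ℝ)) (ν := (volume : Measure ℝ)))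
    convert this using 2 with p
    simp
  have I2 := mp2.integrable_comp_of_integrable (integrable_trilinear h1 h3 h4 h2 hv.memW hφ.memW (hD hu))
  have I1 := mp1.integrable_comp_of_integrable (integrable_trilinear h1 h3 h4 h2 hu.memW hφ.memW (hD hv))
  have J1 : Integrable (fun p : ℝ × ℝ => hat u p.1 *
      ((2 * Real.pi * Complex.I * (p.2 - p.1 : ℝ) * hat v (p.2 - p.1)) * hat φ (-p.2)))
      (volume.prod volume) := by
    refine I1.congr (Filter.Eventually.of_forall fun p => ?_)
    simp only [Function.comp_apply, neg_sub, sub_sub_cancel_left]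
    ring
  have J2 : Integrable (fun p : ℝ × ℝ => (2 * Real.pi * Complex.I * p.1 * hat u p.1) *
      (hat v (p.2 - p.1) * hat φ (-p.2))) (volume.prod volume) := by
    refine I2.congr (Filter.Eventually.of_forall fun p => ?_)
    simp only [Function.comp_apply, neg_neg, show -p.1 - (p.2 - p.1) = -p.2 by ring]
    ring
  have E2 : pairing (dv u) (toDist fun x => v x * φ x) = ∫ η, ∫ ξ,
      (2 * Real.pi * Complex.I * η * hat u η) * (hat v (ξ - η) * hat φ (-ξ)) := by
    rw [pairing_eq]
    apply integral_congr_ae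
    filter_upwards [fhat_dv hu, ae_neg (hat_mul h1 h2 hv hφ.1)] with η e1 e2
    rw [e1, e2, integral_const_mul]
    congr 1
    rw [conv, ← integral_sub_right_eq_self _ η]
    congr 1
    ext ξ
    congr 2; ring
  have E1 : pairing (dv v) (toDist fun x => u x * φ x) = ∫ η, ∫ ξ, hat u η *
      ((2 * Real.pi * Complex.I * (ξ - η : ℝ) * hat v (ξ - η)) * hat φ (-ξ)) := by
    rw [pairing_eq]
    have K := ((Measure.measurePreserving_neg volume).prod
      (MeasurePreserving.id volume)).integrable_comp_of_integrable
      (integrable_trilinear h1 h3 h4 h2 hu.memW hφ.memW (hD hv))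
    calc _ = ∫ ζ, ∫ η, hat u η * ((2 * Real.pi * Complex.I * ζ * hat v ζ) * hat φ (-ζ - η)) := by
          apply integral_congr_ae
          filter_upwards [fhat_dv hv, ae_neg (hat_mul h1 h2 hu hφ.1)] with ζ e1 e2
          rw [e1, e2, conv, ← integral_const_mul]
          congr 1; ext η; ring
      _ = ∫ η, ∫ ζ, hat u η * ((2 * Real.pi * Complex.I * ζ * hat v ζ) * hat φ (-ζ - η)) := by
          refine integral_integral_swap (K.congr (Filter.Eventually.of_forall fun p => ?_))
          simp only [Function.comp_apply, Function.uncurry, Prod.map, neg_neg, id]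
          ring
      _ = _ := by
          congr 1; ext η
          rw [← integral_sub_right_eq_self _ η]
          congr 1; ext ξ
          rw [show -(ξ - η) - η = -ξ by ring]
  have E0 : pairing (dv fun x => u x * v x) (toDist φ) = ∫ ξ, ∫ η,
      ((2 * Real.pi * Complex.I * η * hat u η) * (hat v (ξ - η) * hat φ (-ξ)) + hat u η *
      ((2 * Real.pi * Complex.I * (ξ - η : ℝ) * hat v (ξ - η)) * hat φ (-ξ))) := by
    rw [pairing_eq]
    apply integral_congr_ae
    have huv := hu.mul h1 (by linarith) le_rfl h2 hv
    filter_upwards [fhat_dv huv, hat_mul h1 h2 hu hv.1] with ξ e1 e2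
    rw [e1, e2, conv, ← integral_const_mul, ← integral_mul_const]
    congr 1; ext η
    push_cast; ring
  have J : Integrable (Function.uncurry fun ξ η : ℝ =>
      (2 * Real.pi * Complex.I * η * hat u η) * (hat v (ξ - η) * hat φ (-ξ)) + hat u η *
      ((2 * Real.pi * Complex.I * (ξ - η : ℝ) * hat v (ξ - η)) * hat φ (-ξ)))
      (volume.prod volume) := (J2.add J1).swap
  rw [E0, E1, E2, integral_integral_swap J,
    ← integral_add J2.integral_prod_left J1.integral_prod_left]
  apply integral_congr_ae
  filter_upwards [J2.prod_right_ae, J1.prod_right_ae] with η a b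
  exact integral_add a b

/-! ### The difference-quotient characterization of `H^σ`, `0 < σ < 1` -/

theorem hat_translate {f : ℝ → ℂ} (hf : MemLp f 2 volume) (h : ℝ) :
    hat (fun x => f (x + h)) =ᵐ[volume] fun ξ => (Real.fourierChar (h * ξ) : ℂ) * hat f ξ := by
  have hf' : MemLp (fun x => f (x + h)) 2 volume :=
    hf.comp_measurePreserving (measurePreserving_add_right volume h)
  have hm : MemW 0 (fun ξ => (Real.fourierChar (h * ξ) : ℂ) * hat f ξ) := by
    rw [memW_zero_iff]
    refine (memLp_hat hf).of_le ?_ (Filter.Eventually.of_forall fun ξ => by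
      rw [norm_mul, Circle.norm_coe, one_mul])
    exact (Continuous.aestronglyMeasurable (by fun_prop)).mul (memLp_hat hf).1
  refine IsFourierDensity.fhat_ae_eq ⟨hm.aestronglyMeasurable, fun φ =>
    ⟨integrable_mul_schwartz_of_memW hm φ, ?_⟩⟩
  rw [TemperedDistribution.fourier_apply, toDist_apply hf', ← integral_sub_right_eq_self _ h]
  simp only [sub_add_cancel]
  have h2 := ((isFourierDensity_hat hf).2 (𝓕⁻ (SchwartzMap.compSubConstCLM ℂ h (𝓕 φ)))).2
  rw [TemperedDistribution.fourier_apply, FourierTransform.fourier_fourierInv_eq,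
    toDist_apply hf] at h2
  simp only [SchwartzMap.compSubConstCLM_apply] at h2
  rw [h2]
  congr 1
  ext ξ
  have h3 : (𝓕⁻ (SchwartzMap.compSubConstCLM ℂ h (𝓕 φ))) ξ = (Real.fourierChar (h * ξ) : ℂ) * φ ξ := by
    have h4 : φ ξ = (𝓕⁻ (𝓕 φ)) ξ := by rw [FourierTransform.fourierInv_fourier_eq]
    rw [h4, SchwartzMap.fourierInv_coe, SchwartzMap.fourierInv_coe, Real.fourierInv_eq,
      Real.fourierInv_eq, ← integral_add_right_eq_self _ h, ← integral_const_mul]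
    congr 1
    ext x
    have : (Real.fourierChar (inner ℝ (x + h) ξ) : ℂ) =
        (Real.fourierChar (h * ξ) : ℂ) * Real.fourierChar (inner ℝ x ξ) := by
      rw [← Circle.coe_mul, ← AddChar.map_add_eq_mul]
      congr 2
      simp; ring
    rw [Circle.smul_def, Circle.smul_def, SchwartzMap.compSubConstCLM_apply, add_sub_cancel_right,
      smul_eq_mul, smul_eq_mul, this]
    ring
  rw [h3]; ring

theorem lintegral_translate_sub {f : ℝ → ℂ} (hf : MemLp f 2 volume) (h : ℝ) :
    ∫⁻ x, ‖f (x + h) - f x‖ₑ ^ 2 =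
      ∫⁻ ξ, ‖(Real.fourierChar (h * ξ) : ℂ) - 1‖ₑ ^ 2 * ‖hat f ξ‖ₑ ^ 2 := by
  have hf' : MemLp (fun x => f (x + h)) 2 volume :=
    hf.comp_measurePreserving (measurePreserving_add_right volume h)
  have h1 : MemLp (fun x => f (x + h) + (-1) * f x) 2 volume := hf'.add (hf.const_mul (-1))
  have h2 := congrArg (· ^ 2) (eLpNorm_hat h1)
  simp only [eLpNorm_two_sq] at h2
  simp only [neg_mul, one_mul, ← sub_eq_add_neg] at h2
  rw [← h2]
  apply lintegral_congr_ae
  filter_upwards [hat_add hf' (hf.const_mul (-1)), hat_translate hf h, hat_const_mul hf (-1)]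
    with ξ e1 e2 e3
  simp only [neg_mul, one_mul, ← sub_eq_add_neg] at e1 e3
  rw [← mul_pow, ← enorm_mul, e1, e2, e3]
  congr 2; ring

/-- The symbol of the Gagliardo seminorm. -/
noncomputable def gagSymbol (σ ξ : ℝ) : ℝ≥0∞ :=
  ∫⁻ h, ENNReal.ofReal (|h| ^ (-(1 + 2 * σ))) * ‖(Real.fourierChar (h * ξ) : ℂ) - 1‖ₑ ^ 2

/-- Scaling h by ξ shows that the symbol is homogeneous of degree 2σ. -/
theorem gagSymbol_eq {σ ξ : ℝ} (hξ : ξ ≠ 0) :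
    gagSymbol σ ξ = ENNReal.ofReal (|ξ| ^ (2 * σ)) * gagSymbol σ 1 := by
  have h0 : 0 < |ξ| := abs_pos.2 hξ
  have h := lintegral_comp_mul_left hξ
    (fun h => ENNReal.ofReal (|h| ^ (-(1 + 2 * σ))) * ‖(Real.fourierChar (h * 1) : ℂ) - 1‖ₑ ^ 2)
  have e : ∀ h : ℝ, ENNReal.ofReal (|h| ^ (-(1 + 2 * σ))) * ‖(Real.fourierChar (h * ξ) : ℂ) - 1‖ₑ ^ 2 =
      ENNReal.ofReal (|ξ| ^ (1 + 2 * σ)) * (ENNReal.ofReal (|ξ * h| ^ (-(1 + 2 * σ))) *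
        ‖(Real.fourierChar (ξ * h * 1) : ℂ) - 1‖ₑ ^ 2) := fun h => by
    rw [← mul_assoc, ← ENNReal.ofReal_mul (Real.rpow_nonneg h0.le _), abs_mul,
      Real.mul_rpow h0.le (abs_nonneg h), ← mul_assoc, ← Real.rpow_add h0]
    simp [mul_comm]
  unfold gagSymbol
  simp only [e]
  rw [lintegral_const_mul' _ _ ENNReal.ofReal_ne_top, h, ← mul_assoc,
    ← ENNReal.ofReal_mul (Real.rpow_nonneg h0.le _), abs_inv, ← Real.rpow_neg_one |ξ|,
    ← Real.rpow_add h0]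
  congr 3; ring

theorem norm_fourierChar_sub_one_le (h : ℝ) :
    ‖(Real.fourierChar h : ℂ) - 1‖ ≤ 2 * Real.pi * |h| := by
  rw [Real.fourierChar_apply]
  have := Real.norm_exp_I_mul_ofReal_sub_one_le (x := 2 * Real.pi * h)
  rw [mul_comm Complex.I] at this
  refine this.trans (le_of_eq ?_)
  rw [Real.norm_eq_abs, abs_mul, abs_of_pos (by positivity : 0 < 2 * Real.pi)]

/-- Near 0 the integrand is at most a multiple of h^{1-2σ}, integrable as σ < 1. At infinity it is
at most 4h^{-1-2σ}, integrable as σ > 0. Conjugation handles h < 0. -/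
theorem gagSymbol_one_lt_top {σ : ℝ} (h0 : 0 < σ) (h1 : σ < 1) : gagSymbol σ 1 < ⊤ := by
  have hI1 : IntegrableOn (fun h : ℝ => (2 * Real.pi) ^ 2 * h ^ (1 - 2 * σ)) (Set.Ioc 0 1) volume := by
    have := (intervalIntegral.intervalIntegrable_rpow' (a := 0) (b := 1)
      (r := 1 - 2 * σ) (by linarith)).const_mul ((2 * Real.pi) ^ 2)
    rwa [intervalIntegrable_iff_integrableOn_Ioc_of_le zero_le_one] at this
  have hI2 : IntegrableOn (fun h : ℝ => 4 * h ^ (-(1 + 2 * σ))) (Set.Ioi 1) volume :=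
    (integrableOn_Ioi_rpow_of_lt (by linarith) one_pos).const_mul 4
  have hI : ∫⁻ h in Set.Ioi (0 : ℝ), ENNReal.ofReal (|h| ^ (-(1 + 2 * σ))) *
      ‖(Real.fourierChar (h * 1) : ℂ) - 1‖ₑ ^ 2 < ⊤ := by
    rw [← Set.Ioc_union_Ioi_eq_Ioi zero_le_one]
    refine (lintegral_union_le _ _ _).trans_lt (ENNReal.add_lt_top.2 ⟨?_, ?_⟩)
    · refine lt_of_le_of_lt (setLIntegral_mono' measurableSet_Ioc fun h hh => ?_)
        hI1.setLIntegral_lt_top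
      rw [abs_of_pos hh.1, mul_one, ← ofReal_norm, ← ENNReal.ofReal_pow (norm_nonneg _),
        ← ENNReal.ofReal_mul (Real.rpow_nonneg hh.1.le _)]
      refine ENNReal.ofReal_le_ofReal ?_
      have h2 := norm_fourierChar_sub_one_le h
      rw [abs_of_pos hh.1] at h2
      calc h ^ (-(1 + 2 * σ)) * ‖(Real.fourierChar h : ℂ) - 1‖ ^ 2
          ≤ h ^ (-(1 + 2 * σ)) * (2 * Real.pi * h) ^ 2 := by
            have := Real.rpow_nonneg hh.1.le (-(1 + 2 * σ))
            gcongr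
        _ = (2 * Real.pi) ^ 2 * (h ^ (-(1 + 2 * σ)) * h ^ (2 : ℝ)) := by rw [Real.rpow_two]; ring
        _ = _ := by rw [← Real.rpow_add hh.1]; congr 2; ring
    · refine lt_of_le_of_lt (setLIntegral_mono' measurableSet_Ioi fun h hh => ?_)
        hI2.setLIntegral_lt_top
      have hh' : (0 : ℝ) < h := lt_trans one_pos hh
      rw [abs_of_pos hh', mul_one, ← ofReal_norm, ← ENNReal.ofReal_pow (norm_nonneg _),
        ← ENNReal.ofReal_mul (Real.rpow_nonneg hh'.le _)]
      refine ENNReal.ofReal_le_ofReal ?_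
      have h2 : ‖(Real.fourierChar h : ℂ) - 1‖ ≤ 2 := by
        refine (norm_sub_le _ _).trans ?_
        rw [Circle.norm_coe, norm_one]; norm_num
      have h3 : ‖(Real.fourierChar h : ℂ) - 1‖ ^ 2 ≤ 4 := by
        nlinarith [norm_nonneg ((Real.fourierChar h : ℂ) - 1)]
      have := Real.rpow_nonneg hh'.le (-(1 + 2 * σ))
      rw [mul_comm]
      exact mul_le_mul_of_nonneg_right h3 this
  have hneg : ∫⁻ h in Set.Iio (0 : ℝ), ENNReal.ofReal (|h| ^ (-(1 + 2 * σ))) *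
      ‖(Real.fourierChar (h * 1) : ℂ) - 1‖ₑ ^ 2 = ∫⁻ h in Set.Ioi (0 : ℝ),
      ENNReal.ofReal (|h| ^ (-(1 + 2 * σ))) * ‖(Real.fourierChar (h * 1) : ℂ) - 1‖ₑ ^ 2 := by
    rw [← (Measure.measurePreserving_neg (volume : Measure ℝ)).setLIntegral_comp_preimage_emb
      (MeasurableEquiv.neg ℝ).measurableEmbedding _ (Set.Ioi 0)]
    simp only [Set.neg_preimage, Set.neg_Ioi, neg_zero]
    refine setLIntegral_congr_fun measurableSet_Iio fun h _ => ?_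
    simp only [abs_neg, mul_one]
    congr 2
    have : ((Real.fourierChar (-h) : Circle) : ℂ) - 1 = conj ((Real.fourierChar h : ℂ) - 1) := by
      rw [AddChar.map_neg_eq_inv, Circle.coe_inv_eq_conj, map_sub, map_one]
    rw [this, ← ofReal_norm, ← ofReal_norm, RCLike.norm_conj]
  unfold gagSymbol
  rw [← lintegral_add_compl _ (measurableSet_Ioi (a := (0 : ℝ))), Set.compl_Ioi,
    setLIntegral_congr Iio_ae_eq_Iic.symm, hneg]
  exact ENNReal.add_lt_top.2 ⟨hI, hI⟩

/-- The integrand is positive on (0,1), where e^{2πih} ≠ 1. Nonvanishing is what lets a finite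
Gagliardo integral bound the weighted norm. -/
theorem gagSymbol_one_ne_zero (σ : ℝ) : gagSymbol σ 1 ≠ 0 := by
  intro h0
  unfold gagSymbol at h0
  have hm : Measurable fun h : ℝ => ENNReal.ofReal (|h| ^ (-(1 + 2 * σ))) *
      ‖(Real.fourierChar (h * 1) : ℂ) - 1‖ₑ ^ 2 := by
    refine Measurable.mul (by fun_prop) (Measurable.pow_const (Measurable.enorm ?_) 2)
    exact (Continuous.measurable (by fun_prop))
  rw [lintegral_eq_zero_iff hm] at h0
  have h1 : (volume : Measure ℝ) (Set.Ioo 0 1) = 0 := by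
    refine measure_mono_null (fun h hh => ?_) h0
    simp only [Set.mem_compl_iff, Set.mem_ofPred_eq, Pi.zero_apply, mul_eq_zero, not_or]
    refine ⟨?_, ?_⟩
    · rw [ENNReal.ofReal_eq_zero, not_le]
      exact Real.rpow_pos_of_pos (abs_pos.2 hh.1.ne') _
    · simp only [mul_one, pow_eq_zero_iff two_ne_zero, enorm_eq_zero, sub_eq_zero]
      intro h2
      rw [Real.fourierChar_apply, Complex.exp_eq_one_iff] at h2
      obtain ⟨n, hn⟩ := h2
      have h3 : ((h : ℝ) : ℂ) = ((n : ℝ) : ℂ) := by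
        have h4 : (2 * Real.pi * Complex.I : ℂ) ≠ 0 := Complex.two_pi_I_ne_zero
        apply mul_right_cancel₀ h4
        push_cast at hn ⊢
        linear_combination hn
      have h5 : h = n := by exact_mod_cast h3
      have a := hh.1; have b := hh.2
      rw [h5] at a b
      have a' : (0 : ℤ) < n := by exact_mod_cast a
      have b' : n < (1 : ℤ) := by exact_mod_cast b
      omega
  simp at h1

theorem lintegral_gagliardo {σ : ℝ} {f : ℝ → ℂ} (hf : MemLp f 2 volume) :
    ∫⁻ h, ENNReal.ofReal (|h| ^ (-(1 + 2 * σ))) * ∫⁻ x, ‖f (x + h) - f x‖ₑ ^ 2 =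
      gagSymbol σ 1 * ∫⁻ ξ, ENNReal.ofReal (|ξ| ^ (2 * σ)) * ‖hat f ξ‖ₑ ^ 2 := by
  have hw : Measurable fun h : ℝ => ENNReal.ofReal (|h| ^ (-(1 + 2 * σ))) := by fun_prop
  have hhm : AEMeasurable (fun ξ => ‖hat f ξ‖ₑ ^ 2) volume := (memLp_hat hf).1.enorm.pow_const 2
  have hc : Measurable fun p : ℝ × ℝ => ‖(Real.fourierChar (p.1 * p.2) : ℂ) - 1‖ₑ ^ 2 :=
    (Measurable.enorm (Continuous.measurable (by fun_prop))).pow_const 2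
  simp only [lintegral_translate_sub hf]
  calc _ = ∫⁻ h, ∫⁻ ξ, ENNReal.ofReal (|h| ^ (-(1 + 2 * σ))) *
        (‖(Real.fourierChar (h * ξ) : ℂ) - 1‖ₑ ^ 2 * ‖hat f ξ‖ₑ ^ 2) := by
        refine lintegral_congr fun h => ?_
        rw [lintegral_const_mul' _ _ ENNReal.ofReal_ne_top]
    _ = ∫⁻ ξ, ∫⁻ h, ENNReal.ofReal (|h| ^ (-(1 + 2 * σ))) *
        (‖(Real.fourierChar (h * ξ) : ℂ) - 1‖ₑ ^ 2 * ‖hat f ξ‖ₑ ^ 2) := by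
        refine lintegral_lintegral_swap ?_
        exact (hw.comp measurable_fst).aemeasurable.mul (hc.aemeasurable.mul hhm.comp_snd)
    _ = ∫⁻ ξ, gagSymbol σ ξ * ‖hat f ξ‖ₑ ^ 2 := by
        refine lintegral_congr fun ξ => ?_
        simp only [← mul_assoc]
        rw [lintegral_mul_const' _ _ (by simp)]; rfl
    _ = ∫⁻ ξ, gagSymbol σ 1 * (ENNReal.ofReal (|ξ| ^ (2 * σ)) * ‖hat f ξ‖ₑ ^ 2) := by
        apply lintegral_congr_ae
        have : ∀ᵐ ξ : ℝ, ξ ≠ 0 := by simp [ae_iff]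
        filter_upwards [this] with ξ hξ
        rw [gagSymbol_eq hξ, mul_comm (ENNReal.ofReal _), mul_assoc]
    _ = _ := by
        rw [lintegral_const_mul'']
        exact (Measurable.aemeasurable (by fun_prop)).mul hhm

/-- The right-hand side sees f only through |f(x+h) - f(x)|, hence is stable under Lipschitz maps.
-/
theorem memSob_iff_lintegral {σ : ℝ} (h0 : 0 < σ) (h1 : σ < 1) {f : ℝ → ℂ} (hf : MemLp f 2 volume) :
    MemSob σ f ↔
      ∫⁻ h, ENNReal.ofReal (|h| ^ (-(1 + 2 * σ))) * ∫⁻ x, ‖f (x + h) - f x‖ₑ ^ 2 < ⊤ := by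
  rw [lintegral_gagliardo hf, memSob_iff]
  have hsq : ∀ x : ℝ, 0 ≤ x → ENNReal.ofReal (x ^ (2 * σ)) = ENNReal.ofReal (x ^ σ) ^ 2 := fun x hx => by
    rw [← ENNReal.ofReal_pow (Real.rpow_nonneg hx _), ← Real.rpow_natCast, ← Real.rpow_mul hx]
    congr 2; push_cast; ring
  have hw := (continuous_wt_rpow_ofReal (le_refl (1 : ℝ)) σ).aestronglyMeasurable (μ := volume)
  constructor
  · rintro ⟨-, hW⟩
    refine ENNReal.mul_lt_top (gagSymbol_one_lt_top h0 h1) (lt_of_le_of_lt ?_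
      (ENNReal.pow_lt_top (n := 2) (hW 1 le_rfl).2))
    rw [eLpNorm_two_sq]
    refine lintegral_mono fun ξ => ?_
    rw [enorm_weight_mul le_rfl, mul_pow, hsq _ (abs_nonneg ξ)]
    gcongr
    rw [wt]
    nlinarith [Real.pi_gt_three, abs_nonneg ξ]
  · intro h
    refine ⟨hf, memW_of_memLp (le_refl (1 : ℝ)) ⟨hw.mul (memLp_hat hf).1, ?_⟩⟩
    have h2 : ∫⁻ ξ, ENNReal.ofReal (|ξ| ^ (2 * σ)) * ‖hat f ξ‖ₑ ^ 2 < ⊤ := by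
      by_contra hcon
      rw [not_lt_top_iff.1 hcon, ENNReal.mul_top (gagSymbol_one_ne_zero σ)] at h
      exact lt_irrefl _ h
    have h3 : ∫⁻ ξ, ‖hat f ξ‖ₑ ^ 2 < ⊤ := by
      rw [← eLpNorm_two_sq]; exact ENNReal.pow_lt_top (memLp_hat hf).2
    have h4 : ∀ ξ, ‖((wt 1 ξ ^ σ : ℝ) : ℂ) * hat f ξ‖ₑ ^ 2 ≤ ENNReal.ofReal (8 ^ (2 * σ)) *
        (ENNReal.ofReal (|ξ| ^ (2 * σ)) * ‖hat f ξ‖ₑ ^ 2 + ‖hat f ξ‖ₑ ^ 2) := fun ξ => by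
      rw [enorm_weight_mul le_rfl, mul_pow, ← hsq _ (wt_pos le_rfl ξ).le]
      have h5 : wt 1 ξ ^ (2 * σ) ≤ 8 ^ (2 * σ) * (|ξ| ^ (2 * σ) + 1) := by
        -- The constant 8 exceeds 2π + 1.
        have h6 : wt 1 ξ ≤ 8 * max |ξ| 1 := by
          unfold wt
          nlinarith [Real.pi_lt_d2, le_max_left |ξ| 1, le_max_right |ξ| 1, abs_nonneg ξ]
        have h7 : max |ξ| 1 ^ (2 * σ) ≤ |ξ| ^ (2 * σ) + 1 := by
          rcases max_cases |ξ| 1 with h | h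
          · rw [h.1]; linarith
          · rw [h.1, Real.one_rpow]; linarith [Real.rpow_nonneg (abs_nonneg ξ) (2 * σ)]
        calc wt 1 ξ ^ (2 * σ) ≤ (8 * max |ξ| 1) ^ (2 * σ) :=
              Real.rpow_le_rpow (wt_pos le_rfl ξ).le h6 (by linarith)
          _ = 8 ^ (2 * σ) * max |ξ| 1 ^ (2 * σ) := Real.mul_rpow (by norm_num) (by positivity)
          _ ≤ _ := by gcongr
      calc _ ≤ ENNReal.ofReal (8 ^ (2 * σ) * (|ξ| ^ (2 * σ) + 1)) * ‖hat f ξ‖ₑ ^ 2 := by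
            gcongr
        _ = _ := by
            rw [ENNReal.ofReal_mul (by positivity), ENNReal.ofReal_add (by positivity) zero_le_one,
              ENNReal.ofReal_one]
            ring
    have h8 : eLpNorm (fun ξ => ((wt 1 ξ ^ σ : ℝ) : ℂ) * hat f ξ) 2 volume ^ 2 < ⊤ := by
      rw [eLpNorm_two_sq]
      refine (lintegral_mono h4).trans_lt ?_
      rw [lintegral_const_mul' _ _ ENNReal.ofReal_ne_top,
        lintegral_add_right' _ ((memLp_hat hf).1.enorm.pow_const 2)]
      exact ENNReal.mul_lt_top ENNReal.ofReal_lt_top (ENNReal.add_lt_top.2 ⟨h2, h3⟩)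
    by_contra hcon
    rw [not_lt_top_iff.1 hcon] at h8
    simp at h8

/-- Lipschitz functions of an element of `H^σ` are in `H^σ`. -/
theorem MemSob.of_lipschitz {σ : ℝ} (h0 : 0 < σ) (h1 : σ < 1) {f g : ℝ → ℂ} (hf : MemSob σ f)
    (hg : AEStronglyMeasurable g volume) {L : ℝ} (hL : ∀ x, ‖g x‖ ≤ L * ‖f x‖)
    (hL2 : ∀ x y, ‖g x - g y‖ ≤ L * ‖f x - f y‖) : MemSob σ g := by
  have hg2 : MemLp g 2 volume := hf.1.of_le_mul hg (Filter.Eventually.of_forall hL)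
  rw [memSob_iff_lintegral h0 h1 hg2]
  have h := (memSob_iff_lintegral h0 h1 hf.1).1 hf
  have hpt : ∀ x y, ‖g x - g y‖ₑ ^ 2 ≤ ENNReal.ofReal L ^ 2 * ‖f x - f y‖ₑ ^ 2 := fun x y => by
    rw [← mul_pow]
    gcongr
    rw [← ofReal_norm, ← ofReal_norm, ← ENNReal.ofReal_mul' (norm_nonneg _)]
    exact ENNReal.ofReal_le_ofReal (hL2 x y)
  calc _ ≤ ∫⁻ h, ENNReal.ofReal L ^ 2 *
        (ENNReal.ofReal (|h| ^ (-(1 + 2 * σ))) * ∫⁻ x, ‖f (x + h) - f x‖ₑ ^ 2) := by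
        refine lintegral_mono fun h => ?_
        rw [mul_left_comm, ← lintegral_const_mul' (ENNReal.ofReal L ^ 2) _ (by simp)]
        exact mul_le_mul_right (lintegral_mono fun x => hpt _ _) _
    _ < ⊤ := by
        rw [lintegral_const_mul' _ _ (by simp)]
        exact ENNReal.mul_lt_top (by simp) h

/-! ### Hardy spaces -/

/-- The Fourier transform of `u` vanishes at negative frequencies. -/
def PosFreq (u : ℝ → ℂ) : Prop := ∀ᵐ ξ : ℝ, ξ < 0 → hat u ξ = 0

theorem PosFreq.congr {u v : ℝ → ℂ} (hu : PosFreq u) (h : u =ᵐ[volume] v) : PosFreq v := by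
  unfold PosFreq hat at *
  rwa [← toDist_congr h]

theorem PosFreq.add {u v : ℝ → ℂ} (hu2 : MemLp u 2 volume) (hv2 : MemLp v 2 volume)
    (hu : PosFreq u) (hv : PosFreq v) : PosFreq (fun x => u x + v x) := by
  filter_upwards [hat_add hu2 hv2, hu, hv] with ξ h1 h2 h3 hξ
  rw [h1, h2 hξ, h3 hξ, add_zero]

theorem PosFreq.const_mul {u : ℝ → ℂ} (hu2 : MemLp u 2 volume) (hu : PosFreq u) (c : ℂ) :
    PosFreq (fun x => c * u x) := by
  filter_upwards [hat_const_mul hu2 c, hu] with ξ h1 h2 hξ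
  rw [h1, h2 hξ, mul_zero]

/-- For ξ < 0 one of η and ξ - η is negative, so the convolution integrand vanishes. -/
theorem PosFreq.mul {σ : ℝ} (hσ2 : 1 / 2 < σ) (hσ : σ ≤ 1) {u v : ℝ → ℂ} (hu2 : MemSob σ u)
    (hv2 : MemLp v 2 volume) (hu : PosFreq u) (hv : PosFreq v) : PosFreq (fun x => u x * v x) := by
  filter_upwards [hat_mul hσ2 hσ hu2 hv2] with ξ h1 hξ
  rw [h1, conv]
  refine integral_eq_zero_of_ae ?_
  have h2 := (Measure.measurePreserving_sub_left (volume : Measure ℝ) ξ).quasiMeasurePreserving.ae hv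
  filter_upwards [hu, h2] with η h3 h4
  rcases lt_or_ge η 0 with h | h
  · rw [h3 h]; simp
  · rw [h4 (by linarith)]; simp

theorem PosFreq.mul_mult {σ : ℝ} (hσ2 : 1 / 2 < σ) (hσ : σ ≤ 1) {n v : ℝ → ℂ} (hn2 : MemSob σ n)
    (hv2 : MemLp v 2 volume) (hn : PosFreq n) (hv : PosFreq v) :
    PosFreq (fun x => (n x + 1) * v x) := by
  have := PosFreq.add (hn2.memLp_mul hσ2 hv2) hv2 (hn.mul hσ2 hσ hn2 hv2 hv) hv
  convert this using 2
  ring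

theorem pairing_eq_zero {T : 𝓢'(ℝ, ℂ)} {φ : ℝ → ℂ} (hT : ∀ᵐ ξ : ℝ, ξ < 0 → fhat T ξ = 0)
    (hφ : PosFreq φ) : pairing T (toDist φ) = 0 := by
  rw [pairing_eq]
  refine integral_eq_zero_of_ae ?_
  have h0 : ∀ᵐ ξ : ℝ, ξ ≠ 0 := by simp [ae_iff]
  filter_upwards [hT, ae_neg hφ, h0] with ξ h1 h2 h3
  rcases lt_or_gt_of_ne h3 with h | h
  · rw [h1 h]; simp
  · rw [h2 (by linarith)]; simp

theorem integral_mul_eq_zero {u v : ℝ → ℂ} (hu2 : MemLp u 2 volume) (hv2 : MemLp v 2 volume)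
    (hu : PosFreq u) (hv : PosFreq v) : ∫ x, u x * v x = 0 := by
  rw [← pairing_toDist hu2 hv2]
  exact pairing_eq_zero hu hv

/-- The Hardy space is its own annihilator for the bilinear pairing: choosing v̂(ξ) as the conjugate
of û(-ξ) on ξ > 0 makes the pairing ∫ |û|² over ξ < 0. This criterion passes easily to limits. -/
theorem posFreq_of_integral {u : ℝ → ℂ} (hu2 : MemLp u 2 volume)
    (h : ∀ v : ℝ → ℂ, MemLp v 2 volume → PosFreq v → ∫ x, u x * v x = 0) : PosFreq u := by
  have h1 : MemLp (fun ξ => (Set.Ioi (0 : ℝ)).indicator (fun ξ => conj (hat u (-ξ))) ξ) 2 volume := by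
    refine MemLp.indicator measurableSet_Ioi ?_
    exact ((memLp_hat hu2).comp_measurePreserving (Measure.measurePreserving_neg volume)).star
  obtain ⟨v, hv2, hv⟩ := exists_hat_eq h1
  have hvp : PosFreq v := by
    filter_upwards [hv] with ξ h2 hξ
    rw [h2, Set.indicator_of_notMem]
    simp only [Set.mem_Ioi, not_lt]; exact hξ.le
  have h2 := h v hv2 hvp
  rw [← pairing_toDist hu2 hv2, pairing_eq] at h2
  have h3 : ∫ ξ, (Set.Iio (0 : ℝ)).indicator (fun ξ => ‖hat u ξ‖ ^ 2) ξ = 0 := by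
    have : ((∫ ξ, (Set.Iio (0 : ℝ)).indicator (fun ξ => ‖hat u ξ‖ ^ 2) ξ : ℝ) : ℂ) = 0 := by
      rw [← integral_complex_ofReal, ← h2]
      apply integral_congr_ae
      filter_upwards [ae_neg hv] with ξ h4
      rw [h4]
      by_cases hξ : ξ < 0
      · rw [Set.indicator_of_mem (by exact hξ), Set.indicator_of_mem (by simpa using hξ), neg_neg]
        change _ = hat u ξ * _
        rw [Complex.mul_conj, Complex.normSq_eq_norm_sq]
      · rw [Set.indicator_of_notMem (by exact hξ), Set.indicator_of_notMem (by simpa using hξ)]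
        simp
    exact_mod_cast this
  rw [integral_eq_zero_iff_of_nonneg] at h3
  · filter_upwards [h3] with ξ h4 hξ
    rw [Set.indicator_of_mem (by exact hξ)] at h4
    simpa using h4
  · intro ξ
    exact Set.indicator_nonneg (fun ξ _ => by positivity) ξ
  · exact ((memLp_hat hu2).integrable_norm_pow two_ne_zero).indicator measurableSet_Iio

theorem posFreq_pow {σ : ℝ} (hσ2 : 1 / 2 < σ) (hσ : σ ≤ 1) {u : ℝ → ℂ} (hu2 : MemSob σ u)
    (hu : PosFreq u) (n : ℕ) :
    MemSob σ (fun x => u x ^ (n + 1)) ∧ PosFreq (fun x => u x ^ (n + 1)) := by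
  induction n with
  | zero => simpa using ⟨hu2, hu⟩
  | succ n ih =>
    simp only [pow_succ' _ (n + 1)]
    exact ⟨hu2.mul hσ2 (by linarith) le_rfl hσ ih.1, hu.mul hσ2 hσ hu2 ih.1.1 ih.2⟩

/-- A power series without constant term preserves the Hardy class. Each power lies in it, and the
annihilator criterion is summed term by term, so no convergence in H^σ is needed. -/
theorem posFreq_of_hasSum {σ : ℝ} (hσ2 : 1 / 2 < σ) (hσ : σ ≤ 1) {u f : ℝ → ℂ} (hu2 : MemSob σ u)
    (hu : PosFreq u) {R : ℝ} (hR : ∀ x, ‖u x‖ ≤ R) {a : ℕ → ℂ}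
    (ha : Summable fun n => ‖a n‖ * R ^ n) (hf2 : MemLp f 2 volume)
    (hf : ∀ x, HasSum (fun n => a n * u x ^ (n + 1)) (f x)) : PosFreq f := by
  refine posFreq_of_integral hf2 fun v hv2 hv => ?_
  have hI : Integrable (fun x => ‖u x‖ * ‖v x‖) volume :=
    MemLp.integrable_mul (p := 2) (q := 2) hu2.1.norm hv2.norm
  have hint : ∀ n, Integrable (fun x => a n * u x ^ (n + 1) * v x) volume := fun n =>
    MemLp.integrable_mul (p := 2) (q := 2) ((posFreq_pow hσ2 hσ hu2 hu n).1.1.const_mul (a n)) hv2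
  have h1 := hasSum_integral_of_summable_integral_norm hint (by
    refine Summable.of_nonneg_of_le (fun n => integral_nonneg fun x => norm_nonneg _) (fun n => ?_)
      (ha.mul_right (∫ x, ‖u x‖ * ‖v x‖))
    rw [← integral_const_mul]
    refine integral_mono (hint n).norm (hI.const_mul _) fun x => ?_
    simp only [norm_mul, norm_pow, pow_succ]
    have : ‖u x‖ ^ n ≤ R ^ n := pow_le_pow_left₀ (norm_nonneg _) (hR x) n
    calc ‖a n‖ * (‖u x‖ ^ n * ‖u x‖) * ‖v x‖ = (‖a n‖ * ‖u x‖ ^ n) * (‖u x‖ * ‖v x‖) := by ring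
      _ ≤ _ := by gcongr)
  have h2 : ∀ n, ∫ x, a n * u x ^ (n + 1) * v x = 0 := fun n => by
    have := posFreq_pow hσ2 hσ hu2 hu n
    simp only [mul_assoc]
    rw [integral_const_mul, integral_mul_eq_zero this.1.1 hv2 this.2 hv, mul_zero]
  simp only [h2] at h1
  have h3 := h1.unique hasSum_zero
  rw [← h3]
  congr 1
  ext x
  exact ((hf x).mul_right (v x)).tsum_eq.symm

theorem norm_exp_sub_exp_le {R : ℝ} {a b : ℂ} (ha : ‖a‖ ≤ R) (hb : ‖b‖ ≤ R) :
    ‖Complex.exp a - Complex.exp b‖ ≤ Real.exp R * ‖a - b‖ := by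
  refine Convex.norm_image_sub_le_of_norm_hasDerivWithin_le (s := Metric.closedBall (0 : ℂ) R)
    (f' := Complex.exp) (fun x _ => (Complex.hasDerivAt_exp x).hasDerivWithinAt) (fun x hx => ?_)
    (convex_closedBall _ _) (by simpa using hb) (by simpa using ha)
  rw [Complex.norm_exp]
  exact Real.exp_le_exp.2 ((Complex.re_le_norm x).trans (by simpa using hx))

/-- The exponential is Lipschitz on the bounded range of u, and its series gives the positive
frequencies. -/
theorem memSob_exp_sub_one {σ : ℝ} (hσ2 : 1 / 2 < σ) (hσ : σ < 1) {u : ℝ → ℂ} (hu2 : MemSob σ u)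
    (hc : Continuous u) (hu : PosFreq u) :
    MemSob σ (fun x => Complex.exp (u x) - 1) ∧ PosFreq (fun x => Complex.exp (u x) - 1) := by
  have hR := hu2.norm_le le_rfl hσ2 hc
  set R := prodConst 1 σ * nrm 1 σ (hat u)
  have h1 : MemSob σ (fun x => Complex.exp (u x) - 1) := by
    refine hu2.of_lipschitz (by linarith) hσ (Continuous.aestronglyMeasurable (by fun_prop))
      (L := Real.exp R) (fun x => ?_) fun x y => ?_
    · have := norm_exp_sub_exp_le (hR x) (b := 0) (by simpa using (norm_nonneg _).trans (hR x))
      simpa using this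
    · simpa using norm_exp_sub_exp_le (hR x) (hR y)
  refine ⟨h1, posFreq_of_hasSum hσ2 hσ.le hu2 hu hR (a := fun n => ((n + 1).factorial : ℂ)⁻¹) ?_ h1.1
    fun x => ?_⟩
  · have hR0 : 0 ≤ R := (norm_nonneg _).trans (hR 0)
    refine Summable.of_nonneg_of_le (fun n => by positivity) (fun n => ?_)
      (Real.summable_pow_div_factorial R)
    rw [norm_inv, Complex.norm_natCast, div_eq_inv_mul]
    gcongr
    omega
  · have h2 := (hasSum_nat_add_iff' 1).2 (NormedSpace.exp_series_hasSum_exp' (𝕂 := ℂ) (u x))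
    simp only [← Complex.exp_eq_exp_ℂ] at h2
    simpa using h2

/-- |m| ≤ 1/2 keeps 1+m away from zero, which makes inversion Lipschitz, and makes the geometric
series converge. -/
theorem memSob_inv_sub_one {σ : ℝ} (hσ2 : 1 / 2 < σ) (hσ : σ < 1) {m : ℝ → ℂ} (hm2 : MemSob σ m)
    (hc : Continuous m) (hm : PosFreq m) (hR : ∀ x, ‖m x‖ ≤ 1 / 2) :
    MemSob σ (fun x => (m x + 1)⁻¹ - 1) ∧ PosFreq (fun x => (m x + 1)⁻¹ - 1) := by
  have hlow : ∀ x, 1 / 2 ≤ ‖m x + 1‖ := fun x => by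
    have := norm_sub_le (m x + 1) (m x)
    simp only [add_sub_cancel_left, norm_one] at this
    linarith [hR x]
  have hne : ∀ x, m x + 1 ≠ 0 := fun x h0 => by
    have := hlow x; rw [h0] at this; norm_num at this
  have hinv : ∀ x, ‖(m x + 1)⁻¹‖ ≤ 2 := fun x => by
    rw [norm_inv]
    exact inv_le_of_inv_le₀ (by norm_num) (by linarith [hlow x])
  have h1 : MemSob σ (fun x => (m x + 1)⁻¹ - 1) := by
    refine hm2.of_lipschitz (by linarith) hσ ?_ (L := 4) (fun x => ?_) fun x y => ?_
    · exact Continuous.aestronglyMeasurable (((hc.add continuous_const).inv₀ hne).sub continuous_const)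
    · have : (m x + 1)⁻¹ - 1 = -((m x + 1)⁻¹ * m x) := by field_simp [hne x]; ring
      rw [this, norm_neg, norm_mul]
      have := hinv x
      gcongr
      linarith
    · have : (m x + 1)⁻¹ - 1 - ((m y + 1)⁻¹ - 1) = -((m x + 1)⁻¹ * (m y + 1)⁻¹ * (m x - m y)) := by
        field_simp [hne x, hne y]; ring
      rw [this, norm_neg, norm_mul, norm_mul]
      have := mul_le_mul (hinv x) (hinv y) (norm_nonneg _) (by norm_num)
      gcongr
      linarith
  refine ⟨h1, posFreq_of_hasSum hσ2 hσ.le hm2 hm hR (a := fun n => (-1) ^ (n + 1)) ?_ h1.1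
    fun x => ?_⟩
  · simpa using summable_geometric_two
  · have h2 := hasSum_geometric_of_norm_lt_one (ξ := -m x) (by rw [norm_neg]; linarith [hR x])
    have h3 := (hasSum_nat_add_iff' 1).2 h2
    simp only [Finset.range_one, Finset.sum_singleton, pow_zero, sub_neg_eq_add] at h3
    rw [add_comm 1 (m x)] at h3
    simp only [neg_pow (m x)] at h3
    exact h3

/-- The projection of a function onto the non-negative frequencies. -/
theorem exists_posFreq_part {σ : ℝ} (hσ : 0 ≤ σ) {φ : ℝ → ℂ} (hφ : MemSob σ φ) :
    ∃ ψ, MemSob σ ψ ∧ PosFreq ψ ∧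
      hat ψ =ᵐ[volume] fun ξ => (Set.Ici (0 : ℝ)).indicator 1 ξ * hat φ ξ := by
  have hW : MemW σ (fun ξ => (Set.Ici (0 : ℝ)).indicator 1 ξ * hat φ ξ) := by
    intro κ hκ
    have h := (hφ.memW κ hκ).indicator (measurableSet_Ici (a := (0 : ℝ)))
    refine h.ae_eq (Filter.Eventually.of_forall fun ξ => ?_)
    by_cases hξ : ξ ∈ Set.Ici (0 : ℝ)
    · simp [hξ]
    · simp [hξ]
  obtain ⟨ψ, hψ, h⟩ := exists_memSob_hat_eq hσ hW
  refine ⟨ψ, hψ, ?_, h⟩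
  filter_upwards [h] with ξ h1 hξ
  rw [h1, Set.indicator_of_notMem (by simpa using hξ), zero_mul]

/-! ### Bounded Fourier multipliers -/

theorem MemW.bounded_mul {σ : ℝ} {F a : ℝ → ℂ} (hF : MemW σ F) (ham : Measurable a)
    (ha : ∀ ξ, ‖a ξ‖ ≤ 1) : MemW σ (fun ξ => a ξ * F ξ) := by
  intro κ hκ
  refine (hF κ hκ).of_le ((continuous_wt_rpow_ofReal hκ σ).aestronglyMeasurable.mul
    (ham.aestronglyMeasurable.mul hF.aestronglyMeasurable)) (Filter.Eventually.of_forall fun ξ => ?_)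
  rw [mul_left_comm, norm_mul]
  exact mul_le_of_le_one_left (norm_nonneg _) (ha ξ)

theorem nrm_bounded_mul_le {κ σ : ℝ} (hκ : 1 ≤ κ) {F a : ℝ → ℂ} (hF : MemW σ F)
    (ha : ∀ ξ, ‖a ξ‖ ≤ 1) : nrm κ σ (fun ξ => a ξ * F ξ) ≤ nrm κ σ F := by
  refine ENNReal.toReal_mono (hF κ hκ).2.ne (eLpNorm_mono fun ξ => ?_)
  rw [mul_left_comm, norm_mul]
  exact mul_le_of_le_one_left (norm_nonneg _) (ha ξ)

theorem multiplier_spec {s : ℝ} {a : ℝ → ℂ} (ham : Measurable a) (ha : ∀ ξ, ‖a ξ‖ ≤ 1)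
    {T : 𝓢'(ℝ, ℂ)} (hT : TemperedDistribution.MemSobolev s 2 T) :
    TemperedDistribution.MemSobolev s 2 (multiplier a T) ∧
      fhat (multiplier a T) =ᵐ[volume] fun ξ => a ξ * fhat T ξ := by
  have hW := (memW_fhat hT).bounded_mul ham ha
  have h := exists_isFourierDensity hW
  have h1 : IsFourierDensity (multiplier a T) (fun ξ => a ξ * fhat T ξ) := by
    rw [multiplier, dif_pos h]; exact h.choose_spec
  exact ⟨hW.memSobolev h1, h1.fhat_ae_eq⟩

theorem measurable_hilbertSymbol :
    Measurable (fun ξ : ℝ => -Complex.I * ((SignType.sign ξ : ℝ) : ℂ)) := by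
  have : (fun ξ : ℝ => -Complex.I * ((SignType.sign ξ : ℝ) : ℂ)) =
      fun ξ => if 0 < ξ then -Complex.I else if ξ < 0 then Complex.I else 0 := by
    ext ξ
    rcases lt_trichotomy ξ 0 with h | h | h
    · simp [h, not_lt.2 h.le]
    · simp [h]
    · simp [h]
  rw [this]
  exact Measurable.ite measurableSet_Ioi measurable_const
    (Measurable.ite measurableSet_Iio measurable_const measurable_const)

theorem norm_hilbertSymbol_le (ξ : ℝ) : ‖-Complex.I * ((SignType.sign ξ : ℝ) : ℂ)‖ ≤ 1 := by
  rcases lt_trichotomy ξ 0 with h | h | h <;> simp [h]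

theorem measurable_szegoSymbol : Measurable ((Set.Ici (0 : ℝ)).indicator (1 : ℝ → ℂ)) :=
  measurable_one.indicator measurableSet_Ici

theorem norm_szegoSymbol_le (ξ : ℝ) : ‖(Set.Ici (0 : ℝ)).indicator (1 : ℝ → ℂ) ξ‖ ≤ 1 := by
  by_cases h : ξ ∈ Set.Ici (0 : ℝ) <;> simp [h]

theorem hilbert_spec {s : ℝ} {T : 𝓢'(ℝ, ℂ)} (hT : TemperedDistribution.MemSobolev s 2 T) :
    TemperedDistribution.MemSobolev s 2 (hilbert T) ∧
      fhat (hilbert T) =ᵐ[volume] fun ξ => -Complex.I * ((SignType.sign ξ : ℝ) : ℂ) * fhat T ξ :=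
  multiplier_spec measurable_hilbertSymbol norm_hilbertSymbol_le hT

theorem szegoPlus_spec {s : ℝ} {T : 𝓢'(ℝ, ℂ)} (hT : TemperedDistribution.MemSobolev s 2 T) :
    TemperedDistribution.MemSobolev s 2 (szegoPlus T) ∧
      fhat (szegoPlus T) =ᵐ[volume] fun ξ => (Set.Ici (0 : ℝ)).indicator 1 ξ * fhat T ξ :=
  multiplier_spec measurable_szegoSymbol norm_szegoSymbol_le hT

theorem hat_conj_neg {u : ℝ → ℂ} (hu : MemLp u 2 volume) :
    (fun ξ => hat (fun x => conj (u x)) (-ξ)) =ᵐ[volume] fun ξ => conj (hat u ξ) := by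
  filter_upwards [ae_neg (hat_conj hu)] with ξ h
  rw [h, neg_neg]

/-- Tests ψ̄ with ψ of positive frequency read only the positive frequencies of a distribution. On
them H is -i and C₊ is the identity. -/
theorem pairing_of_fhat_eq {T S : 𝓢'(ℝ, ℂ)} {c : ℂ} {ψ : ℝ → ℂ} (hψ2 : MemLp ψ 2 volume)
    (hψ : PosFreq ψ) (h : ∀ᵐ ξ : ℝ, 0 < ξ → fhat S ξ = c * fhat T ξ) :
    pairing S (toDist fun x => conj (ψ x)) = c * pairing T (toDist fun x => conj (ψ x)) := by
  rw [pairing_eq, pairing_eq, ← integral_const_mul]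
  have h0 : ∀ᵐ ξ : ℝ, ξ ≠ 0 := by simp [ae_iff]
  apply integral_congr_ae
  filter_upwards [h, hψ, hat_conj_neg hψ2, h0] with ξ h1 h2 h3 h4
  rw [h3]
  rcases lt_or_gt_of_ne h4 with h | h
  · simp [h2 h]
  · rw [h1 h, mul_assoc]

theorem pairing_hilbert {s : ℝ} {T : 𝓢'(ℝ, ℂ)} (hT : TemperedDistribution.MemSobolev s 2 T)
    {ψ : ℝ → ℂ} (hψ2 : MemLp ψ 2 volume) (hψ : PosFreq ψ) :
    pairing (hilbert T) (toDist fun x => conj (ψ x)) =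
      -Complex.I * pairing T (toDist fun x => conj (ψ x)) := by
  refine pairing_of_fhat_eq hψ2 hψ ?_
  filter_upwards [(hilbert_spec hT).2] with ξ h hξ
  rw [h]; simp [hξ]

theorem pairing_szegoPlus {s : ℝ} {T : 𝓢'(ℝ, ℂ)} (hT : TemperedDistribution.MemSobolev s 2 T)
    {ψ : ℝ → ℂ} (hψ2 : MemLp ψ 2 volume) (hψ : PosFreq ψ) :
    pairing (szegoPlus T) (toDist fun x => conj (ψ x)) =
      pairing T (toDist fun x => conj (ψ x)) := by
  rw [← one_mul (pairing T _)]
  refine pairing_of_fhat_eq hψ2 hψ ?_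
  filter_upwards [(szegoPlus_spec hT).2] with ξ h hξ
  rw [h]; simp [hξ.le]

/-- Pairing C₊T with φ equals pairing T with ψ̄, where ψ is the positive-frequency part of φ̄. -/
theorem szegoPlus_eq_of_pairing {s : ℝ} (hs : s ≤ 0) {T S : 𝓢'(ℝ, ℂ)}
    (hT : TemperedDistribution.MemSobolev s 2 T) (hS : TemperedDistribution.MemSobolev s 2 S)
    (h : ∀ ψ, MemSob (-s) ψ → PosFreq ψ →
      pairing T (toDist fun x => conj (ψ x)) = pairing S (toDist fun x => conj (ψ x))) :
    szegoPlus T = szegoPlus S := by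
  refine ext_of_pairing (szegoPlus_spec hT).1 (szegoPlus_spec hS).1 fun φ => ?_
  have hφ := memSob_schwartz (-s) φ
  obtain ⟨ψ, hψ, hψp, hψe⟩ := exists_posFreq_part (by linarith) hφ.conj
  have key : ∀ {T : 𝓢'(ℝ, ℂ)}, TemperedDistribution.MemSobolev s 2 T →
      pairing (szegoPlus T) (toDist φ) = pairing T (toDist fun x => conj (ψ x)) := by
    intro T hT
    rw [pairing_eq, pairing_eq]
    apply integral_congr_ae
    filter_upwards [(szegoPlus_spec hT).2, hat_conj_neg hψ.1, hψe, hat_conj hφ.1] with ξ h1 h2 h3 h4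
    rw [h1, h2, h3, h4]
    by_cases hξ : ξ ∈ Set.Ici (0 : ℝ) <;> simp [hξ]
  rw [key hT, key hS, h ψ hψ hψp]

theorem szegoPlus_eq_self {s : ℝ} {T : 𝓢'(ℝ, ℂ)} (hT : TemperedDistribution.MemSobolev s 2 T)
    (h : ∀ᵐ ξ : ℝ, ξ < 0 → fhat T ξ = 0) : szegoPlus T = T := by
  refine ext_of_fhat (szegoPlus_spec hT).1 hT ?_
  filter_upwards [(szegoPlus_spec hT).2, h] with ξ h1 h2
  rw [h1]
  by_cases hξ : ξ < 0
  · simp [h2 hξ]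
  · simp [not_lt.1 hξ]

/-! ### Products with a distribution -/

theorem mulDist_add_one {s : ℝ} (hs : -(1 / 2) < s) (hs' : s < 0) {g : ℝ → ℂ}
    (hg : MemSob (s + 1) g) {T : 𝓢'(ℝ, ℂ)} (hT : TemperedDistribution.MemSobolev s 2 T) :
    mulDist (fun x => g x + 1) T = mulDist g T + T := by
  have h1 := mulDist_spec hs hs' hg.isMult hT
  refine mulDist_eq hs hs' hg.isMult_add_one hT (h1.1.add hT) fun φ hφ => ?_
  rw [pairing_add_left h1.1 hT hφ, h1.2 φ hφ, ← pairing_add_right hT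
    (hg.isMult.mul_memSob (by linarith) (by linarith) (by linarith) (by linarith) hφ) hφ]
  congr 2
  ext x
  ring

/-- Prepares the difference of two gauge equations: only the term (n-m)(q+f) contains the unknown
difference, and it can be absorbed. -/
theorem mulDist_sub_add {s : ℝ} (hs : -(1 / 2) < s) (hs' : s < 0) {m n : ℝ → ℂ}
    (hm : MemSob (s + 1) m) (hn : MemSob (s + 1) n) {q f : 𝓢'(ℝ, ℂ)}
    (hq : TemperedDistribution.MemSobolev s 2 q) (hf : TemperedDistribution.MemSobolev s 2 f) :
    mulDist (fun x => n x + 1) (q + f) = mulDist (fun x => m x + 1) q +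
      (mulDist (fun x => n x - m x) (q + f) + (mulDist m f + f)) := by
  have hmul : ∀ {g φ : ℝ → ℂ}, IsMult (s + 1) g → MemSob (-s) φ → MemSob (-s) (fun x => g x * φ x) :=
    fun hg hφ => hg.mul_memSob (by linarith) (by linarith) (by linarith) (by linarith) hφ
  have h1 := mulDist_spec hs hs' hm.isMult_add_one hq
  have h2 := mulDist_spec hs hs' (hn.sub hm).isMult (hq.add hf)
  have h3 := mulDist_spec hs hs' hm.isMult_add_one hf
  rw [← mulDist_add_one hs hs' hm hf]
  refine mulDist_eq hs hs' hn.isMult_add_one (hq.add hf) (h1.1.add (h2.1.add h3.1)) fun φ hφ => ?_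
  rw [pairing_add_left h1.1 (h2.1.add h3.1) hφ, pairing_add_left h2.1 h3.1 hφ, h1.2 φ hφ,
    h2.2 φ hφ, h3.2 φ hφ, add_left_comm,
    ← pairing_add_left hq hf (hmul hm.isMult_add_one hφ),
    ← pairing_add_right (hq.add hf) (hmul (hn.sub hm).isMult hφ) (hmul hm.isMult_add_one hφ)]
  congr 2
  ext x
  ring

/-! ### The gauge -/

theorem hat_sub {u v : ℝ → ℂ} (hu : MemLp u 2 volume) (hv : MemLp v 2 volume) :
    hat (fun x => u x - v x) =ᵐ[volume] fun ξ => hat u ξ - hat v ξ := by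
  have h := hat_add hu (hv.const_mul (-1))
  filter_upwards [h, hat_const_mul hv (-1)] with ξ h1 h2
  rw [h2] at h1
  simpa [sub_eq_add_neg] using h1

theorem mulDist_sub {s : ℝ} (hs : -(1 / 2) < s) (hs' : s < 0) {m n : ℝ → ℂ}
    (hm : MemSob (s + 1) m) (hn : MemSob (s + 1) n) {q : 𝓢'(ℝ, ℂ)}
    (hq : TemperedDistribution.MemSobolev s 2 q) :
    mulDist (fun x => n x + 1) q = mulDist (fun x => m x + 1) q + mulDist (fun x => n x - m x) q := by
  have hmul : ∀ {g φ : ℝ → ℂ}, IsMult (s + 1) g → MemSob (-s) φ → MemSob (-s) (fun x => g x * φ x) :=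
    fun hg hφ => hg.mul_memSob (by linarith) (by linarith) (by linarith) (by linarith) hφ
  have h1 := mulDist_spec hs hs' hm.isMult_add_one hq
  have h2 := mulDist_spec hs hs' (hn.sub hm).isMult hq
  refine mulDist_eq hs hs' hn.isMult_add_one hq (h1.1.add h2.1) fun φ hφ => ?_
  rw [pairing_add_left h1.1 h2.1 hφ, h1.2 φ hφ, h2.2 φ hφ,
    ← pairing_add_right hq (hmul hm.isMult_add_one hφ) (hmul (hn.sub hm).isMult hφ)]
  congr 2
  ext x
  ring

/-- On ξ ≥ 0 the symbol of d/dx + iκ is i · `wt κ ξ`. Solving the equation is division by the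
weight, which gains one derivative with norm one by `nrm_wt_mul`. -/
theorem isGauge_iff_density {s κ : ℝ} (hs : -(1 / 2) < s) (hs' : s < 0)
    {q : 𝓢'(ℝ, ℂ)} (hq : TemperedDistribution.MemSobolev s 2 q) {m : ℝ → ℂ} (hc : Continuous m)
    (hm : MemSob (s + 1) m) (hp : PosFreq m) :
    IsGauge s κ q m ↔ (fun ξ => ((wt κ ξ : ℝ) : ℂ) * hat m ξ) =ᵐ[volume] fun ξ =>
      (Set.Ici (0 : ℝ)).indicator 1 ξ * fhat (mulDist (fun x => m x + 1) q) ξ := by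
  have hP := szegoPlus_spec (mulDist_spec hs hs' hm.isMult_add_one hq).1
  have hms : TemperedDistribution.MemSobolev s 2 (toDist m) := (hm.mono (by linarith)).2
  have h1 := fhat_add (hms.smul (-(Complex.I * κ))) (hP.1.smul Complex.I)
  have h2 := fhat_smul hms (-(Complex.I * κ))
  have h3 := fhat_smul hP.1 Complex.I
  have h4 := fhat_dv hm
  have key : (fhat (dv m) =ᵐ[volume] fhat ((-(Complex.I * κ)) • toDist m +
      Complex.I • szegoPlus (mulDist (fun x => m x + 1) q))) ↔
      (fun ξ => ((wt κ ξ : ℝ) : ℂ) * hat m ξ) =ᵐ[volume] fun ξ =>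
      (Set.Ici (0 : ℝ)).indicator 1 ξ * fhat (mulDist (fun x => m x + 1) q) ξ := by
    apply Filter.eventually_congr
    filter_upwards [h1, h2, h3, h4, hP.2, hp] with ξ h1 h2 h3 h4 h5 h6
    rw [h1, h2, h3, h4, h5]
    rcases lt_or_ge ξ 0 with h | h
    · have : fhat (toDist m) ξ = 0 := h6 h
      rw [this, h6 h, Set.indicator_of_notMem (by simpa using h)]
      simp
    · rw [wt, abs_of_nonneg h]
      change _ = _ * hat m ξ + _ ↔ _
      push_cast
      constructor
      · intro h7
        refine mul_left_cancel₀ Complex.I_ne_zero ?_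
        linear_combination h7
      · intro h7
        linear_combination Complex.I * h7
  rw [← key]
  constructor
  · intro h
    rw [dv, h.2.2]
  · intro h
    exact ⟨hc, ⟨hm, hp⟩, ext_of_fhat hm.memSobolev_dv ((hms.smul _).add (hP.1.smul _)) h⟩

theorem IsGauge.density {s κ : ℝ} (hs : -(1 / 2) < s) (hs' : s < 0) {q : 𝓢'(ℝ, ℂ)}
    (hq : TemperedDistribution.MemSobolev s 2 q) {m : ℝ → ℂ} (h : IsGauge s κ q m) :
    (fun ξ => ((wt κ ξ : ℝ) : ℂ) * hat m ξ) =ᵐ[volume] fun ξ =>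
      (Set.Ici (0 : ℝ)).indicator 1 ξ * fhat (mulDist (fun x => m x + 1) q) ξ :=
  (isGauge_iff_density hs hs' hq h.1 h.2.1.1 h.2.1.2).1 h

/-- Weak form of -im' + κm = C₊[q(m+1)]. The left side already has positive frequencies, so tests ψ̄
with ψ in the Hardy class suffice, and they absorb C₊. -/
theorem isGauge_iff_pairing {s κ : ℝ} (hs : -(1 / 2) < s) (hs' : s < 0)
    {q : 𝓢'(ℝ, ℂ)} (hq : TemperedDistribution.MemSobolev s 2 q) {m : ℝ → ℂ} (hc : Continuous m)
    (hm : MemSob (s + 1) m) (hp : PosFreq m) :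
    IsGauge s κ q m ↔ ∀ ψ, MemSob (-s) ψ → PosFreq ψ →
      -Complex.I * pairing (dv m) (toDist fun x => conj (ψ x)) +
        κ * pairing (toDist m) (toDist fun x => conj (ψ x)) =
      pairing q (toDist fun x => (m x + 1) * conj (ψ x)) := by
  have hP := mulDist_spec hs hs' hm.isMult_add_one hq
  have hms : TemperedDistribution.MemSobolev s 2 (toDist m) := (hm.mono (by linarith)).2
  have hV1 := hm.memSobolev_dv.smul (-Complex.I)
  have hV2 := hms.smul (κ : ℂ)
  have hV := hV1.add hV2
  have hVp : ∀ᵐ ξ : ℝ, ξ < 0 → fhat ((-Complex.I) • dv m + (κ : ℂ) • toDist m) ξ = 0 := by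
    filter_upwards [fhat_add hV1 hV2, fhat_smul hm.memSobolev_dv (-Complex.I), fhat_smul hms (κ : ℂ),
      fhat_dv hm, hp] with ξ h1 h2 h3 h4 h5 hξ
    have : fhat (toDist m) ξ = 0 := h5 hξ
    rw [h1, h2, h3, h4, h5 hξ, this]
    simp
  have e : IsGauge s κ q m ↔ (-Complex.I) • dv m + (κ : ℂ) • toDist m =
      szegoPlus (mulDist (fun x => m x + 1) q) := by
    constructor
    · intro h
      have e1 : -Complex.I * -(Complex.I * κ) = -(κ : ℂ) := by
        linear_combination (κ : ℂ) * Complex.I_mul_I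
      have e2 : -Complex.I * Complex.I = 1 := by rw [neg_mul, Complex.I_mul_I, neg_neg]
      rw [dv, h.2.2, smul_add, smul_smul, smul_smul, e1, e2, one_smul]
      module
    · intro h
      refine ⟨hc, ⟨hm, hp⟩, ?_⟩
      have e2 : Complex.I * -Complex.I = 1 := by rw [mul_neg, Complex.I_mul_I, neg_neg]
      rw [← h, smul_add, smul_smul, smul_smul, e2, one_smul]
      change dv m = _
      module
  rw [e]
  constructor
  · intro h ψ hψ hψp
    have h1 := pairing_szegoPlus hP.1 hψ.1 hψp
    rw [← h, hP.2 _ hψ.conj, pairing_add_left hV1 hV2 hψ.conj, pairing_smul_left hm.memSobolev_dv,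
      pairing_smul_left hms] at h1
    exact h1
  · intro h
    rw [← szegoPlus_eq_self hV hVp]
    refine szegoPlus_eq_of_pairing hs'.le hV hP.1 fun ψ hψ hψp => ?_
    rw [hP.2 _ hψ.conj, pairing_add_left hV1 hV2 hψ.conj, pairing_smul_left hm.memSobolev_dv,
      pairing_smul_left hms]
    exact h ψ hψ hψp

theorem nrm_wt_mul {κ : ℝ} (hκ : 1 ≤ κ) (σ : ℝ) (F : ℝ → ℂ) :
    nrm κ σ (fun ξ => ((wt κ ξ : ℝ) : ℂ) * F ξ) = nrm κ (σ + 1) F := by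
  unfold nrm
  congr 2
  ext ξ
  rw [← mul_assoc, ← Complex.ofReal_mul, Real.rpow_add (wt_pos hκ ξ), Real.rpow_one]

/-- The solution operator of `-i u' + κ u = C₊ F`. -/
theorem exists_posFreq_solution {s κ : ℝ} (hs : -(1 / 2) < s) (hκ : 1 ≤ κ) {F : ℝ → ℂ}
    (hF : MemW s F) : ∃ u, Continuous u ∧ MemSob (s + 1) u ∧ PosFreq u ∧
      (fun ξ => ((wt κ ξ : ℝ) : ℂ) * hat u ξ) =ᵐ[volume] fun ξ =>
        (Set.Ici (0 : ℝ)).indicator 1 ξ * F ξ := by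
  have h1 := (hF.bounded_mul measurable_szegoSymbol norm_szegoSymbol_le).weight_mul hκ (τ := -1)
  rw [sub_neg_eq_add] at h1
  obtain ⟨u, hu, hue⟩ := exists_memSob_hat_eq (by linarith) h1
  obtain ⟨v, hvc, hv, hvu⟩ := hu.exists_continuous (by linarith)
  have hh : hat v = hat u := by unfold hat; rw [toDist_congr hvu]
  refine ⟨v, hvc, hv, ?_, ?_⟩
  · unfold PosFreq
    rw [hh]
    filter_upwards [hue] with ξ h hξ
    rw [h, Set.indicator_of_notMem (by simpa using hξ)]
    simp
  · rw [hh]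
    filter_upwards [hue] with ξ h
    rw [h, ← mul_assoc, ← Complex.ofReal_mul, Real.rpow_neg_one, mul_inv_cancel₀ (wt_pos hκ ξ).ne',
      Complex.ofReal_one, one_mul]

/-- Banach's fixed point theorem in L², applied not to m but to the weighted density M of q(m+1).
Each M determines a candidate u M, and R returns the weighted density of q(u M + 1); the hypothesis
makes its Lipschitz constant at most 1/2. -/
theorem exists_isGauge {s κ : ℝ} (hs : -(1 / 2) < s) (hs' : s < 0) (hκ : 1 ≤ κ) {q : 𝓢'(ℝ, ℂ)}
    (hq : TemperedDistribution.MemSobolev s 2 q)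
    (hδ : prodConst κ (s + 1) * nrm κ s (fhat q) ≤ 1 / 2) : ∃ m, IsGauge s κ q m := by
  have hM : ∀ M : Lp ℂ 2 (volume : Measure ℝ),
      MemW s (fun ξ => ((wt κ ξ ^ (-s) : ℝ) : ℂ) * M ξ) := fun M => by
    have := (memW_zero_iff.2 (Lp.memLp M)).weight_mul hκ (τ := -s)
    rwa [zero_sub, neg_neg] at this
  choose u huc hu hup hue using fun M => exists_posFreq_solution hs hκ (hM M)
  have hP := fun M => mulDist_spec hs hs' (hu M).isMult_add_one hq
  have hL := fun M => memW_fhat (hP M).1 κ hκ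
  let R : Lp ℂ 2 (volume : Measure ℝ) → Lp ℂ 2 (volume : Measure ℝ) := fun M => (hL M).toLp _
  have hu_le : ∀ M N : Lp ℂ 2 (volume : Measure ℝ),
      nrm κ (s + 1) (hat fun x => u N x - u M x) ≤ ‖N - M‖ := fun M N => by
    rw [← nrm_wt_mul hκ]
    have e : (fun ξ => ((wt κ ξ : ℝ) : ℂ) * hat (fun x => u N x - u M x) ξ) =ᵐ[volume] fun ξ =>
        (Set.Ici (0 : ℝ)).indicator 1 ξ * (((wt κ ξ ^ (-s) : ℝ) : ℂ) * (N - M) ξ) := by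
      filter_upwards [hat_sub (hu N).1 (hu M).1, hue M, hue N, Lp.coeFn_sub N M] with ξ h1 h2 h3 h4
      rw [h1, mul_sub, h3, h2, h4, Pi.sub_apply]
      ring
    rw [nrm_congr e]
    refine (nrm_bounded_mul_le hκ (hM (N - M)) norm_szegoSymbol_le).trans (le_of_eq ?_)
    rw [Lp.norm_def, nrm]
    congr 2
    ext ξ
    rw [← mul_assoc, ← Complex.ofReal_mul, ← Real.rpow_add (wt_pos hκ ξ)]
    simp
  have hR : ContractingWith (1 / 2) R := by
    refine ⟨by rw [← NNReal.coe_lt_coe]; norm_num, LipschitzWith.of_dist_le_mul fun N M => ?_⟩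
    have hn := (hu N).sub (hu M)
    have hD := (mulDist_spec hs hs' hn.isMult hq).1
    rw [dist_eq_norm, dist_eq_norm, ← MemLp.toLp_sub, Lp.norm_toLp]
    have e : (eLpNorm ((fun ξ => ((wt κ ξ ^ s : ℝ) : ℂ) * fhat (mulDist (fun x => u N x + 1) q) ξ) -
        fun ξ => ((wt κ ξ ^ s : ℝ) : ℂ) * fhat (mulDist (fun x => u M x + 1) q) ξ) 2 volume).toReal =
        nrm κ s (fhat (mulDist (fun x => u N x - u M x) q)) := by
      rw [nrm]
      congr 1
      apply eLpNorm_congr_ae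
      have h := fhat_add (hP M).1 hD
      rw [← mulDist_sub hs hs' (hu M) (hu N) hq] at h
      filter_upwards [h] with ξ h
      simp only [Pi.sub_apply]
      rw [h]
      ring
    rw [e]
    calc _ ≤ _ := nrm_mulDist_le hs hs' hκ hn hq
      _ = (prodConst κ (s + 1) * nrm κ s (fhat q)) * nrm κ (s + 1) (hat fun x => u N x - u M x) := by
        ring
      _ ≤ 1 / 2 * ‖N - M‖ := mul_le_mul hδ (hu_le M N) (nrm_nonneg _ _ _) (by norm_num)
      _ = _ := by simp
  have hfix := hR.fixedPoint_isFixedPt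
  set M := ContractingWith.fixedPoint R hR
  refine ⟨u M, (isGauge_iff_density hs hs' hq (huc M) (hu M) (hup M)).2 ?_⟩
  have h1 : M =ᵐ[volume] _ := (Lp.ext_iff.1 hfix.symm).trans (hL M).coeFn_toLp
  filter_upwards [hue M, h1] with ξ h2 h3
  rw [h2, h3, ← mul_assoc ((wt κ ξ ^ (-s) : ℝ) : ℂ), ← Complex.ofReal_mul,
    ← Real.rpow_add (wt_pos hκ ξ)]
  simp

/-- The product q·m is absorbed with factor 1/4, whence 4/3 = 1/(1 - 1/4). -/
theorem IsGauge.nrm_le {s κ : ℝ} (hs : -(1 / 2) < s) (hs' : s < 0) (hκ : 1 ≤ κ) {q : 𝓢'(ℝ, ℂ)}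
    (hq : TemperedDistribution.MemSobolev s 2 q)
    (hδ : prodConst κ (s + 1) * nrm κ s (fhat q) ≤ 1 / 4) {m : ℝ → ℂ} (h : IsGauge s κ q m) :
    nrm κ (s + 1) (hat m) ≤ 4 / 3 * nrm κ s (fhat q) := by
  have hm := h.2.1.1
  have hP := (mulDist_spec hs hs' hm.isMult hq).1
  have h1 : nrm κ (s + 1) (hat m) ≤ nrm κ s (fhat (mulDist (fun x => m x + 1) q)) := by
    rw [← nrm_wt_mul hκ, nrm_congr (h.density hs hs' hq)]
    exact nrm_bounded_mul_le hκ (memW_fhat (mulDist_spec hs hs' hm.isMult_add_one hq).1)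
      norm_szegoSymbol_le
  rw [mulDist_add_one hs hs' hm hq, nrm_congr (fhat_add hP hq)] at h1
  have h2 := nrm_add_le hκ (memW_fhat hP) (memW_fhat hq)
  have h3 := nrm_mulDist_le hs hs' hκ hm hq
  have h4 := mul_le_mul_of_nonneg_right hδ (nrm_nonneg κ (s + 1) (hat m))
  linarith

/-- The difference is absorbed with factor 1/4, and mf + f costs at most 1/3 + 1. The ratio 16/9 is
rounded up to 2. -/
theorem IsGauge.nrm_sub_le {s κ : ℝ} (hs : -(1 / 2) < s) (hs' : s < 0) (hκ : 1 ≤ κ)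
    {q f : 𝓢'(ℝ, ℂ)} (hq : TemperedDistribution.MemSobolev s 2 q)
    (hf : TemperedDistribution.MemSobolev s 2 f)
    (hδ : prodConst κ (s + 1) * nrm κ s (fhat q) ≤ 1 / 4)
    (hδ' : prodConst κ (s + 1) * nrm κ s (fhat (q + f)) ≤ 1 / 4)
    {m n : ℝ → ℂ} (hm : IsGauge s κ q m) (hn : IsGauge s κ (q + f) n) :
    nrm κ (s + 1) (hat fun x => n x - m x) ≤ 2 * nrm κ s (fhat f) := by
  have hm2 := hm.2.1.1
  have hn2 := hn.2.1.1
  have hd := hn2.sub hm2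
  have hqf := hq.add hf
  have hP := (mulDist_spec hs hs' hm2.isMult_add_one hq).1
  have hD1 := (mulDist_spec hs hs' hd.isMult hqf).1
  have hD2 := (mulDist_spec hs hs' hm2.isMult hf).1
  have hD := hD1.add (hD2.add hf)
  have h1 : nrm κ (s + 1) (hat fun x => n x - m x) ≤
      nrm κ s (fhat (mulDist (fun x => n x - m x) (q + f) + (mulDist m f + f))) := by
    rw [← nrm_wt_mul hκ]
    refine le_trans (le_of_eq (nrm_congr ?_ κ s)) (nrm_bounded_mul_le hκ (memW_fhat hD)
      norm_szegoSymbol_le)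
    have h := hn.density hs hs' hqf
    rw [mulDist_sub_add hs hs' hm2 hn2 hq hf] at h
    filter_upwards [hat_sub hn2.1 hm2.1, h, hm.density hs hs' hq, fhat_add hP hD] with ξ h1 h2 h3 h4
    rw [h1, mul_sub, h2, h3, h4]
    ring
  rw [nrm_congr (fhat_add hD1 (hD2.add hf))] at h1
  have h2 := nrm_add_le hκ (memW_fhat hD1) (memW_fhat (hD2.add hf))
  rw [nrm_congr (fhat_add hD2 hf)] at h2
  have h3 := nrm_add_le hκ (memW_fhat hD2) (memW_fhat hf)
  have h4 := nrm_mulDist_le hs hs' hκ hd hqf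
  have h5 := nrm_mulDist_le hs hs' hκ hm2 hf
  have h6 := mul_le_mul_of_nonneg_right hδ' (nrm_nonneg κ (s + 1) (hat fun x => n x - m x))
  have h7 := mul_le_mul_of_nonneg_left (hm.nrm_le hs hs' hκ hq hδ) (prodConst_nonneg κ (s + 1))
  have h8 : prodConst κ (s + 1) * nrm κ (s + 1) (hat m) ≤ 1 / 3 := by linarith
  have h9 := mul_le_mul_of_nonneg_left h8 (nrm_nonneg κ s (fhat f))
  linarith [nrm_nonneg κ s (fhat f)]

theorem eq_of_nrm_sub_eq_zero {κ σ : ℝ} (hκ : 1 ≤ κ) (hσ2 : 1 / 2 < σ) {u v : ℝ → ℂ}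
    (hu : MemSob σ u) (hv : MemSob σ v) (huc : Continuous u) (hvc : Continuous v)
    (h : nrm κ σ (hat fun x => u x - v x) ≤ 0) : u = v := by
  ext x
  have h1 := (hu.sub hv).norm_le hκ hσ2 (huc.sub hvc) x
  rw [le_antisymm h (nrm_nonneg _ _ _), mul_zero, norm_le_zero_iff, sub_eq_zero] at h1
  exact h1

theorem IsGauge.unique {s κ : ℝ} (hs : -(1 / 2) < s) (hs' : s < 0) (hκ : 1 ≤ κ)
    {q : 𝓢'(ℝ, ℂ)} (hq : TemperedDistribution.MemSobolev s 2 q)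
    (hδ : prodConst κ (s + 1) * nrm κ s (fhat q) ≤ 1 / 4)
    {m n : ℝ → ℂ} (hm : IsGauge s κ q m) (hn : IsGauge s κ q n) : n = m := by
  have h0 : TemperedDistribution.MemSobolev s 2 (0 : 𝓢'(ℝ, ℂ)) := by
    simp
  have h1 : nrm κ s (fhat (0 : 𝓢'(ℝ, ℂ))) = 0 := by
    have h2 : fhat (0 : 𝓢'(ℝ, ℂ)) =ᵐ[volume] fun ξ => 0 * fhat q ξ := by
      convert fhat_smul hq 0
      ext φ
      simp
    rw [nrm_congr h2, nrm_const_mul, norm_zero, zero_mul]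
  have h := IsGauge.nrm_sub_le hs hs' hκ hq h0 hδ (by rwa [add_zero]) hm (by rwa [add_zero])
  rw [h1, mul_zero] at h
  exact eq_of_nrm_sub_eq_zero hκ (by linarith) hn.2.1.1 hm.2.1.1 hn.1 hm.1 h

theorem IsGauge.norm_le {s κ : ℝ} (hs : -(1 / 2) < s) (hs' : s < 0) (hκ : 1 ≤ κ) {q : 𝓢'(ℝ, ℂ)}
    (hq : TemperedDistribution.MemSobolev s 2 q)
    (hδ : prodConst κ (s + 1) * nrm κ s (fhat q) ≤ 1 / 4) {m : ℝ → ℂ} (h : IsGauge s κ q m)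
    (x : ℝ) : ‖m x‖ ≤ 1 / 2 := by
  have h1 := h.2.1.1.norm_le hκ (by linarith) h.1 x
  have h7 := mul_le_mul_of_nonneg_left (h.nrm_le hs hs' hκ hq hδ) (prodConst_nonneg κ (s + 1))
  linarith

theorem isGauge_gauge {s κ : ℝ} {q : 𝓢'(ℝ, ℂ)} (h : ∃ m, IsGauge s κ q m) :
    IsGauge s κ q (gauge s κ q) := by
  rw [gauge, dif_pos h]; exact h.choose_spec

/-! ### The functional derivative of `β` -/

theorem pairing_dv_symm {s : ℝ} {u v : ℝ → ℂ} (hu : MemSob (s + 1) u) (hv : MemSob (s + 1) v) :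
    pairing (dv u) (toDist v) = -pairing (dv v) (toDist u) := by
  rw [pairing_eq, pairing_eq, ← integral_neg_eq_self, ← integral_neg]
  apply integral_congr_ae
  filter_upwards [ae_neg (fhat_dv hu), fhat_dv hv] with ξ h1 h2
  rw [h1, h2, neg_neg]
  push_cast
  ring

theorem fhat_dv_conj {s : ℝ} {u : ℝ → ℂ} (hu : MemSob (s + 1) u) :
    fhat (dv fun x => conj (u x)) =ᵐ[volume] fun ξ => conj (fhat (dv u) (-ξ)) := by
  filter_upwards [fhat_dv hu.conj, ae_neg (fhat_dv hu), hat_conj hu.1] with ξ h1 h2 h3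
  rw [h1, h2, h3]
  simp only [map_mul, Complex.conj_I, Complex.conj_ofReal, map_ofNat]
  push_cast
  ring

theorem IsGauge.pairing_eq {s κ : ℝ} (hs : -(1 / 2) < s) (hs' : s < 0) {q : 𝓢'(ℝ, ℂ)}
    (hq : TemperedDistribution.MemSobolev s 2 q) {m : ℝ → ℂ} (h : IsGauge s κ q m) {ψ : ℝ → ℂ}
    (hψ : MemSob (-s) ψ) (hψp : PosFreq ψ) :
    -Complex.I * pairing (dv m) (toDist fun x => conj (ψ x)) +
        κ * pairing (toDist m) (toDist fun x => conj (ψ x)) =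
      pairing q (toDist fun x => (m x + 1) * conj (ψ x)) :=
  (isGauge_iff_pairing hs hs' hq h.1 h.2.1.1 h.2.1.2).1 h ψ hψ hψp

/-- The two gauge equations, tested against each other. -/
theorem IsGauge.pairing_symm {s κ : ℝ} (hs : -(1 / 2) < s) (hs' : s < 0) {q p : 𝓢'(ℝ, ℂ)}
    (hq : TemperedDistribution.MemSobolev s 2 q) (hqr : IsRealValued q)
    (hp : TemperedDistribution.MemSobolev s 2 p) {m n : ℝ → ℂ} (hm : IsGauge s κ q m)
    (hn : IsGauge s κ p n) :
    pairing p (toDist fun x => (n x + 1) * conj (m x)) =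
      pairing q (toDist fun x => (conj (m x) + 1) * n x) := by
  have hm2 := hm.2.1.1
  have hn2 := hn.2.1.1
  -- Each equation is tested with the other solution. After conjugating the equation of m, where q
  -- real is used, antisymmetry of the derivative makes the two left-hand sides equal.
  have h1 := hn.pairing_eq hs hs' hp (hm2.mono (by linarith)) hm.2.1.2
  have h2 := hm.pairing_eq hs hs' hq (hn2.mono (by linarith)) hn.2.1.2
  rw [pairing_toDist hn2.1 hm2.conj.1] at h1
  rw [pairing_toDist hm2.1 hn2.conj.1] at h2
  have h3 : MemLp (fun x => (m x + 1) * conj (n x)) 2 volume :=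
    (hm2.isMult_add_one.mul_memSob (τ := s + 1) (by linarith) (by linarith) le_rfl (by linarith)
      hn2.conj).1
  have h4 := congrArg conj h2
  rw [conj_pairing (hqr.fhat_neg hq) h3, map_add, map_mul, map_mul,
    conj_pairing (fhat_dv_conj hm2) hn2.conj.1, ← integral_conj] at h4
  simp only [map_mul, map_add, map_one, map_neg, Complex.conj_I, Complex.conj_conj, neg_neg,
    Complex.conj_ofReal] at h4
  rw [pairing_dv_symm hm2.conj hn2] at h4
  rw [← h1, ← h4]
  simp only [mul_comm (n _)]
  ring

/-- An exact remainder, from `IsGauge.pairing_symm` for (q, q+f) and for (q, q). Both f and n-m are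
small of first order in f. -/
theorem IsGauge.pairing_sub {s κ : ℝ} (hs : -(1 / 2) < s) (hs' : s < 0) {q f : 𝓢'(ℝ, ℂ)}
    (hq : TemperedDistribution.MemSobolev s 2 q) (hqr : IsRealValued q)
    (hf : TemperedDistribution.MemSobolev s 2 f) {m n : ℝ → ℂ} (hm : IsGauge s κ q m)
    (hn : IsGauge s κ (q + f) n) :
    pairing (q + f) (toDist n) - pairing q (toDist m) -
        pairing f (toDist fun x => m x + conj (m x) + m x * conj (m x)) =
      pairing f (toDist fun x => (conj (m x) + 1) * (n x - m x)) := by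
  have hm2 : MemSob (-s) m := hm.2.1.1.mono (by linarith)
  have hn2 : MemSob (-s) n := hn.2.1.1.mono (by linarith)
  have hmul : ∀ {g φ : ℝ → ℂ}, MemSob (s + 1) g → MemSob (-s) φ → MemSob (-s) (fun x => g x * φ x) :=
    fun hg hφ => hg.mul (by linarith) (by linarith) (by linarith) (by linarith) hφ
  have h1 := hm.pairing_symm hs hs' hq hqr (hq.add hf) hn
  have h2 := hm.pairing_symm hs hs' hq hqr hq hm
  have hnm := hmul hn.2.1.1 hm2.conj
  have hmm := hmul hm.2.1.1 hm2.conj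
  have e1 : (fun x => (n x + 1) * conj (m x)) = fun x => n x * conj (m x) + conj (m x) := by
    ext x; ring
  have e2 : (fun x => (conj (m x) + 1) * n x) = fun x => n x * conj (m x) + n x := by
    ext x; ring
  have e3 : (fun x => (m x + 1) * conj (m x)) = fun x => m x * conj (m x) + conj (m x) := by
    ext x; ring
  have e4 : (fun x => (conj (m x) + 1) * m x) = fun x => m x * conj (m x) + m x := by
    ext x; ring
  have e5 : (fun x => (conj (m x) + 1) * (n x - m x)) = fun x =>
      (n x * conj (m x) + n x) + (-1) * (m x * conj (m x) + m x) := by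
    ext x; ring
  rw [e1, e2, pairing_add_left hq hf (hnm.add hm2.conj), pairing_add_right hq hnm hm2.conj,
    pairing_add_right hf hnm hm2.conj, pairing_add_right hq hnm hn2] at h1
  rw [e3, e4, pairing_add_right hq hmm hm2.conj, pairing_add_right hq hmm hm2] at h2
  rw [e5, pairing_add_right hf (hnm.add hn2) ((hmm.add hm2).const_mul (-1)),
    pairing_const_mul_right f (hmm.add hm2).1, pairing_add_right hf hnm hn2,
    pairing_add_right hf hmm hm2, pairing_add_right hf (hm2.add hm2.conj) hmm,
    pairing_add_right hf hm2 hm2.conj, pairing_add_left hq hf hn2]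
  linear_combination h2 - h1

theorem nrm_fhat_add_le {s κ : ℝ} (hκ : 1 ≤ κ) (hs' : s ≤ 0) {q f : 𝓢'(ℝ, ℂ)}
    (hq : TemperedDistribution.MemSobolev s 2 q) (hf : TemperedDistribution.MemSobolev s 2 f) :
    nrm κ s (fhat (q + f)) ≤ sobolevNorm s q + sobolevNorm s f := by
  rw [nrm_congr (fhat_add hq hf), sobolevNorm_eq_nrm hq, sobolevNorm_eq_nrm hf]
  exact (nrm_add_le hκ (memW_fhat hq) (memW_fhat hf)).trans
    (add_le_add (nrm_le_nrm_one hκ hs' (memW_fhat hq)) (nrm_le_nrm_one hκ hs' (memW_fhat hf)))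

theorem hasFunctionalDeriv_beta {s κ : ℝ} (hs : -(1 / 2) < s) (hs' : s < 0) (hκ : 1 ≤ κ)
    {q : 𝓢'(ℝ, ℂ)} (hq : TemperedDistribution.MemSobolev s 2 q) (hqr : IsRealValued q)
    (hδ : prodConst κ (s + 1) * (sobolevNorm s q + 1) ≤ 1 / 4) {m : ℝ → ℂ}
    (hm : IsGauge s κ q m) :
    HasFunctionalDeriv s (beta s κ) q (fun x => m x + conj (m x) + m x * conj (m x)) := by
  have hK := prodConst_nonneg κ (s + 1)
  have hσ2 : 1 / 2 < s + 1 := by linarith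
  have hsm : ∀ {f : 𝓢'(ℝ, ℂ)}, TemperedDistribution.MemSobolev s 2 f → sobolevNorm s f ≤ 1 →
      prodConst κ (s + 1) * nrm κ s (fhat (q + f)) ≤ 1 / 4 := fun hf hf1 =>
    (mul_le_mul_of_nonneg_left ((nrm_fhat_add_le hκ hs'.le hq hf).trans (by linarith)) hK).trans hδ
  have hδq : prodConst κ (s + 1) * nrm κ s (fhat q) ≤ 1 / 4 := by
    refine (mul_le_mul_of_nonneg_left ?_ hK).trans hδ
    rw [sobolevNorm_eq_nrm hq]
    linarith [nrm_le_nrm_one hκ hs'.le (memW_fhat hq)]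
  have hm2 := hm.2.1.1
  have hmm : MemSob (s + 1) (fun x => m x * conj (m x)) :=
    hm2.mul hσ2 (by linarith) le_rfl (by linarith) hm2.conj
  -- The bound 1 keeps q+f where the gauge exists. The remainder is at most (1/3 + 1) · 2‖f‖² =
  -- (8/3)‖f‖², so ‖f‖ ≤ ε/3 suffices.
  refine ⟨((hm2.add hm2.conj).add hmm).mono (by linarith), fun ε hε =>
    ⟨min 1 (ε / 3), by positivity, fun f hf hfr hfδ => ?_⟩⟩
  have hδf := hsm hf (hfδ.trans (min_le_left _ _))
  have hn := isGauge_gauge (exists_isGauge hs hs' hκ (hq.add hf) (hδf.trans (by norm_num)))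
  have hmg : gauge s κ q = m := hm.unique hs hs' hκ hq hδq (isGauge_gauge ⟨m, hm⟩)
  rw [beta, beta, hmg, hm.pairing_sub hs hs' hq hqr hf hn]
  set n := gauge s κ (q + f)
  have hd := hn.2.1.1.sub hm2
  have hd' : MemSob (-s) (fun x => n x - m x) := hd.mono (by linarith)
  have hmd : MemSob (-s) (fun x => conj (m x) * (n x - m x)) :=
    hm2.conj.mul hσ2 (by linarith) (by linarith) (by linarith) hd'
  have e : (fun x => (conj (m x) + 1) * (n x - m x)) = fun x =>
      conj (m x) * (n x - m x) + (n x - m x) := by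
    ext x; ring
  rw [e]
  have h1 := norm_pairing_le hκ hf (hmd.add hd')
  have h2 := nrm_add_le hκ hmd.memW hd'.memW
  rw [← nrm_congr (hat_add hmd.1 hd'.1)] at h2
  have h3 := nrm_hat_mul_le hκ hσ2 (by linarith) (by linarith) (by linarith) hm2.conj hd'
  rw [nrm_congr (hat_conj hm2.1), nrm_conj_neg hκ hm2.memW] at h3
  have h4 := mul_le_mul_of_nonneg_left (hm.nrm_le hs hs' hκ hq hδq) hK
  have h5 : prodConst κ (s + 1) * nrm κ (s + 1) (hat m) ≤ 1 / 3 := by linarith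
  have h6 := mul_le_mul_of_nonneg_right h5 (nrm_nonneg κ (-s) (hat fun x => n x - m x))
  have h7 : nrm κ (-s) (hat fun x => n x - m x) ≤ 2 * nrm κ s (fhat f) :=
    (nrm_mono hκ (by linarith) hd.memW).trans (hm.nrm_sub_le hs hs' hκ hq hf hδq hδf hn)
  have h8 : nrm κ s (fhat f) ≤ sobolevNorm s f := by
    rw [sobolevNorm_eq_nrm hf]; exact nrm_le_nrm_one hκ hs'.le (memW_fhat hf)
  have h9 : sobolevNorm s f ≤ ε / 3 := hfδ.trans (min_le_right _ _)
  have h0 := nrm_nonneg κ s (fhat f)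
  refine h1.trans ?_
  calc _ ≤ sobolevNorm s f * ε := mul_le_mul h8 (by linarith) (nrm_nonneg _ _ _) (h0.trans h8)
    _ = _ := mul_comm _ _

/-! ### The Bock–Kruskal equation and the gauge equation -/

theorem exists_posFreq_add_conj {σ : ℝ} (hσ : 0 ≤ σ) {φ : ℝ → ℂ} (hφ : MemSob σ φ) :
    ∃ ψ χ : ℝ → ℂ, MemSob σ ψ ∧ PosFreq ψ ∧ MemSob σ χ ∧ PosFreq χ ∧
      φ = fun x => ψ x + conj (χ x) := by
  obtain ⟨ψ, hψ, hψp, h⟩ := exists_posFreq_part hσ hφ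
  refine ⟨ψ, fun x => conj (φ x - ψ x), hψ, hψp, (hφ.sub hψ).conj, ?_, ?_⟩
  · filter_upwards [hat_conj (hφ.sub hψ).1, ae_neg (hat_sub hφ.1 hψ.1), ae_neg h] with ξ h1 h2 h3 hξ
    rw [h1, h2, h3, Set.indicator_of_mem (by simpa using hξ.le)]
    simp
  · ext x
    simp

theorem pairing_hilbert_posFreq {s : ℝ} {T : 𝓢'(ℝ, ℂ)}
    (hT : TemperedDistribution.MemSobolev s 2 T) {ψ : ℝ → ℂ} (hψ : PosFreq ψ) :
    pairing (hilbert T) (toDist ψ) = Complex.I * pairing T (toDist ψ) := by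
  rw [pairing_eq, pairing_eq, ← integral_const_mul]
  have h0 : ∀ᵐ ξ : ℝ, ξ ≠ 0 := by simp [ae_iff]
  apply integral_congr_ae
  filter_upwards [(hilbert_spec hT).2, ae_neg hψ, h0] with ξ h1 h2 h4
  rcases lt_or_gt_of_ne h4 with h | h
  · rw [h1]; simp [h, mul_assoc]
  · simp [h2 (by linarith)]

theorem fhat_dv_eq_zero {σ : ℝ} {u : ℝ → ℂ} (hu : MemSob σ u) (hp : PosFreq u) :
    ∀ᵐ ξ : ℝ, ξ < 0 → fhat (dv u) ξ = 0 := by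
  filter_upwards [fhat_dv hu, hp] with ξ h1 h2 hξ
  rw [h1, h2 hξ, mul_zero]

theorem dv_add {u v : ℝ → ℂ} (hu : MemLp u 2 volume) (hv : MemLp v 2 volume) :
    dv (fun x => u x + v x) = dv u + dv v := by
  rw [dv, toDist_add hu hv, map_add]; rfl

theorem dv_const_mul {u : ℝ → ℂ} (hu : MemLp u 2 volume) (c : ℂ) :
    dv (fun x => c * u x) = c • dv u := by
  rw [dv, toDist_const_mul hu, map_smul]; rfl

/-- Two distributions with real pairings agree if they agree on the functions `g ψ̄` with `ψ` of
non-negative frequencies. -/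
theorem eq_of_pairing_mul_conj {s : ℝ} (hs : -(1 / 2) < s) (hs' : s < 0) {T S : 𝓢'(ℝ, ℂ)}
    (hT : TemperedDistribution.MemSobolev s 2 T) (hS : TemperedDistribution.MemSobolev s 2 S)
    (hTr : ∀ φ, MemSob (-s) φ → pairing T (toDist fun x => conj (φ x)) = conj (pairing T (toDist φ)))
    (hSr : ∀ φ, MemSob (-s) φ → pairing S (toDist fun x => conj (φ x)) = conj (pairing S (toDist φ)))
    {g h : ℝ → ℂ} (hg : IsMult (s + 1) g) (hh : IsMult (s + 1) h) (hgh : ∀ x, g x * h x = 1)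
    (hgr : ∀ x, conj (g x) = g x)
    (H : ∀ ψ, MemSob (-s) ψ → PosFreq ψ → pairing T (toDist fun x => g x * conj (ψ x)) =
      pairing S (toDist fun x => g x * conj (ψ x))) : T = S := by
  have hmul : ∀ {g φ : ℝ → ℂ}, IsMult (s + 1) g → MemSob (-s) φ → MemSob (-s) (fun x => g x * φ x) :=
    fun hg hφ => hg.mul_memSob (by linarith) (by linarith) (by linarith) (by linarith) hφ
  refine ext_of_pairing hT hS fun φ => ?_
  -- Splitting φ/g = hφ into ψ + χ̄ gives φ = gψ + gχ̄. The second term is covered by H; the first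
  -- is the conjugate of gψ̄, as g is real.
  obtain ⟨ψ, χ, hψ, hψp, hχ, hχp, e⟩ :=
    exists_posFreq_add_conj (by linarith) (hmul hh (memSob_schwartz (-s) φ))
  have e2 : (φ : ℝ → ℂ) = fun x => g x * ψ x + g x * conj (χ x) := by
    ext x
    rw [← mul_add, ← congrFun e x, ← mul_assoc, hgh, one_mul]
  have e3 : (fun x => g x * ψ x) = fun x => conj (g x * conj (ψ x)) := by
    ext x
    rw [map_mul, hgr, Complex.conj_conj]
  rw [e2, pairing_add_right hT (hmul hg hψ) (hmul hg hχ.conj),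
    pairing_add_right hS (hmul hg hψ) (hmul hg hχ.conj), H χ hχ hχp, e3,
    hTr _ (hmul hg hψ.conj), hSr _ (hmul hg hψ.conj), H ψ hψ hψp]

/-- The relation `κ + w = κ |1 + m|²` between `w` and an invertible element `1 + m`, with inverse
`1 + n`, of the Hardy algebra. -/
structure Factorization (s κ : ℝ) (w : ℝ → ℝ) (m n : ℝ → ℂ) : Prop where
  memSob_m : MemSob (s + 1) m
  posFreq_m : PosFreq m
  memSob_n : MemSob (s + 1) n
  posFreq_n : PosFreq n
  mul_eq_one : ∀ x, (m x + 1) * (n x + 1) = 1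
  eq_w : ∀ x, (w x : ℂ) + κ = κ * ((m x + 1) * (conj (m x) + 1))

/-- The right-hand side of the Bock–Kruskal equation. -/
noncomputable def bkRhs (κ : ℝ) (w : ℝ → ℝ) : 𝓢'(ℝ, ℂ) :=
  mulDist (fun x => ((1 / (w x + κ) : ℝ) : ℂ)) (hilbert (dv fun x => (w x : ℂ))) +
    hilbert (mulDist (fun x => ((1 / (w x + κ) : ℝ) : ℂ)) (dv fun x => (w x : ℂ))) +
    toDist (fun x => ((2 * κ * w x / (w x + κ) : ℝ) : ℂ))

namespace Factorization

variable {s κ : ℝ} {w : ℝ → ℝ} {m n : ℝ → ℂ}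

theorem conj_mul_eq_one (F : Factorization s κ w m n) (x : ℝ) :
    (conj (m x) + 1) * (conj (n x) + 1) = 1 := by
  have := congrArg conj (F.mul_eq_one x)
  simpa using this

theorem w_eq (F : Factorization s κ w m n) :
    (fun x => (w x : ℂ)) = fun x => (κ : ℂ) * ((m x + conj (m x)) + m x * conj (m x)) := by
  ext x
  linear_combination F.eq_w x

theorem inv_eq (F : Factorization s κ w m n) (hκ : 1 ≤ κ) (x : ℝ) :
    ((1 / (w x + κ) : ℝ) : ℂ) = (κ : ℂ)⁻¹ * ((n x + 1) * (conj (n x) + 1)) := by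
  have hκ0 : (κ : ℂ) ≠ 0 := by exact_mod_cast (by linarith : κ ≠ 0)
  push_cast
  rw [F.eq_w x, one_div]
  apply inv_eq_of_mul_eq_one_right
  have h1 := F.mul_eq_one x
  have h2 := F.conj_mul_eq_one x
  calc _ = ((κ : ℂ) * (κ : ℂ)⁻¹) * (((m x + 1) * (n x + 1)) * ((conj (m x) + 1) * (conj (n x) + 1))) := by
        ring
    _ = 1 := by rw [h1, h2, mul_inv_cancel₀ hκ0]; ring

theorem inv_mul (F : Factorization s κ w m n) (hκ : 1 ≤ κ) (x : ℝ) :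
    ((1 / (w x + κ) : ℝ) : ℂ) * ((w x : ℂ) + κ) = 1 := by
  have hκ0 : (κ : ℂ) ≠ 0 := by exact_mod_cast (by linarith : κ ≠ 0)
  rw [F.inv_eq hκ, F.eq_w]
  have h1 := F.mul_eq_one x
  have h2 := F.conj_mul_eq_one x
  calc _ = ((κ : ℂ)⁻¹ * κ) * (((m x + 1) * (n x + 1)) * ((conj (m x) + 1) * (conj (n x) + 1))) := by
        ring
    _ = 1 := by rw [h1, h2, inv_mul_cancel₀ hκ0]; ring

theorem memSob_sq (hs : -(1 / 2) < s) (hs' : s < 0) {m : ℝ → ℂ} (hm : MemSob (s + 1) m) :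
    MemSob (s + 1) fun x => m x * conj (m x) :=
  hm.mul (by linarith) (by linarith) le_rfl (by linarith) hm.conj

theorem memSob_w (F : Factorization s κ w m n) (hs : -(1 / 2) < s) (hs' : s < 0) :
    MemSob (s + 1) (fun x => (w x : ℂ)) := by
  rw [F.w_eq]
  exact ((F.memSob_m.add F.memSob_m.conj).add (memSob_sq hs hs' F.memSob_m)).const_mul _

theorem isMult_inv (F : Factorization s κ w m n) (hκ : 1 ≤ κ) (hs : -(1 / 2) < s) (hs' : s < 0) :
    IsMult (s + 1) (fun x => ((1 / (w x + κ) : ℝ) : ℂ)) := by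
  refine ⟨(κ : ℂ)⁻¹, ?_⟩
  convert ((F.memSob_n.add F.memSob_n.conj).add (memSob_sq hs hs' F.memSob_n)).const_mul (κ : ℂ)⁻¹
    using 2 with x
  simp only [F.inv_eq hκ]
  ring

theorem isMult_w (F : Factorization s κ w m n) (hs : -(1 / 2) < s) (hs' : s < 0) :
    IsMult (s + 1) (fun x => (w x : ℂ) + κ) :=
  ⟨κ, by simpa using F.memSob_w hs hs'⟩

theorem memSob_rem (F : Factorization s κ w m n) (hκ : 1 ≤ κ) (hs : -(1 / 2) < s) (hs' : s < 0) :
    MemSob (s + 1) (fun x => ((2 * κ * w x / (w x + κ) : ℝ) : ℂ)) := by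
  have := (F.isMult_inv hκ hs hs').mul_memSob (by linarith) (by linarith) le_rfl (by linarith)
    ((F.memSob_w hs hs').const_mul (2 * κ))
  convert this using 2 with x
  push_cast
  ring

theorem pairing_dv_w (F : Factorization s κ w m n) (hs : -(1 / 2) < s) (hs' : s < 0) {φ : ℝ → ℂ}
    (hφ : MemSob (-s) φ) :
    pairing (dv fun x => (w x : ℂ)) (toDist φ) =
      κ * (pairing (dv m) (toDist fun x => (conj (m x) + 1) * φ x) +
        pairing (dv fun x => conj (m x)) (toDist fun x => (m x + 1) * φ x)) := by
  have hm := F.memSob_m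
  have hmm := memSob_sq hs hs' hm
  have hmul : ∀ {g : ℝ → ℂ}, MemSob (s + 1) g → MemSob (-s) (fun x => g x * φ x) :=
    fun hg => hg.mul (by linarith) (by linarith) (by linarith) (by linarith) hφ
  have e : ∀ g : ℝ → ℂ, (fun x => (g x + 1) * φ x) = fun x => g x * φ x + φ x := fun g => by
    ext x; ring
  rw [F.w_eq, dv_const_mul ((hm.add hm.conj).add hmm).1, dv_add (hm.add hm.conj).1 hmm.1,
    dv_add hm.1 hm.conj.1,
    pairing_smul_left ((hm.memSobolev_dv.add hm.conj.memSobolev_dv).add hmm.memSobolev_dv),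
    pairing_add_left (hm.memSobolev_dv.add hm.conj.memSobolev_dv) hmm.memSobolev_dv hφ,
    pairing_add_left hm.memSobolev_dv hm.conj.memSobolev_dv hφ,
    pairing_dv_mul hs hs' hm hm.conj hφ, e, e,
    pairing_add_right hm.memSobolev_dv (hmul hm.conj) hφ,
    pairing_add_right hm.conj.memSobolev_dv (hmul hm) hφ]
  ring

/-- The logarithmic derivative of κ(1+m)(1+m̄), where 1+n is the inverse of 1+m. -/
theorem pairing_inv_dv_w (F : Factorization s κ w m n) (hκ : 1 ≤ κ) (hs : -(1 / 2) < s)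
    (hs' : s < 0) {φ : ℝ → ℂ} (hφ : MemSob (-s) φ) :
    pairing (mulDist (fun x => ((1 / (w x + κ) : ℝ) : ℂ)) (dv fun x => (w x : ℂ))) (toDist φ) =
      pairing (dv m) (toDist fun x => (n x + 1) * φ x) +
        pairing (dv fun x => conj (m x)) (toDist fun x => (conj (n x) + 1) * φ x) := by
  have hκ0 : (κ : ℂ) ≠ 0 := by exact_mod_cast (by linarith : κ ≠ 0)
  have hg := F.isMult_inv hκ hs hs'
  have hmul : ∀ {g : ℝ → ℂ}, IsMult (s + 1) g → MemSob (-s) (fun x => g x * φ x) :=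
    fun hg => hg.mul_memSob (by linarith) (by linarith) (by linarith) (by linarith) hφ
  rw [(mulDist_spec hs hs' hg (F.memSob_w hs hs').memSobolev_dv).2 φ hφ,
    F.pairing_dv_w hs hs' (hmul hg)]
  have e1 : (fun x => (conj (m x) + 1) * (((1 / (w x + κ) : ℝ) : ℂ) * φ x)) =
      fun x => (κ : ℂ)⁻¹ * ((n x + 1) * φ x) := by
    ext x
    rw [F.inv_eq hκ]
    linear_combination ((κ : ℂ)⁻¹ * (n x + 1) * φ x) * F.conj_mul_eq_one x
  have e2 : (fun x => (m x + 1) * (((1 / (w x + κ) : ℝ) : ℂ) * φ x)) =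
      fun x => (κ : ℂ)⁻¹ * ((conj (n x) + 1) * φ x) := by
    ext x
    rw [F.inv_eq hκ]
    linear_combination ((κ : ℂ)⁻¹ * (conj (n x) + 1) * φ x) * F.mul_eq_one x
  rw [e1, e2, pairing_const_mul_right _ (hmul F.memSob_n.isMult_add_one).1,
    pairing_const_mul_right _ (hmul F.memSob_n.conj.isMult_add_one).1]
  field_simp

/-- m'/(1+m) has no negative frequencies, so it annihilates Hardy functions. -/
theorem pairing_dv_eq_zero (F : Factorization s κ w m n) (hs : -(1 / 2) < s) (hs' : s < 0)
    {ψ : ℝ → ℂ} (hψ : MemSob (-s) ψ) (hψp : PosFreq ψ) :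
    pairing (dv m) (toDist fun x => (n x + 1) * ψ x) = 0 :=
  pairing_eq_zero (fhat_dv_eq_zero F.memSob_m F.posFreq_m)
    (F.posFreq_n.mul_mult (by linarith) (by linarith) F.memSob_n hψ.1 hψp)

theorem pairing_dv_conj_eq_zero (F : Factorization s κ w m n) (hs : -(1 / 2) < s) (hs' : s < 0)
    {ψ : ℝ → ℂ} (hψ : MemSob (-s) ψ) (hψp : PosFreq ψ) :
    pairing (dv fun x => conj (m x)) (toDist fun x => (conj (n x) + 1) * conj (ψ x)) = 0 := by
  have h := congrArg conj (F.pairing_dv_eq_zero hs hs' hψ hψp)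
  rw [conj_pairing (fhat_dv_conj F.memSob_m) (F.memSob_n.isMult_add_one.mul_memSob (by linarith)
    (by linarith) (by linarith) (by linarith) hψ).1] at h
  simpa using h

/-- H acts as -i on m'/(1+m) and as +i on its conjugate. The test function is split into Hardy and
conjugate-Hardy halves, each annihilated by one of the two terms. -/
theorem pairing_hilbert_inv_dv_w (F : Factorization s κ w m n) (hκ : 1 ≤ κ) (hs : -(1 / 2) < s)
    (hs' : s < 0) {φ : ℝ → ℂ} (hφ : MemSob (-s) φ) :
    pairing (hilbert (mulDist (fun x => ((1 / (w x + κ) : ℝ) : ℂ)) (dv fun x => (w x : ℂ))))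
        (toDist φ) =
      -Complex.I * pairing (dv m) (toDist fun x => (n x + 1) * φ x) +
        Complex.I * pairing (dv fun x => conj (m x)) (toDist fun x => (conj (n x) + 1) * φ x) := by
  have hg := F.isMult_inv hκ hs hs'
  have hT := (mulDist_spec hs hs' hg (F.memSob_w hs hs').memSobolev_dv).1
  have hH := (hilbert_spec hT).1
  have hmul : ∀ {g φ : ℝ → ℂ}, IsMult (s + 1) g → MemSob (-s) φ → MemSob (-s) (fun x => g x * φ x) :=
    fun hg hφ => hg.mul_memSob (by linarith) (by linarith) (by linarith) (by linarith) hφ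
  have hn := F.memSob_n.isMult_add_one
  have hn' := F.memSob_n.conj.isMult_add_one
  obtain ⟨ψ, χ, hψ, hψp, hχ, hχp, e⟩ := exists_posFreq_add_conj (by linarith) hφ
  have e1 : ∀ g : ℝ → ℂ, (fun x => (g x + 1) * (ψ x + conj (χ x))) =
      fun x => (g x + 1) * ψ x + (g x + 1) * conj (χ x) := fun g => by
    ext x; ring
  rw [e, pairing_add_right hH hψ hχ.conj, pairing_hilbert_posFreq hT hψp,
    pairing_hilbert hT hχ.1 hχp, F.pairing_inv_dv_w hκ hs hs' hψ,
    F.pairing_inv_dv_w hκ hs hs' hχ.conj, F.pairing_dv_eq_zero hs hs' hψ hψp,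
    F.pairing_dv_conj_eq_zero hs hs' hχ hχp, e1, e1,
    pairing_add_right F.memSob_m.memSobolev_dv (hmul hn hψ) (hmul hn hχ.conj),
    pairing_add_right F.memSob_m.conj.memSobolev_dv (hmul hn' hψ) (hmul hn' hχ.conj),
    F.pairing_dv_eq_zero hs hs' hψ hψp, F.pairing_dv_conj_eq_zero hs hs' hχ hχp]
  ring

theorem mul_conj (F : Factorization s κ w m n) (φ : ℝ → ℂ) :
    (fun x => ((w x : ℂ) + κ) * φ x) =
      fun x => (κ : ℂ) * ((m x + 1) * ((conj (m x) + 1) * φ x)) := by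
  ext x
  rw [F.eq_w]
  ring

theorem memSobolev_terms (F : Factorization s κ w m n) (hκ : 1 ≤ κ) (hs : -(1 / 2) < s)
    (hs' : s < 0) :
    TemperedDistribution.MemSobolev s 2 (mulDist (fun x => ((1 / (w x + κ) : ℝ) : ℂ))
      (hilbert (dv fun x => (w x : ℂ)))) ∧
    TemperedDistribution.MemSobolev s 2
      (hilbert (mulDist (fun x => ((1 / (w x + κ) : ℝ) : ℂ)) (dv fun x => (w x : ℂ)))) ∧
    TemperedDistribution.MemSobolev s 2
      (toDist (fun x => ((2 * κ * w x / (w x + κ) : ℝ) : ℂ))) := by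
  have hg := F.isMult_inv hκ hs hs'
  have hW := (F.memSob_w hs hs').memSobolev_dv
  exact ⟨(mulDist_spec hs hs' hg (hilbert_spec hW).1).1,
    (hilbert_spec (mulDist_spec hs hs' hg hW).1).1,
    ((F.memSob_rem hκ hs hs').mono (by linarith)).2⟩

theorem memSobolev_bkRhs (F : Factorization s κ w m n) (hκ : 1 ≤ κ) (hs : -(1 / 2) < s)
    (hs' : s < 0) : TemperedDistribution.MemSobolev s 2 (bkRhs κ w) := by
  obtain ⟨h1, h2, h3⟩ := F.memSobolev_terms hκ hs hs'
  exact (h1.add h2).add h3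

theorem pairing_bkRhs (F : Factorization s κ w m n) (hκ : 1 ≤ κ) (hs : -(1 / 2) < s)
    (hs' : s < 0) {φ : ℝ → ℂ} (hφ : MemSob (-s) φ) :
    pairing (bkRhs κ w) (toDist φ) =
      pairing (hilbert (dv fun x => (w x : ℂ)))
          (toDist fun x => ((1 / (w x + κ) : ℝ) : ℂ) * φ x) +
        (-Complex.I * pairing (dv m) (toDist fun x => (n x + 1) * φ x) +
          Complex.I * pairing (dv fun x => conj (m x)) (toDist fun x => (conj (n x) + 1) * φ x)) +
        ∫ x, ((2 * κ * w x / (w x + κ) : ℝ) : ℂ) * φ x := by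
  obtain ⟨h1, h2, h3⟩ := F.memSobolev_terms hκ hs hs'
  rw [bkRhs, pairing_add_left (h1.add h2) h3 hφ, pairing_add_left h1 h2 hφ,
    F.pairing_hilbert_inv_dv_w hκ hs hs' hφ, pairing_toDist (F.memSob_rem hκ hs hs').1 hφ.1,
    (mulDist_spec hs hs' (F.isMult_inv hκ hs hs')
      (hilbert_spec (F.memSob_w hs hs').memSobolev_dv).1).2 φ hφ]

theorem fhat_hilbert_dv_w (F : Factorization s κ w m n) (hs : -(1 / 2) < s) (hs' : s < 0) :
    fhat (hilbert (dv fun x => (w x : ℂ))) =ᵐ[volume]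
      fun ξ => conj (fhat (hilbert (dv fun x => (w x : ℂ))) (-ξ)) := by
  have hW := F.memSob_w hs hs'
  have h := (hilbert_spec hW.memSobolev_dv).2
  have h2 := fhat_dv_conj hW
  simp only [Complex.conj_ofReal] at h2
  filter_upwards [h, ae_neg h, h2] with ξ h3 h4 h5
  rw [h3, h4, h5]
  simp [Left.sign_neg]

/-- Reality of the right-hand side, required by `eq_of_pairing_mul_conj`, which tests on only half
of the functions. -/
theorem conj_pairing_bkRhs (F : Factorization s κ w m n) (hκ : 1 ≤ κ) (hs : -(1 / 2) < s)
    (hs' : s < 0) {φ : ℝ → ℂ} (hφ : MemSob (-s) φ) :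
    pairing (bkRhs κ w) (toDist fun x => conj (φ x)) = conj (pairing (bkRhs κ w) (toDist φ)) := by
  have hmul : ∀ {g : ℝ → ℂ}, IsMult (s + 1) g → MemSob (-s) (fun x => g x * φ x) :=
    fun hg => hg.mul_memSob (by linarith) (by linarith) (by linarith) (by linarith) hφ
  have hm := F.memSob_m
  have h1 := conj_pairing (fhat_dv_conj hm) (hmul F.memSob_n.isMult_add_one).1
  have h2' := fhat_dv_conj hm.conj
  simp only [Complex.conj_conj] at h2'
  have h2 := conj_pairing h2' (hmul F.memSob_n.conj.isMult_add_one).1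
  rw [F.pairing_bkRhs hκ hs hs' hφ, F.pairing_bkRhs hκ hs hs' hφ.conj, map_add, map_add, map_add,
    map_mul, map_mul, conj_pairing (F.fhat_hilbert_dv_w hs hs') (hmul (F.isMult_inv hκ hs hs')).1,
    h1, h2, ← integral_conj]
  simp only [map_mul, map_add, map_one, map_neg, Complex.conj_I, Complex.conj_conj,
    Complex.conj_ofReal]
  ring

/-- After multiplication by w+κ = κ(1+m)(1+m̄), the first Hilbert term gives -iκ[m'(1+m̄) +
m̄'(1+m)] and the second -iκ m'(1+m̄) + iκ m̄'(1+m). The m̄' terms cancel and the m' terms double.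
In 2κw = 2κ²[m(1+m̄) + m̄] the last summand vanishes against ψ̄. -/
theorem pairing_bkRhs_mul_conj (F : Factorization s κ w m n) (hκ : 1 ≤ κ) (hs : -(1 / 2) < s)
    (hs' : s < 0) {ψ : ℝ → ℂ} (hψ : MemSob (-s) ψ) (hψp : PosFreq ψ) :
    pairing (bkRhs κ w) (toDist fun x => ((w x : ℂ) + κ) * conj (ψ x)) =
      2 * κ * (-Complex.I * pairing (dv m) (toDist fun x => conj ((m x + 1) * ψ x)) +
        κ * pairing (toDist m) (toDist fun x => conj ((m x + 1) * ψ x))) := by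
  have hm := F.memSob_m
  have hmul : ∀ {g φ : ℝ → ℂ}, IsMult (s + 1) g → MemSob (-s) φ → MemSob (-s) (fun x => g x * φ x) :=
    fun hg hφ => hg.mul_memSob (by linarith) (by linarith) (by linarith) (by linarith) hφ
  have hmψ := hmul hm.isMult_add_one hψ
  have hmψ' := hmul hm.isMult_add_one hψ.conj
  have e1 : (fun x => ((1 / (w x + κ) : ℝ) : ℂ) * (((w x : ℂ) + κ) * conj (ψ x))) =
      fun x => conj (ψ x) := by
    ext x
    rw [← mul_assoc, F.inv_mul hκ, one_mul]
  have e2 : (fun x => (n x + 1) * (((w x : ℂ) + κ) * conj (ψ x))) =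
      fun x => (κ : ℂ) * conj ((m x + 1) * ψ x) := by
    ext x
    rw [F.eq_w, map_mul, map_add, map_one]
    linear_combination ((κ : ℂ) * (conj (m x) + 1) * conj (ψ x)) * F.mul_eq_one x
  have e3 : (fun x => (conj (n x) + 1) * (((w x : ℂ) + κ) * conj (ψ x))) =
      fun x => (κ : ℂ) * ((m x + 1) * conj (ψ x)) := by
    ext x
    rw [F.eq_w]
    linear_combination ((κ : ℂ) * (m x + 1) * conj (ψ x)) * F.conj_mul_eq_one x
  have e4 : (fun x => ((2 * κ * w x / (w x + κ) : ℝ) : ℂ) * (((w x : ℂ) + κ) * conj (ψ x))) =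
      fun x => (2 * κ ^ 2 : ℂ) * (m x * conj ((m x + 1) * ψ x)) +
        (2 * κ ^ 2 : ℂ) * conj (m x * ψ x) := by
    ext x
    have h1 : ((2 * κ * w x / (w x + κ) : ℝ) : ℂ) = 2 * κ * w x * ((1 / (w x + κ) : ℝ) : ℂ) := by
      push_cast; ring
    rw [h1]
    have h2 := F.inv_mul hκ x
    have h3 := F.eq_w x
    simp only [map_mul, map_add, map_one]
    linear_combination (2 * κ * w x * conj (ψ x)) * h2 + (2 * κ * conj (ψ x)) * h3
  have e5 : (fun x => (conj (m x) + 1) * conj (ψ x)) = fun x => conj ((m x + 1) * ψ x) := by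
    ext x; simp
  have h0 : ∫ x, conj (m x * ψ x) = 0 := by
    rw [integral_conj, integral_mul_eq_zero hm.1 hψ.1 F.posFreq_m hψp, map_zero]
  have hi1 : Integrable (fun x => m x * conj ((m x + 1) * ψ x)) volume :=
    MemLp.integrable_mul (p := 2) (q := 2) hm.1 hmψ.conj.1
  have hi2 : Integrable (fun x => conj (m x * ψ x)) volume := by
    have := MemLp.integrable_mul (p := 2) (q := 2) hm.conj.1 hψ.conj.1
    convert this using 1
    ext x; simp
  rw [F.pairing_bkRhs hκ hs hs' (hmul (F.isMult_w hs hs') hψ.conj), e1, e2, e3, e4,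
    pairing_hilbert (F.memSob_w hs hs').memSobolev_dv hψ.1 hψp, F.pairing_dv_w hs hs' hψ.conj, e5,
    pairing_const_mul_right _ hmψ.conj.1, pairing_const_mul_right _ hmψ'.1,
    integral_add (hi1.const_mul _) (hi2.const_mul _), integral_const_mul, integral_const_mul, h0,
    pairing_toDist hm.1 hmψ.conj.1]
  ring

/-- For `w + κ = κ |1 + m|²`, the Bock–Kruskal equation for `w` is the gauge equation for `m`. -/
theorem bk_iff_isGauge (F : Factorization s κ w m n) (hκ : 1 ≤ κ) (hs : -(1 / 2) < s)
    (hs' : s < 0) (hc : Continuous m) {q : 𝓢'(ℝ, ℂ)}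
    (hq : TemperedDistribution.MemSobolev s 2 q) (hqr : IsRealValued q) :
    (2 : ℂ) • q = bkRhs κ w ↔ IsGauge s κ q m := by
  have hκ0 : (κ : ℂ) ≠ 0 := by exact_mod_cast (by linarith : κ ≠ 0)
  have hm := F.memSob_m
  have hn := F.memSob_n
  have hmul : ∀ {g φ : ℝ → ℂ}, IsMult (s + 1) g → MemSob (-s) φ → MemSob (-s) (fun x => g x * φ x) :=
    fun hg hφ => hg.mul_memSob (by linarith) (by linarith) (by linarith) (by linarith) hφ
  have key : ∀ ψ, MemSob (-s) ψ → PosFreq ψ →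
      pairing ((2 : ℂ) • q) (toDist fun x => ((w x : ℂ) + κ) * conj (ψ x)) =
        2 * κ * pairing q (toDist fun x => (m x + 1) * conj ((m x + 1) * ψ x)) := fun ψ hψ hψp => by
    have e : (fun x => ((w x : ℂ) + κ) * conj (ψ x)) =
        fun x => (κ : ℂ) * ((m x + 1) * conj ((m x + 1) * ψ x)) := by
      rw [F.mul_conj]
      simp only [map_mul, map_add, map_one]
    rw [pairing_smul_left hq, e, pairing_const_mul_right _
      (hmul hm.isMult_add_one (hmul hm.isMult_add_one hψ).conj).1]
    ring
  rw [isGauge_iff_pairing hs hs' hq hc hm F.posFreq_m]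
  constructor
  · intro h ψ hψ hψp
    -- Testing with (1+n)ψ makes the product with 1+m equal to ψ, so every Hardy test is reached.
    have h1 := hmul hn.isMult_add_one hψ
    have h2 := F.posFreq_n.mul_mult (by linarith) (by linarith) hn hψ.1 hψp
    have h3 := key _ h1 h2
    rw [h, F.pairing_bkRhs_mul_conj hκ hs hs' h1 h2] at h3
    have e : ∀ x, (m x + 1) * ((n x + 1) * ψ x) = ψ x := fun x => by
      rw [← mul_assoc, F.mul_eq_one, one_mul]
    simp only [e] at h3
    exact mul_left_cancel₀ (mul_ne_zero two_ne_zero hκ0) h3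
  · intro h
    refine eq_of_pairing_mul_conj hs hs' (hq.smul 2) (F.memSobolev_bkRhs hκ hs hs') (fun φ hφ => ?_)
      (fun φ hφ => F.conj_pairing_bkRhs hκ hs hs' hφ) (F.isMult_w hs hs') (F.isMult_inv hκ hs hs')
      (fun x => by rw [mul_comm, F.inv_mul hκ]) (fun x => by simp) fun ψ hψ hψp => ?_
    · rw [pairing_smul_left hq, pairing_smul_left hq, map_mul, conj_pairing (hqr.fhat_neg hq) hφ.1,
        map_ofNat]
    · rw [key ψ hψ hψp, F.pairing_bkRhs_mul_conj hκ hs hs' hψ hψp,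
        h _ (hmul hm.isMult_add_one hψ)
          (F.posFreq_m.mul_mult (by linarith) (by linarith) hm hψ.1 hψp)]

end Factorization

/-! ### From the gauge to solutions and back; the threshold for κ; the theorem. -/

theorem isBKSolution_iff {s κ : ℝ} {q : 𝓢'(ℝ, ℂ)} {w : ℝ → ℝ} :
    IsBKSolution s κ q w ↔ Continuous w ∧ MemSob (s + 1) (fun x => (w x : ℂ)) ∧
      (∃ δ > 0, ∀ x, δ ≤ κ + w x) ∧ (2 : ℂ) • q = bkRhs κ w := Iff.rfl

theorem ofReal_norm_sq_add (κ : ℝ) (z : ℂ) : ((κ * (‖z‖ ^ 2 + 2 * z.re) : ℝ) : ℂ) =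
    κ * (z + conj z + z * conj z) := by
  rw [Complex.add_conj, Complex.mul_conj, Complex.normSq_eq_norm_sq]
  push_cast
  ring

theorem IsGauge.factorization {s κ : ℝ} (hs : -(1 / 2) < s) (hs' : s < 0) {q : 𝓢'(ℝ, ℂ)}
    {m : ℝ → ℂ} (hm : IsGauge s κ q m) (hb : ∀ x, ‖m x‖ ≤ 1 / 2) :
    Factorization s κ (fun x => κ * (‖m x‖ ^ 2 + 2 * (m x).re)) m (fun x => (m x + 1)⁻¹ - 1) := by
  have hn := memSob_inv_sub_one (by linarith) (by linarith) hm.2.1.1 hm.1 hm.2.1.2 hb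
  refine ⟨hm.2.1.1, hm.2.1.2, hn.1, hn.2, fun x => ?_, fun x => ?_⟩
  · have : m x + 1 ≠ 0 := fun h0 => by
      have h1 := hb x
      rw [eq_neg_of_add_eq_zero_left h0] at h1
      norm_num at h1
    rw [sub_add_cancel, mul_inv_cancel₀ this]
  · rw [ofReal_norm_sq_add]
    ring

theorem abs_log_sub_log_le {δ a b : ℝ} (hδ : 0 < δ) (ha : δ ≤ a) (hb : δ ≤ b) :
    |Real.log a - Real.log b| ≤ δ⁻¹ * |a - b| := by
  have key : ∀ {a b : ℝ}, δ ≤ a → δ ≤ b → Real.log a - Real.log b ≤ δ⁻¹ * |a - b| := by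
    intro a b ha hb
    have ha0 : 0 < a := by linarith
    have hb0 : 0 < b := by linarith
    rw [← Real.log_div ha0.ne' hb0.ne']
    refine (Real.log_le_sub_one_of_pos (by positivity)).trans ?_
    have : a / b - 1 = b⁻¹ * (a - b) := by field_simp
    rw [this]
    have h1 : b⁻¹ ≤ δ⁻¹ := inv_anti₀ hδ hb
    exact (mul_le_mul_of_nonneg_left (le_abs_self _) (by positivity)).trans
      (mul_le_mul_of_nonneg_right h1 (abs_nonneg _))
  rw [abs_le]
  refine ⟨?_, key ha hb⟩
  have := key hb ha
  rw [abs_sub_comm] at this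
  linarith

/-- Every `w` with `inf (κ + w) > 0` has the form `κ + w = κ |1 + m|²` with `1 + m` invertible in
the Hardy algebra. -/
theorem exists_factorization {s κ : ℝ} (hs : -(1 / 2) < s) (hs' : s < 0) (hκ : 1 ≤ κ) {w : ℝ → ℝ}
    (hc : Continuous w) (hw : MemSob (s + 1) (fun x => (w x : ℂ))) {δ : ℝ} (hδ : 0 < δ)
    (hwδ : ∀ x, δ ≤ κ + w x) : ∃ m n, Continuous m ∧ Factorization s κ w m n := by
  have hκ0 : 0 < κ := by linarith
  have hσ2 : 1 / 2 < s + 1 := by linarith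
  have hpos : ∀ x, 0 < 1 + w x / κ := fun x => by
    have : 1 + w x / κ = (κ + w x) / κ := by field_simp
    rw [this]
    exact div_pos (hδ.trans_le (hwδ x)) hκ0
  set φ : ℝ → ℝ := fun x => Real.log (1 + w x / κ) with hφdef
  have hφc : Continuous φ := Continuous.log (by fun_prop) fun x => (hpos x).ne'
  -- The minimum with 1 allows comparison with log 1, the value of the logarithm at w = 0.
  set d : ℝ := min (δ / κ) 1
  have hd : 0 < d := by positivity
  have hdw : ∀ x, d ≤ 1 + w x / κ := fun x => by
    refine (min_le_left _ _).trans ?_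
    rw [div_le_iff₀ hκ0]
    have : (1 + w x / κ) * κ = κ + w x := by field_simp
    rw [this]
    exact hwδ x
  have hφ : MemSob (s + 1) (fun x => (φ x : ℂ)) := by
    refine hw.of_lipschitz (by linarith) (by linarith)
      (Complex.continuous_ofReal.comp hφc).aestronglyMeasurable (L := d⁻¹) (fun x => ?_) fun x y => ?_
    · rw [Complex.norm_real, Complex.norm_real, Real.norm_eq_abs, Real.norm_eq_abs]
      have h := abs_log_sub_log_le hd (hdw x) (min_le_right _ _)
      rw [Real.log_one, sub_zero, add_sub_cancel_left, abs_div, abs_of_pos hκ0] at h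
      refine h.trans (mul_le_mul_of_nonneg_left (div_le_self (abs_nonneg _) hκ) (by positivity))
    · rw [← Complex.ofReal_sub, ← Complex.ofReal_sub, Complex.norm_real, Complex.norm_real,
        Real.norm_eq_abs, Real.norm_eq_abs]
      have h := abs_log_sub_log_le hd (hdw x) (hdw y)
      rw [add_sub_add_left_eq_sub, ← sub_div, abs_div, abs_of_pos hκ0] at h
      refine h.trans (mul_le_mul_of_nonneg_left (div_le_self (abs_nonneg _) hκ) (by positivity))
  -- As φ = ψ + χ̄ is real, F = (ψ+χ)/2 satisfies F + F̄ = φ. Then 1+m = e^F and 1+n = e^{-F} are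
  -- inverse to each other, and κ|1+m|² = κe^φ = κ + w.
  obtain ⟨ψ, χ, hψ, hψp, hχ, hχp, e⟩ := exists_posFreq_add_conj (by linarith) hφ
  have hG := (hψ.add hχ).const_mul (1 / 2)
  have hGp := (hψp.add hψ.1 hχ.1 hχp).const_mul (hψ.add hχ).1 (1 / 2)
  obtain ⟨F, hFc, hF, hFG⟩ := hG.exists_continuous hσ2
  have hFp : PosFreq F := hGp.congr hFG.symm
  have hFφ : (fun x => F x + conj (F x)) = fun x => (φ x : ℂ) := by
    refine (Continuous.ae_eq_iff_eq volume (hFc.add (Complex.continuous_conj.comp hFc))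
      (Complex.continuous_ofReal.comp hφc)).1 ?_
    filter_upwards [hFG] with x hx
    have h1 := congrFun e x
    have h2 := congrArg conj h1
    simp only [Complex.conj_ofReal, map_add, Complex.conj_conj] at h1 h2
    change F x + conj (F x) = (φ x : ℂ)
    rw [hx]
    simp only [map_mul, map_add, map_div₀, map_one, map_ofNat]
    linear_combination (-(1 / 2) : ℂ) * h1 + (-(1 / 2) : ℂ) * h2
  have hm := memSob_exp_sub_one hσ2 (by linarith) hF hFc hFp
  have hn := memSob_exp_sub_one hσ2 (by linarith) (hF.const_mul (-1)) (by fun_prop)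
    (hFp.const_mul hF.1 (-1))
  refine ⟨_, _, by fun_prop, hm.1, hm.2, hn.1, hn.2, fun x => ?_, fun x => ?_⟩
  · rw [sub_add_cancel, sub_add_cancel, ← Complex.exp_add]
    simp
  · rw [map_sub, map_one, sub_add_cancel, sub_add_cancel, ← Complex.exp_conj, ← Complex.exp_add,
      congrFun hFφ x, ← Complex.ofReal_exp, hφdef]
    simp only
    rw [Real.exp_log (hpos x)]
    have hκ0' : (κ : ℂ) ≠ 0 := by exact_mod_cast hκ0.ne'
    push_cast
    field_simp
    ring

theorem IsGauge.isBKSolution {s κ : ℝ} (hs : -(1 / 2) < s) (hs' : s < 0) (hκ : 1 ≤ κ)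
    {q : 𝓢'(ℝ, ℂ)} (hq : TemperedDistribution.MemSobolev s 2 q) (hqr : IsRealValued q)
    {m : ℝ → ℂ} (hm : IsGauge s κ q m) (hb : ∀ x, ‖m x‖ ≤ 1 / 2) :
    IsBKSolution s κ q (fun x => κ * (‖m x‖ ^ 2 + 2 * (m x).re)) := by
  have F := hm.factorization hs hs' hb
  have hc := hm.1
  -- The bound is κ + w = κ|1+m|² ≥ κ/4, since |m| ≤ 1/2.
  refine isBKSolution_iff.2 ⟨by fun_prop, F.memSob_w hs hs', ⟨κ / 4, by linarith, fun x => ?_⟩,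
    (F.bk_iff_isGauge hκ hs hs' hm.1 hq hqr).2 hm⟩
  have h1 : |(m x).re| ≤ 1 / 2 := (Complex.abs_re_le_norm _).trans (hb x)
  have h2 : |(m x).re| ≤ ‖m x‖ := Complex.abs_re_le_norm _
  have h3 : (m x).re ^ 2 ≤ ‖m x‖ ^ 2 := sq_le_sq' (by linarith [abs_le.1 h2]) (abs_le.1 h2).2
  have h4 : 1 / 4 ≤ 1 + (‖m x‖ ^ 2 + 2 * (m x).re) := by
    nlinarith [(abs_le.1 h1).1]
  have h5 := mul_le_mul_of_nonneg_left h4 (by linarith : 0 ≤ κ)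
  linarith

/-- The factor m' of an arbitrary solution solves the gauge equation, hence is m; and w is
determined by m. -/
theorem IsBKSolution.eq {s κ : ℝ} (hs : -(1 / 2) < s) (hs' : s < 0) (hκ : 1 ≤ κ)
    {q : 𝓢'(ℝ, ℂ)} (hq : TemperedDistribution.MemSobolev s 2 q) (hqr : IsRealValued q)
    {m : ℝ → ℂ} (huniq : ∀ m', IsGauge s κ q m' → m' = m) {w : ℝ → ℝ}
    (hw : IsBKSolution s κ q w) : w = fun x => κ * (‖m x‖ ^ 2 + 2 * (m x).re) := by
  obtain ⟨hc, hw2, ⟨δ, hδ, hwδ⟩, heq⟩ := isBKSolution_iff.1 hw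
  obtain ⟨m', n', hmc, F⟩ := exists_factorization hs hs' hκ hc hw2 hδ hwδ
  have h := huniq m' ((F.bk_iff_isGauge hκ hs hs' hmc hq hqr).1 heq)
  subst h
  ext x
  have h1 := congrFun F.w_eq x
  simp only [← ofReal_norm_sq_add] at h1
  exact_mod_cast h1

/-- The threshold for `κ` makes the product estimate contractive. -/
theorem prodConst_mul_le {s κ A : ℝ} (hs : -(1 / 2) < s) (hs' : s < 0) (hA : 0 < A)
    (hκ : max 1 ((4 * prodConst 1 (s + 1)) ^ (1 / (1 / 2 - |s|))) * (1 + A) ^ (1 / (1 / 2 - |s|)) ≤ κ) :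
    1 ≤ κ ∧ prodConst κ (s + 1) * (A + 1) ≤ 1 / 4 := by
  rw [abs_of_neg hs'] at hκ
  set p := 1 / 2 - -s
  have hp : 0 < p := by simp only [p]; linarith
  have hc := prodConst_nonneg 1 (s + 1)
  set c := prodConst 1 (s + 1)
  have hA1 : 1 ≤ (1 + A) ^ (1 / p) := Real.one_le_rpow (by linarith) (by positivity)
  have hκ1 : 1 ≤ κ := le_trans (by nlinarith [le_max_left 1 ((4 * c) ^ (1 / p))]) hκ
  refine ⟨hκ1, ?_⟩
  have h1 : (4 * c) ^ (1 / p) * (1 + A) ^ (1 / p) ≤ κ :=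
    (mul_le_mul_of_nonneg_right (le_max_right _ _) (by linarith)).trans hκ
  rw [← Real.mul_rpow (by positivity) (by linarith)] at h1
  -- Raised to the power p = 1/2 - |s|, the threshold reads 4c(1+A) ≤ κ^p, and `prodConst κ (s+1)`
  -- equals κ^{-p} c.
  have h2 := Real.rpow_le_rpow (by positivity) h1 hp.le
  rw [← Real.rpow_mul (by positivity), one_div_mul_cancel hp.ne', Real.rpow_one] at h2
  have e : (1 : ℝ) / 2 - (s + 1) = -p := by simp only [p]; ring
  rw [prodConst_eq hκ1, e, Real.rpow_neg (by linarith)]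
  have h3 : 0 < κ ^ p := Real.rpow_pos_of_pos (by linarith) p
  rw [mul_assoc, inv_mul_le_iff₀ h3]
  change c * (A + 1) ≤ _
  linarith

end BockKruskal

open BockKruskal in
theorem theorem4p10 (s : ℝ) (hs : -(1 / 2) < s) (hs' : s < 0) :
    ∃ C : ℝ, 1 ≤ C ∧ ∀ A : ℝ, 0 < A → ∀ q ∈ sobolevBall s A,
      ∀ κ : ℝ, C * (1 + A) ^ (1 / (1 / 2 - |s|)) ≤ κ →
        ∃ (m : ℝ → ℂ) (w : ℝ → ℝ),
          m = gauge s κ q ∧ IsGauge s κ q m ∧ (∀ m', IsGauge s κ q m' → m' = m) ∧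
          (∀ x, w x = κ * (‖m x‖ ^ 2 + 2 * (m x).re)) ∧
          HasFunctionalDeriv s (beta s κ) q (fun x => (w x / κ : ℝ)) ∧
          IsBKSolution s κ q w ∧ (∀ w', IsBKSolution s κ q w' → w' = w) := by
  refine ⟨max 1 ((4 * prodConst 1 (s + 1)) ^ (1 / (1 / 2 - |s|))), le_max_left _ _,
    fun A hA q ⟨hq, hqr, hqA⟩ κ hκ => ?_⟩
  obtain ⟨hκ1, hκA⟩ := prodConst_mul_le hs hs' hA hκ
  have hK := prodConst_nonneg κ (s + 1)
  -- The extra 1 leaves room for the variations f of norm at most 1 in the derivative of β.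
  have hδ' : prodConst κ (s + 1) * (sobolevNorm s q + 1) ≤ 1 / 4 :=
    (mul_le_mul_of_nonneg_left (by linarith) hK).trans hκA
  have hδ : prodConst κ (s + 1) * nrm κ s (fhat q) ≤ 1 / 4 := by
    refine (mul_le_mul_of_nonneg_left ?_ hK).trans hδ'
    rw [sobolevNorm_eq_nrm hq]
    linarith [nrm_le_nrm_one hκ1 hs'.le (memW_fhat hq)]
  have hm := isGauge_gauge (exists_isGauge hs hs' hκ1 hq (hδ.trans (by norm_num)))
  have huniq : ∀ m', IsGauge s κ q m' → m' = gauge s κ q :=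
    fun m' hm' => hm.unique hs hs' hκ1 hq hδ hm'
  refine ⟨gauge s κ q, fun x => κ * (‖gauge s κ q x‖ ^ 2 + 2 * (gauge s κ q x).re), rfl, hm, huniq,
    fun x => rfl, ?_, hm.isBKSolution hs hs' hκ1 hq hqr (hm.norm_le hs hs' hκ1 hq hδ),
    fun w' hw' => hw'.eq hs hs' hκ1 hq hqr huniq⟩
  have hκ0 : (κ : ℂ) ≠ 0 := by exact_mod_cast (by linarith : κ ≠ 0)
  convert hasFunctionalDeriv_beta hs hs' hκ1 hq hqr hδ' hm using 2 with x
  rw [Complex.ofReal_div, ofReal_norm_sq_add, mul_div_cancel_left₀ _ hκ0]
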